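/- **Main Theorem.** Let $\ell\ge 0$, let $f_1,\dots,f_\ell$ be entire functions on $\mathbb C$, put $f=(f_1,\dots,f_\ell)$, $|f(z)|=\big(\sum_{j=1}^\ell|f_j(z)|^2\big)^{1/2}$, $f'=(f_1',\dots,f_\ell')$, and fix $r>0$. For $n\ge 0$ let $$G_n(z)=\sum_{\nu=0}^n\ \sum_{j_1=1}^\ell\cdots\sum_{j_\nu=1}^\ell a_{j_1,\dots,j_\nu}\,f_{j_1}(z)\cdots f_{j_\nu}(z),$$ where the coefficients $a_{j_1,\dots,j_\nu}$ (one for each tuple, including a single one for $\nu=0$) are independent standard complex Gaussian random variables, i.e. with density $\frac1\pi e^{-|a|^2}$ on $\mathbb C$. On the punctured disk $D_r^*=\{0<|z|<r\}$ consider, for $n\ge 1$, the normalized counting divisor $$\mathbf Z(r,G_n)=\frac1n\sum_{G_n(z)=0,\ 0<|z|<r}\Big(\log\frac r{|z|}\Big)\delta_z ,$$ zeros being counted with multiplicity (and $\mathbf Z(r,G_n)=0$ on the null event $G_n\equiv 0$). Let $C=\{z\in\mathbb C:\ |f(z)|=1,\ f'(z)\ne 0\}$ and let $$\Xi(x)=\begin{cases}2/x,&x>1,\\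 1,&x=1,\\ 0,&x<1.\end{cases}$$ Let $\mu_C$ be the nonnegative measure on $C$ defined by the $1$-form $$\omega=\frac1{2\pi}\cdot\frac{\sqrt{-1}}2\sum_{j=1}^\ell\big(f_j\,d\overline{f_j}-\overline{f_j}\,df_j\big),$$ that is, the measure on $C$ whose density with respect to arc length (one-dimensional Hausdorff measure) at $z$ is $|\omega_z(\tau)|$, $\tau$ being a unit tangent vector of $C$ at $z$. (At a point where $C$ has no tangent line, take the supremum of $|\omega_z(\tau)|$ over the unit vectors of the tangent cone, which is $0$ if there are none.) Then, as $n\to\infty$, the expectation $\mathbf E(\mathbf Z(r,G_n))$ converges, as a distribution on $D_r^*$, to $$\log\frac r{|z|}\cdot\Big(|f|\,\Xi(|f|)\,\frac{\sqrt{-1}}{2\pi}\,\partial\bar\partial\log|f|\ +\ \mu_C\Big),$$ where the first term is read as $0$ at the points with $|f|<1$, so in particular at the common zeros of the $f_j$. Explicitly: for every continuous $\varphi:\mathbb C\to\mathbb C$ with compact support contained in $D_r^*$, the integral $\int\varphi\,d\mathbf Z(r,G_n)$ is well defined and is an integrable function of the coefficients, $\varphi\log\frac r{|z|}$ is integrable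 against both terms in the bracket, and $$\lim_{n\to\infty}\mathbf E\int\varphi\,d\mathbf Z(r,G_n)=\int_{\mathbb C}\varphi\,\log\frac r{|z|}\;|f|\,\Xi(|f|)\,\frac{\sqrt{-1}}{2\pi}\,\partial\bar\partial\log|f|+\int_C\varphi\,\log\frac r{|z|}\,d\mu_C .$$ -/

import Mathlib

open MeasureTheory Filter Topology
open scoped ENNReal ComplexConjugate

namespace RandomEntire

noncomputable section

/-- The standard complex Gaussian law `(1/π) exp(-|z|²) dx dy` on `ℂ`. -/
def stdComplexGaussian : Measure ℂ :=
  volume.withDensity (fun z => ENNReal.ofReal (Real.exp (-‖z‖ ^ 2) / Real.pi))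

/-- The multi-indices `(j_1, …, j_ν)` with `0 ≤ ν ≤ n` and all `j_k ∈ {1, …, ℓ}`;
there is exactly one multi-index with `ν = 0`. -/
abbrev MultiIndex (ℓ n : ℕ) : Type := Σ ν : Fin (n + 1), (Fin (ν : ℕ) → Fin ℓ)

/-- The joint law of the i.i.d. standard complex Gaussian coefficients. -/
def coeffLaw (ℓ n : ℕ) : Measure (MultiIndex ℓ n → ℂ) :=
  Measure.pi (fun _ => stdComplexGaussian)

/-- `G_n(z) = ∑_{ν ≤ n} ∑_{j_1, …, j_ν} a_{j_1, …, j_ν} f_{j_1}(z) ⋯ f_{j_ν}(z)`. -/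
def randomPoly {ℓ : ℕ} (f : Fin ℓ → ℂ → ℂ) (n : ℕ) (a : MultiIndex ℓ n → ℂ) (z : ℂ) : ℂ :=
  ∑ i : MultiIndex ℓ n, a i * ∏ k, f (i.2 k) z

/-- The punctured disk `0 < |z| < r`. -/
def puncturedDisk (r : ℝ) : Set ℂ := {z | 0 < ‖z‖ ∧ ‖z‖ < r}

/-- The normalized counting divisor
`Z(r, G) = (1/n) ∑_{G(z) = 0, 0 < |z| < r} log (r/|z|) δ_z`, as a measure on `ℂ`, the zeros being
counted with multiplicity. -/
def countingDivisor (r : ℝ) (n : ℕ) (G : ℂ → ℂ) : Measure ℂ :=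
  ENNReal.ofReal (1 / n) •
    Measure.sum (fun z : {z : ℂ // G z = 0 ∧ z ∈ puncturedDisk r} =>
      ((analyticOrderNatAt G z : ℝ≥0∞) * ENNReal.ofReal (Real.log (r / ‖(z : ℂ)‖))) •
        Measure.dirac (z : ℂ))

/-- `|f(z)| = (∑_j |f_j(z)|²)^{1/2}`. -/
def absF {ℓ : ℕ} (f : Fin ℓ → ℂ → ℂ) (z : ℂ) : ℝ := Real.sqrt (∑ j, ‖f j z‖ ^ 2)

/-- The function `Ξ`. -/
def Xi (x : ℝ) : ℝ := if 1 < x then 2 / x else if x = 1 then 1 else 0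

/-- The density with respect to `dx dy` of the `(1,1)`-form `(√-1/2π) ∂∂̄u`, for a real function `u`
that is twice differentiable near `z`: one has `√-1 ∂∂̄u = (1/2) (u_xx + u_yy) dx ∧ dy`. -/
def ddbarDensity (u : ℂ → ℝ) (z : ℂ) : ℝ :=
  1 / (4 * Real.pi) * Laplacian.laplacian u z

/-- `C = {z : |f(z)| = 1, f'(z) ≠ 0}`. -/
def curveC {ℓ : ℕ} (f : Fin ℓ → ℂ → ℂ) : Set ℂ :=
  {z | absF f z = 1 ∧ ∃ j, deriv (f j) z ≠ 0}

/-- The 1-form `(1/2π) (√-1/2) ∑_j (f_j d(conj f_j) - conj f_j d f_j)`. -/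
def argForm {ℓ : ℕ} (f : Fin ℓ → ℂ → ℂ) (z : ℂ) : ℂ →L[ℝ] ℂ :=
  ((1 / (2 * Real.pi) : ℂ) * (Complex.I / 2)) •
    ∑ j, (f j z • fderiv ℝ (fun w => conj (f j w)) z - conj (f j z) • fderiv ℝ (f j) z)

/-- The (nonnegative) measure defined by a 1-form `ω` on a plane curve `C`: its density with respect
to arc length (one-dimensional Hausdorff measure on `C`) is `|ω_z(τ)|`, where `τ` is a unit tangent
vector of `C` at `z`. At a point where `C` has no tangent line the largest value of `|ω_z(τ)|` over
the unit vectors `τ` of the tangent cone is taken (and `0` at an isolated point). -/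
def formMeasure (C : Set ℂ) (ω : ℂ → ℂ →L[ℝ] ℂ) : Measure ℂ :=
  ((Measure.hausdorffMeasure 1 : Measure ℂ).restrict C).withDensity
    (fun z => ⨆ τ ∈ {τ : ℂ | τ ∈ tangentConeAt ℝ C z ∧ ‖τ‖ = 1}, ‖ω z τ‖ₑ)

end

end RandomEntire

/-!
The coefficient `a` of the empty multi-index is a free additive constant in `G_n = a + H`. Given
the other coefficients, the zeros of `G_n` are the solutions of `-H = a`, so the area formula for
entire functions (`lintegral_fiberSum_entire`) integrates `a` out, and almost surely `a` is not a
critical value of `-H`, so that all zeros are simple (`ae_simple_zeros`). The integral over the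
remaining coefficients is a Gaussian moment of two linear forms
(`lintegral_normSq_mul_exp_linearForms`). The result (`lintegral_tsum_zeros_gaussian`) is the
Edelman-Kostlan density `(1/π) ∂∂̄ log K_n(z, z)` of the expected number of zeros, where here
`K_n(z, z) = 1 + v + ⋯ + v ^ n` with `v = |f|²`.

Write `c = ⟨f', f⟩ = ∂v/∂z`, let `h_n` be the logarithmic derivative of `1 + s + ⋯ + s ^ n`
divided by `n`, and put `p_n(s) = s h_n(s)`. Divided by `n`, the density is (`expectedDensity_eq`)
`(1/π) (p_n'(v) |c|² / v + h_n(v) (|f'|² - |c|² / v))`.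

In the second summand `h_n` is bounded by `1` and converges pointwise, to `0` on `[0, 1)`, to
`1/2` at `1`, and to `1/s` for `s > 1`. Dominated convergence gives the absolutely continuous part
of the limit, since `|f'|² - |c|² / v` is `2π v` times the density of `(√-1/2π) ∂∂̄ log|f|`
(`ddbarDensity_log_absF`).

In the first summand `p_n` increases from `0` to `1` and converges to the unit step at `1`, so
`p_n'(v) |∇v|²` should converge to `|∇v|` times arc length on `v = 1`, and `|∇v| = 2 |c|`. As `1`
need not be a regular value of `v`, this coarea statement is proved without a parametrization of
the curve (`IsStepApprox.exists_tendsto_integral_gradNorm`): `|∇v|²` is the sum of the squares of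
the two partial derivatives, and on a vertical line, with `g` the restriction of `v`, the function
`p_n'(g) g'²` is integrated by parts. By analyticity the solutions of `g = 1` are isolated, or `g`
is constant, and the limit is the sum of `|g'|` over the solutions
(`IsStepApprox.tendsto_integral_mul`). Integrating over the lines, by the area formula for the
projection of a level curve to an axis (`lintegral_fiberSum_levelSet`), gives arc length weighted
by `|∂v/∂y|² / |∇v|`, and the two weights add up to `|∇v|`. Finally `|c| / 2π` is the modulus of
`ω` on the unit tangent vectors of `C` (`iSup_enorm_argForm`).
-/

namespace RandomEntire

/-! ### Fibre sums of locally injective maps -/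

/-- The sum of `u` over the points of `s` in the fibre of `f` above `y`, each counted once. -/
noncomputable def fiberSum {X Y : Type*} (f : X → Y) (s : Set X) (u : X → ℝ≥0∞) (y : Y) : ℝ≥0∞ :=
  ∑' x, (s ∩ f ⁻¹' {y}).indicator u x

lemma fiberSum_of_injOn {X Y : Type*} {f : X → Y} {s : Set X} (hf : Set.InjOn f s)
    (u : X → ℝ≥0∞) {x : X} (hx : x ∈ s) : fiberSum f s u (f x) = u x := by
  unfold fiberSum
  rw [tsum_eq_single x]
  · simp [hx]
  · intro x' hx'
    apply Set.indicator_of_notMem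
    rintro ⟨h1, h2⟩
    exact hx' (hf h1 hx h2)

lemma fiberSum_of_notMem {X Y : Type*} {f : X → Y} {s : Set X} (u : X → ℝ≥0∞) {y : Y}
    (hy : y ∉ f '' s) : fiberSum f s u y = 0 := by
  unfold fiberSum
  rw [ENNReal.tsum_eq_zero]
  intro x
  apply Set.indicator_of_notMem
  rintro ⟨h1, h2⟩
  exact hy ⟨x, h1, h2⟩

lemma fiberSum_iUnion {X Y : Type*} {f : X → Y} {A : ℕ → Set X}
    (hA : Pairwise (Function.onFun Disjoint A))
    (u : X → ℝ≥0∞) (y : Y) : fiberSum f (⋃ i, A i) u y = ∑' i, fiberSum f (A i) u y := by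
  unfold fiberSum
  rw [ENNReal.tsum_comm]
  congr 1
  ext x
  by_cases hx : ∃ i, x ∈ A i
  · obtain ⟨i, hi⟩ := hx
    rw [tsum_eq_single i]
    · by_cases hy : f x = y
      · simp only [Set.indicator]
        rw [if_pos ⟨Set.mem_iUnion.2 ⟨i, hi⟩, hy⟩, if_pos ⟨hi, hy⟩]
      · simp [Set.indicator, hy]
    · intro j hj
      apply Set.indicator_of_notMem
      rintro ⟨h1, -⟩
      exact Set.disjoint_left.1 (hA hj) h1 hi
  · rw [Set.indicator_of_notMem, ENNReal.tsum_eq_zero.2]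
    · intro i
      exact Set.indicator_of_notMem (fun h => hx ⟨i, h.1⟩) _
    · rintro ⟨h, -⟩
      exact hx (Set.mem_iUnion.1 h)

lemma fiberSum_indicator {X Y : Type*} {f : X → Y} {s B : Set X} (hB : B ⊆ s)
    (y : Y) : fiberSum f s (B.indicator 1) y = fiberSum f B 1 y := by
  unfold fiberSum
  congr 1
  ext x
  by_cases hx : x ∈ B
  · have := hB hx
    by_cases hy : f x = y <;> simp [Set.indicator, hx, this, hy]
  · simp [Set.indicator, hx]

/-- If a hereditary property of sets holds locally on `s`, then `s` splits into countably many
disjoint Borel pieces that have it. -/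
lemma exists_measurable_partition {X : Type*} [TopologicalSpace X] [SecondCountableTopology X]
    [MeasurableSpace X] [OpensMeasurableSpace X] {s : Set X} (hs : MeasurableSet s)
    {P : Set X → Prop} (h0 : P ∅) (hP : ∀ A B, A ⊆ B → P B → P A)
    (hloc : ∀ x ∈ s, ∃ U ∈ 𝓝 x, P (s ∩ U)) :
    ∃ A : ℕ → Set X, (∀ n, MeasurableSet (A n)) ∧ Pairwise (Function.onFun Disjoint A) ∧
      ⋃ n, A n = s ∧ ∀ n, P (A n) := by
  have hopen : ∀ x : X, ∃ U, IsOpen U ∧ P (s ∩ U) ∧ (x ∈ s → x ∈ U) := by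
    intro x
    by_cases hx : x ∈ s
    · obtain ⟨U, hU, hPU⟩ := hloc x hx
      obtain ⟨V, hVU, hVo, hxV⟩ := mem_nhds_iff.1 hU
      exact ⟨V, hVo, hP _ _ (Set.inter_subset_inter_right s hVU) hPU, fun _ => hxV⟩
    · exact ⟨∅, isOpen_empty, by simpa using h0, fun h => (hx h).elim⟩
  choose U hUo hUP hUx using hopen
  obtain ⟨t, -, htc, hst⟩ := TopologicalSpace.countable_cover_nhdsWithin (f := U) (s := s)
    (fun x hx => mem_nhdsWithin_of_mem_nhds ((hUo x).mem_nhds (hUx x hx)))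
  rcases t.eq_empty_or_nonempty with rfl | hne
  · have : s = ∅ := by simpa using hst
    subst this
    exact ⟨fun _ => ∅, by simp, fun _ _ _ => by simp [Function.onFun], by simp, fun _ => h0⟩
  obtain ⟨g, rfl⟩ := htc.exists_eq_range hne
  refine ⟨disjointed (fun n => s ∩ U (g n)), ?_, disjoint_disjointed _, ?_, ?_⟩
  · exact fun n => MeasurableSet.disjointed (fun n => hs.inter (hUo _).measurableSet) n
  · rw [iUnion_disjointed]
    apply Set.Subset.antisymm
    · exact Set.iUnion_subset fun n => Set.inter_subset_left
    · intro x hx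
      have := hst hx
      simp only [Set.mem_range, Set.iUnion_exists, Set.iUnion_iUnion_eq', Set.mem_iUnion] at this
      obtain ⟨n, hn⟩ := this
      exact Set.mem_iUnion.2 ⟨n, hx, hn⟩
  · exact fun n => hP _ _ (disjointed_subset _ n) (hUP (g n))

lemma exists_measure_fiberSum_of_injOn {X Y : Type*} [TopologicalSpace X] [PolishSpace X]
    [MeasurableSpace X] [BorelSpace X] [TopologicalSpace Y] [T2Space Y] [MeasurableSpace Y]
    [BorelSpace Y] (μ : Measure Y) {f : X → Y} (hf : Continuous f) {s : Set X}
    (hs : MeasurableSet s) (hinj : Set.InjOn f s) :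
    ∃ η : Measure X, ∀ u : X → ℝ≥0∞, Measurable u →
      Measurable (fiberSum f s u) ∧ ∫⁻ x, u x ∂η = ∫⁻ y, fiberSum f s u y ∂μ := by
  have he := ContinuousOn.measurableEmbedding hs hf.continuousOn hinj
  set e := s.domRestrict f with hedef
  refine ⟨(μ.comap e).map Subtype.val, fun u hu => ?_⟩
  have hfs : ∀ x : s, fiberSum f s u (e x) = u x := fun x => fiberSum_of_injOn hinj u x.2
  have hr : Set.range e = f '' s := Set.range_domRestrict f s
  have hext : fiberSum f s u = Function.extend e (fun x : s => u x) 0 := by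
    ext y
    by_cases hy : ∃ x, e x = y
    · obtain ⟨x, rfl⟩ := hy
      rw [he.injective.extend_apply, hfs]
    · rw [Function.extend_apply' _ _ _ hy, fiberSum_of_notMem]
      · rfl
      · rw [← hr]; exact hy
  have hm : Measurable (fiberSum f s u) := by
    rw [hext]
    exact he.measurable_extend (hu.comp measurable_subtype_coe) measurable_zero
  refine ⟨hm, ?_⟩
  rw [lintegral_map hu measurable_subtype_coe]
  have h1 : ∫⁻ y, fiberSum f s u y ∂μ = ∫⁻ y in Set.range e, fiberSum f s u y ∂μ := by
    rw [setLIntegral_eq_of_support_subset]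
    intro y hy
    by_contra h
    rw [hr] at h
    exact hy (fiberSum_of_notMem u h)
  rw [h1, ← he.map_comap, he.lintegral_map]
  simp_rw [hfs]

/-- For a locally injective map, integrating the fibre sums of `u` is integrating `u` against a
measure upstairs. -/
lemma exists_measure_fiberSum {X Y : Type*} [TopologicalSpace X] [PolishSpace X]
    [MeasurableSpace X] [BorelSpace X] [TopologicalSpace Y] [T2Space Y] [MeasurableSpace Y]
    [BorelSpace Y] (μ : Measure Y) {f : X → Y} (hf : Continuous f) {s : Set X}
    (hs : MeasurableSet s) (hinj : ∀ x ∈ s, ∃ U ∈ 𝓝 x, Set.InjOn f (s ∩ U)) :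
    ∃ η : Measure X, ∀ u : X → ℝ≥0∞, Measurable u →
      Measurable (fiberSum f s u) ∧ ∫⁻ x, u x ∂η = ∫⁻ y, fiberSum f s u y ∂μ := by
  obtain ⟨A, hAm, hAd, hAs, hAi⟩ := exists_measurable_partition hs (P := Set.InjOn f)
    (Set.injOn_empty _) (fun A B h hB => hB.mono h) hinj
  choose η hη using fun n => exists_measure_fiberSum_of_injOn μ hf (hAm n) (hAi n)
  refine ⟨Measure.sum η, fun u hu => ?_⟩
  have : fiberSum f s u = fun y => ∑' n, fiberSum f (A n) u y := by
    ext y; rw [← hAs, fiberSum_iUnion hAd]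
  rw [this]
  refine ⟨Measurable.tsum fun n => (hη n u hu).1, ?_⟩
  rw [lintegral_sum_measure, lintegral_tsum fun n => ((hη n u hu).1).aemeasurable]
  exact tsum_congr fun n => (hη n u hu).2

/-- A measure carried by `s` that is locally on `s` at most `ν` is at most `ν`. -/
lemma measure_le_of_locally_le {X : Type*} [TopologicalSpace X] [SecondCountableTopology X]
    [MeasurableSpace X] [OpensMeasurableSpace X] {s : Set X} (hs : MeasurableSet s)
    {η ν : Measure X} (hη : η sᶜ = 0)
    (hloc : ∀ x ∈ s, ∃ U ∈ 𝓝 x, ∀ B ⊆ s ∩ U, MeasurableSet B → η B ≤ ν B) : η ≤ ν := by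
  obtain ⟨A, hAm, hAd, hAs, hAi⟩ := exists_measurable_partition hs
    (P := fun C => ∀ B ⊆ C, MeasurableSet B → η B ≤ ν B)
    (by intro B hB _; rw [Set.subset_empty_iff.1 hB]; simp) (fun A B h hB C hC => hB C (hC.trans h))
    hloc
  rw [Measure.le_iff]
  intro B hB
  have key : ∀ m : Measure X, m (B ∩ s) = ∑' n, m (B ∩ A n) := by
    intro m
    rw [← hAs, Set.inter_iUnion, measure_iUnion]
    · exact fun i j hij => (hAd hij).mono Set.inter_subset_right Set.inter_subset_right
    · exact fun n => hB.inter (hAm n)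
  calc η B ≤ η (B ∩ s) + η sᶜ := by
        refine (measure_mono ?_).trans (measure_union_le _ _)
        intro x hx
        by_cases h : x ∈ s
        · exact Or.inl ⟨hx, h⟩
        · exact Or.inr h
    _ = ∑' n, η (B ∩ A n) := by rw [hη, add_zero, key]
    _ ≤ ∑' n, ν (B ∩ A n) :=
        ENNReal.tsum_le_tsum fun n => hAi n _ Set.inter_subset_right (hB.inter (hAm n))
    _ = ν (B ∩ s) := (key ν).symm
    _ ≤ ν B := measure_mono Set.inter_subset_left

lemma fiberSum_one_of_injOn {X Y : Type*} {f : X → Y} {B : Set X} (hB : Set.InjOn f B) :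
    fiberSum f B 1 = (f '' B).indicator 1 := by
  ext y
  by_cases hy : y ∈ f '' B
  · obtain ⟨x, hx, rfl⟩ := hy
    rw [fiberSum_of_injOn hB _ hx, Set.indicator_of_mem (Set.mem_image_of_mem f hx)]
    rfl
  · rw [fiberSum_of_notMem _ hy, Set.indicator_of_notMem hy]

lemma measure_eq_of_injOn {X Y : Type*} [TopologicalSpace X] [PolishSpace X]
    [MeasurableSpace X] [BorelSpace X] [TopologicalSpace Y] [T2Space Y] [MeasurableSpace Y]
    [BorelSpace Y] {μ : Measure Y} {f : X → Y} (hf : Continuous f) {s : Set X} {η : Measure X}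
    (hη : ∀ u : X → ℝ≥0∞, Measurable u → ∫⁻ x, u x ∂η = ∫⁻ y, fiberSum f s u y ∂μ)
    {B : Set X} (hBs : B ⊆ s) (hBm : MeasurableSet B) (hB : Set.InjOn f B) :
    η B = μ (f '' B) := by
  have h1 := hη (B.indicator 1) (measurable_one.indicator hBm)
  rw [lintegral_indicator_one hBm] at h1
  rw [h1]
  simp_rw [fiberSum_indicator hBs, fiberSum_one_of_injOn hB]
  rw [lintegral_indicator_one (hBm.image_of_continuousOn_injOn hf.continuousOn hB)]

lemma measure_compl_eq_zero_of_fiberSum {X Y : Type*} [MeasurableSpace X] [MeasurableSpace Y]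
    {μ : Measure Y} {f : X → Y} {s : Set X} (hs : MeasurableSet s) {η : Measure X}
    (hη : ∀ u : X → ℝ≥0∞, Measurable u → ∫⁻ x, u x ∂η = ∫⁻ y, fiberSum f s u y ∂μ) :
    η sᶜ = 0 := by
  have h1 := hη (sᶜ.indicator 1) (measurable_one.indicator hs.compl)
  rw [lintegral_indicator_one hs.compl] at h1
  rw [h1]
  have : ∀ y, fiberSum f s (sᶜ.indicator 1) y = 0 := by
    intro y
    unfold fiberSum
    rw [ENNReal.tsum_eq_zero]
    intro x
    by_cases hx : x ∈ s <;> simp [Set.indicator, hx]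
  simp [this]

/-! ### The area formula for entire functions -/

lemma abs_det_restrictScalars_toSpanSingleton {H' : ℂ} :
    |((ContinuousLinearMap.toSpanSingleton ℂ H' : ℂ →L[ℂ] ℂ).restrictScalars ℝ).det| =
      ‖H'‖ ^ 2 := by
  simp [ContinuousLinearMap.det, LinearMap.det_restrictScalars,
      Algebra.norm_complex_eq, Complex.normSq_eq_norm_sq]

/-- Area formula for an entire function, the fibre sums being taken without multiplicities. -/
theorem lintegral_fiberSum_entire {H : ℂ → ℂ} (hH : Differentiable ℂ H) {u ρ : ℂ → ℝ≥0∞}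
    (hu : Measurable u) (hρ : Measurable ρ) :
    ∫⁻ w, fiberSum H Set.univ u w * ρ w = ∫⁻ z, u z * ‖deriv H z‖ₑ ^ 2 * ρ (H z) := by
  have hd : Continuous (deriv H) := (hH.contDiff (n := 1)).continuous_deriv le_rfl
  set s : Set ℂ := {z | deriv H z ≠ 0} with hsdef
  have hso : IsOpen s := isOpen_ne_fun hd continuous_const
  have hs : MeasurableSet s := hso.measurableSet
  have hfd : ∀ z, HasFDerivAt H
      ((ContinuousLinearMap.toSpanSingleton ℂ (deriv H z)).restrictScalars ℝ) z :=
    fun z => ((hH z).hasDerivAt.hasFDerivAt).restrictScalars ℝ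
  -- The critical values form a null set, and `H` is locally injective off the critical points.
  have hcrit : volume (H '' sᶜ) = 0 := by
    refine addHaar_image_eq_zero_of_det_fderivWithin_eq_zero volume
      (fun z _ => (hfd z).hasFDerivWithinAt) fun z hz => ?_
    have : deriv H z = 0 := by simpa [hsdef] using hz
    rw [← abs_eq_zero, abs_det_restrictScalars_toSpanSingleton, this]
    simp
  have hinj : ∀ z ∈ s, ∃ U ∈ 𝓝 z, Set.InjOn H (s ∩ U) := by
    intro z hz
    have h1 := ((hH.contDiff (n := 1)).contDiffAt (x := z)).hasStrictDerivAt (by simp)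
    have h2 := h1.hasStrictFDerivAt_equiv hz
    refine ⟨(h2.toOpenPartialHomeomorph H).source,
      (h2.toOpenPartialHomeomorph H).open_source.mem_nhds h2.mem_toOpenPartialHomeomorph_source, ?_⟩
    exact (h2.toOpenPartialHomeomorph H).injOn.mono Set.inter_subset_right
  obtain ⟨η, hη⟩ := exists_measure_fiberSum volume hH.continuous hs hinj
  have hden : Measurable fun z => ‖deriv H z‖ₑ ^ 2 := (hd.measurable.enorm).pow_const 2
  have hηB : ∀ B ⊆ s, MeasurableSet B → Set.InjOn H B →
      η B = ((volume.restrict s).withDensity fun z => ‖deriv H z‖ₑ ^ 2) B := by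
    intro B hBs hBm hBi
    rw [measure_eq_of_injOn hH.continuous (fun u hu => (hη u hu).2) hBs hBm hBi,
      ← lintegral_abs_det_fderiv_eq_addHaar_image volume hBm
        (fun z _ => (hfd z).hasFDerivWithinAt) hBi, withDensity_apply _ hBm,
      Measure.restrict_restrict hBm, Set.inter_eq_left.2 hBs]
    refine lintegral_congr fun z => ?_
    rw [abs_det_restrictScalars_toSpanSingleton, ENNReal.ofReal_pow (norm_nonneg _), ofReal_norm]
  have hηeq : η = (volume.restrict s).withDensity fun z => ‖deriv H z‖ₑ ^ 2 := by
    apply le_antisymm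
    · refine measure_le_of_locally_le hs
        (measure_compl_eq_zero_of_fiberSum hs (fun u hu => (hη u hu).2)) fun z hz => ?_
      obtain ⟨U, hU, hUi⟩ := hinj z hz
      exact ⟨U, hU, fun B hB hBm =>
        (hηB B (hB.trans Set.inter_subset_left) hBm (hUi.mono hB)).le⟩
    · refine measure_le_of_locally_le hs ?_ fun z hz => ?_
      · refine withDensity_absolutelyContinuous _ _ ?_
        rw [Measure.restrict_apply hs.compl]
        simp
      obtain ⟨U, hU, hUi⟩ := hinj z hz
      exact ⟨U, hU, fun B hB hBm =>
        (hηB B (hB.trans Set.inter_subset_left) hBm (hUi.mono hB)).ge⟩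
  have hae : ∀ᵐ w, fiberSum H Set.univ u w * ρ w = fiberSum H s (fun z => u z * ρ (H z)) w := by
    have : ∀ᵐ w, w ∉ H '' sᶜ := measure_eq_zero_iff_ae_notMem.1 hcrit
    filter_upwards [this] with w hw
    unfold fiberSum
    rw [← ENNReal.tsum_mul_right]
    congr 1
    ext z
    by_cases hz : H z = w
    · have : z ∈ s := by
        by_contra h
        exact hw ⟨z, h, hz⟩
      simp [Set.indicator, hz, this]
    · simp [Set.indicator, hz]
  have hm : Measurable fun z => u z * ρ (H z) := hu.mul (hρ.comp hH.continuous.measurable)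
  rw [lintegral_congr_ae hae, ← (hη _ hm).2, hηeq,
    lintegral_withDensity_eq_lintegral_mul _ hden hm, ← lintegral_indicator hs]
  refine lintegral_congr fun z => ?_
  by_cases hz : z ∈ s
  · simp [Set.indicator, hz]; ring
  · have : deriv H z = 0 := by simpa [hsdef] using hz
    simp [this, Set.indicator, hz]

/-! ### The projection of a level curve to the horizontal axis -/

/-- The Euclidean length of the gradient of a real function on the plane. -/
noncomputable def gradNorm (v : ℂ → ℝ) (z : ℂ) : ℝ :=
  Real.sqrt (fderiv ℝ v z 1 ^ 2 + fderiv ℝ v z Complex.I ^ 2)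

lemma fderiv_apply_eq_re_im (v : ℂ → ℝ) (z d : ℂ) :
    fderiv ℝ v z d = fderiv ℝ v z 1 * d.re + fderiv ℝ v z Complex.I * d.im := by
  conv_lhs => rw [show d = d.re • (1 : ℂ) + d.im • Complex.I by
    simp [Complex.re_add_im]]
  rw [map_add, map_smul, map_smul]
  simp [mul_comm]

/-- A displacement `(d1, d2)` that is almost orthogonal to the gradient `(X, Y)` is shortened by the
projection to the `x`-axis by a factor within `t` of `|Y| / |(X, Y)|`. Displacements between nearby
points of a level curve are of this kind. -/
lemma re_bilipschitz_of_strict {X Y δ d1 d2 D t : ℝ} (hY : Y ≠ 0) (ht : 1 < t)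
    (hδ : δ = |Y| * (1 - 1 / t) / 2) (hD : D = Real.sqrt (d1 ^ 2 + d2 ^ 2))
    (h : |X * d1 + Y * d2| ≤ δ * D) :
    |d1| ≤ t * (|Y| / Real.sqrt (X ^ 2 + Y ^ 2)) * D ∧
      D ≤ t * (Real.sqrt (X ^ 2 + Y ^ 2) / |Y|) * |d1| := by
  have hYp : 0 < |Y| := abs_pos.2 hY
  set N := Real.sqrt (X ^ 2 + Y ^ 2) with hN
  have hN2 : N ^ 2 = X ^ 2 + Y ^ 2 := Real.sq_sqrt (by positivity)
  have hD2 : D ^ 2 = d1 ^ 2 + d2 ^ 2 := by rw [hD]; exact Real.sq_sqrt (by positivity)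
  have hD0 : 0 ≤ D := by rw [hD]; positivity
  have hNp : 0 < N := Real.sqrt_pos.2 (by positivity)
  have hXN : |X| ≤ N := Real.abs_le_sqrt (by nlinarith)
  have hYN : |Y| ≤ N := Real.abs_le_sqrt (by nlinarith)
  have ht0 : 0 < t := by linarith
  have hti : 1 / t < 1 := by rw [div_lt_one ht0]; exact ht
  have hti0 : 0 < 1 / t := by positivity
  have hδ0 : 0 < δ := by rw [hδ]; have : 0 < 1 - 1 / t := by linarith
                         positivity
  have hδY : 2 * δ = |Y| - |Y| / t := by rw [hδ]; field_simp
  have hδN : δ ≤ N := by nlinarith [mul_pos hYp hti0]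
  -- `P` and `Q` are `N` times the components of the displacement along `(X, Y)` and across it.
  set P := X * d1 + Y * d2 with hP
  set Q := X * d2 - Y * d1 with hQ
  have hPQ : P ^ 2 + Q ^ 2 = N ^ 2 * D ^ 2 := by rw [hN2, hD2, hP, hQ]; ring
  have hd1 : N ^ 2 * d1 = X * P - Y * Q := by rw [hN2, hP, hQ]; ring
  have hQle : |Q| ≤ N * D := by
    apply abs_le_of_sq_le_sq _ (by positivity)
    nlinarith [sq_nonneg P]
  have hQge : (N - δ) * D ≤ |Q| := by
    have hP2 : P ^ 2 ≤ (δ * D) ^ 2 := by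
      rw [← sq_abs P]; exact pow_le_pow_left₀ (abs_nonneg _) h 2
    have : ((N - δ) * D) ^ 2 ≤ Q ^ 2 := by
      have : 0 ≤ δ * (N - δ) * D ^ 2 := by
        have : 0 ≤ N - δ := by linarith
        positivity
      have e : ((N - δ) * D) ^ 2 + 2 * (δ * (N - δ) * D ^ 2) + (δ * D) ^ 2 = N ^ 2 * D ^ 2 := by
        ring
      linarith
    rw [← sq_abs Q] at this
    exact le_of_sq_le_sq this (abs_nonneg _)
  have hXP : |X * P| ≤ N * (δ * D) := by
    rw [abs_mul]; exact mul_le_mul hXN h (abs_nonneg _) hNp.le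
  have hYQ : |Y * Q| = |Y| * |Q| := abs_mul _ _
  have habs : N ^ 2 * |d1| = |X * P - Y * Q| := by
    rw [← hd1, abs_mul, abs_of_pos (pow_pos hNp 2)]
  constructor
  · have h1 : N ^ 2 * |d1| ≤ N * (δ * D) + |Y| * (N * D) := by
      rw [habs]
      refine (abs_sub _ _).trans (add_le_add hXP ?_)
      rw [hYQ]; exact mul_le_mul_of_nonneg_left hQle hYp.le
    have h2 : N * |d1| ≤ (δ + |Y|) * D := by
      have : N * (N * |d1|) ≤ N * ((δ + |Y|) * D) := by linarith
      exact le_of_mul_le_mul_left this hNp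
    have h3 : δ + |Y| ≤ t * |Y| := by
      rw [hδ]
      have : 1 - 1 / t ≤ t - 1 := by
        rw [sub_le_sub_iff, ← sub_nonneg]
        have : t + t - (1 + 1) = 2 * (t - 1) := by ring
        have h5 : t + 1/t - 2 = (t - 1) ^ 2 / t := by field_simp; ring
        have h6 : 0 ≤ (t - 1) ^ 2 / t := by positivity
        linarith
      have := mul_le_mul_of_nonneg_left this hYp.le
      linarith
    rw [show t * (|Y| / N) * D = (t * |Y| * D) / N by ring, le_div_iff₀ hNp]
    have := mul_le_mul_of_nonneg_right h3 hD0
    linarith [mul_comm N |d1|]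
  · have h1 : |Y| * ((N - δ) * D) - N * (δ * D) ≤ N ^ 2 * |d1| := by
      rw [habs]
      have := abs_sub_abs_le_abs_sub (Y * Q) (X * P)
      rw [abs_sub_comm, hYQ] at this
      have h4 := mul_le_mul_of_nonneg_left hQge hYp.le
      linarith
    have h2 : N * (|Y| / t) * D ≤ N ^ 2 * |d1| := by
      refine le_trans ?_ h1
      have : |Y| / t = |Y| - 2 * δ := by linarith
      rw [this]
      have : 0 ≤ δ * D * (N - |Y|) := by
        have : 0 ≤ N - |Y| := by linarith
        positivity
      linarith
    have h3 : (|Y| / t) * D ≤ N * |d1| := by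
      have : N * ((|Y| / t) * D) ≤ N * (N * |d1|) := by linarith
      exact le_of_mul_le_mul_left this hNp
    rw [show t * (N / |Y|) * |d1| = (N * |d1|) * t / |Y| by ring, le_div_iff₀ hYp]
    have h4 := mul_le_mul_of_nonneg_right h3 ht0.le
    have h5 : |Y| / t * D * t = D * |Y| := by field_simp
    linarith

lemma continuous_fderiv_apply_const {v : ℂ → ℝ} (hv : ContDiff ℝ 1 v) (e : ℂ) :
    Continuous fun z => fderiv ℝ v z e :=
  (hv.continuous_fderiv (by norm_num)).clm_apply continuous_const

lemma continuous_gradNorm {v : ℂ → ℝ} (hv : ContDiff ℝ 1 v) : Continuous (gradNorm v) :=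
  Real.continuous_sqrt.comp (((continuous_fderiv_apply_const hv 1).pow 2).add
    ((continuous_fderiv_apply_const hv Complex.I).pow 2))

lemma gradNorm_pos {v : ℂ → ℝ} {z : ℂ} (hz : fderiv ℝ v z Complex.I ≠ 0) : 0 < gradNorm v z :=
  Real.sqrt_pos.2 (by positivity)

/-- Near a point where `∂v/∂y ≠ 0` the projection of a level set of `v` to the `x`-axis is
bilipschitz with constants as close as desired to the derivative of arc length. -/
lemma exists_nhds_re_bilipschitz {v : ℂ → ℝ} (hv : ContDiff ℝ 1 v) {z₀ : ℂ}
    (hz₀ : fderiv ℝ v z₀ Complex.I ≠ 0) {t : ℝ} (ht : 1 < t) {L : ℝ} :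
    ∃ U ∈ 𝓝 z₀, ∀ z ∈ U, ∀ w ∈ U, v z = L → v w = L →
      |z.re - w.re| ≤ t * (|fderiv ℝ v z₀ Complex.I| / gradNorm v z₀) * ‖z - w‖ ∧
      ‖z - w‖ ≤ t * (gradNorm v z₀ / |fderiv ℝ v z₀ Complex.I|) * |z.re - w.re| := by
  have hs : HasStrictFDerivAt v (fderiv ℝ v z₀) z₀ :=
    (hv.contDiffAt).hasStrictFDerivAt (by norm_num)
  have hδ : 0 < |fderiv ℝ v z₀ Complex.I| * (1 - 1 / t) / 2 := by
    have : 1 / t < 1 := by rw [div_lt_one (by linarith)]; exact ht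
    have : 0 < 1 - 1 / t := by linarith
    have := abs_pos.2 hz₀
    positivity
  have h1 := hs.isLittleO.def hδ
  rw [nhds_prod_eq, Filter.Eventually, Filter.mem_prod_same_iff] at h1
  obtain ⟨U, hU, hUU⟩ := h1
  refine ⟨U, hU, fun z hz w hw hvz hvw => ?_⟩
  have h2 := hUU (Set.mk_mem_prod hz hw)
  simp only [Set.mem_ofPred_eq, hvz, hvw, sub_self, zero_sub, Real.norm_eq_abs, abs_neg] at h2
  rw [fderiv_apply_eq_re_im] at h2
  have := re_bilipschitz_of_strict (D := ‖z - w‖) hz₀ ht rfl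
    (by rw [Complex.norm_eq_sqrt_sq_add_sq]) h2
  simpa [gradNorm] using this

/-- Area formula for the projection of a level curve to the `x`-axis. -/
theorem lintegral_fiberSum_levelSet {v : ℂ → ℝ} (hv : ContDiff ℝ 1 v) (L : ℝ) {u : ℂ → ℝ≥0∞}
    (hu : Measurable u) :
    ∫⁻ x : ℝ, fiberSum Complex.re {z | v z = L ∧ fderiv ℝ v z Complex.I ≠ 0} u x =
      ∫⁻ z in {z | v z = L}, u z * ENNReal.ofReal (|fderiv ℝ v z Complex.I| / gradNorm v z)
        ∂(Measure.hausdorffMeasure 1) := by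
  set s : Set ℂ := {z | v z = L ∧ fderiv ℝ v z Complex.I ≠ 0} with hsdef
  set c : ℂ → ℝ := fun z => |fderiv ℝ v z Complex.I| / gradNorm v z with hcdef
  have hY := continuous_fderiv_apply_const hv Complex.I
  have hN := continuous_gradNorm hv
  have hcm : Measurable c := hY.measurable.abs.div hN.measurable
  have hs : MeasurableSet s :=
    (isClosed_eq hv.continuous continuous_const).measurableSet.inter
      (isOpen_ne_fun hY continuous_const).measurableSet
  have hinj : ∀ z ∈ s, ∃ U ∈ 𝓝 z, Set.InjOn Complex.re (s ∩ U) := by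
    intro z hz
    obtain ⟨U, hU, hUb⟩ := exists_nhds_re_bilipschitz hv hz.2 (one_lt_two) (L := L)
    refine ⟨U, hU, fun x hx y hy hxy => ?_⟩
    have := (hUb x hx.2 y hy.2 hx.1.1 hy.1.1).2
    rw [hxy, sub_self, abs_zero, mul_zero] at this
    exact sub_eq_zero.1 (norm_le_zero_iff.1 this)
  obtain ⟨η, hη⟩ := exists_measure_fiberSum (volume : Measure ℝ) Complex.continuous_re hs hinj
  set ν : Measure ℂ := ((Measure.hausdorffMeasure 1 : Measure ℂ).restrict s).withDensity
    (fun z => ENNReal.ofReal (c z)) with hνdef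
  have hcm' : Measurable fun z => ENNReal.ofReal (c z) := hcm.ennreal_ofReal
  have hνB : ∀ B ⊆ s, MeasurableSet B →
      ν B = ∫⁻ z in B, ENNReal.ofReal (c z) ∂(Measure.hausdorffMeasure 1) := by
    intro B hBs hBm
    rw [hνdef, withDensity_apply _ hBm, Measure.restrict_restrict hBm, Set.inter_eq_left.2 hBs]
  -- Near each point of the curve the two measures agree up to the factor `t ^ 2`.
  have hloc : ∀ t : ℝ, 1 < t → ∀ z ∈ s, ∃ U ∈ 𝓝 z, ∀ B ⊆ s ∩ U, MeasurableSet B →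
      η B ≤ ENNReal.ofReal (t ^ 2) * ν B ∧ ν B ≤ ENNReal.ofReal (t ^ 2) * η B := by
    intro t ht z₀ hz₀
    have ht0 : 0 < t := by linarith
    obtain ⟨U₁, hU₁, hUb⟩ := exists_nhds_re_bilipschitz hv hz₀.2 ht (L := L)
    obtain ⟨U₂, hU₂, hUi⟩ := hinj z₀ hz₀
    have hNp := gradNorm_pos hz₀.2
    have hYp := abs_pos.2 hz₀.2
    have hc0 : 0 < c z₀ := div_pos hYp hNp
    have hcc : ContinuousAt c z₀ := hY.abs.continuousAt.div hN.continuousAt hNp.ne'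
    have hU₃ : ∀ᶠ z in 𝓝 z₀, c z < t * c z₀ ∧ c z₀ / t < c z :=
      (hcc.eventually_lt continuousAt_const (by nlinarith)).and
        (continuousAt_const.eventually_lt hcc (by rw [div_lt_iff₀ ht0]; nlinarith))
    refine ⟨U₁ ∩ U₂ ∩ {z | c z < t * c z₀ ∧ c z₀ / t < c z},
      inter_mem (inter_mem hU₁ hU₂) hU₃, fun B hB hBm => ?_⟩
    have hBs : B ⊆ s := fun z hz => (hB hz).1
    have hB1 : B ⊆ U₁ := fun z hz => (hB hz).2.1.1
    have hBi : Set.InjOn Complex.re B := hUi.mono (show B ⊆ s ∩ U₂ from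
      fun z hz => ⟨hBs hz, (hB hz).2.1.2⟩)
    have hηB := measure_eq_of_injOn Complex.continuous_re (fun u hu => (hη u hu).2) hBs hBm hBi
    rw [hνB B hBs hBm]
    have hlip : LipschitzOnWith (Real.toNNReal (t * c z₀)) Complex.re B :=
      LipschitzOnWith.of_dist_le_mul fun x hx y hy => by
        rw [Real.coe_toNNReal _ (by positivity), Real.dist_eq, dist_eq_norm]
        exact (hUb x (hB1 hx) y (hB1 hy) (hBs hx).1 (hBs hy).1).1
    have hanti : AntilipschitzWith (Real.toNNReal (t / c z₀)) (B.domRestrict Complex.re) :=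
      AntilipschitzWith.of_le_mul_dist fun x y => by
        rw [Real.coe_toNNReal _ (by positivity), Real.dist_eq, Subtype.dist_eq, dist_eq_norm]
        have := (hUb x (hB1 x.2) y (hB1 y.2) (hBs x.2).1 (hBs y.2).1).2
        have e : t * (gradNorm v z₀ / |fderiv ℝ v z₀ Complex.I|) = t / c z₀ := by
          rw [hcdef]; field_simp
        rw [e] at this
        exact this
    have h1 : η B ≤ ENNReal.ofReal (t * c z₀) * Measure.hausdorffMeasure 1 B := by
      rw [hηB, ← hausdorffMeasure_real]
      have := hlip.hausdorffMeasure_image_le (d := 1) zero_le_one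
      simpa [ENNReal.ofReal] using this
    have h2 : Measure.hausdorffMeasure 1 B ≤ ENNReal.ofReal (t / c z₀) * η B := by
      rw [hηB, ← hausdorffMeasure_real]
      have := hanti.le_hausdorffMeasure_image (d := 1) zero_le_one Set.univ
      rw [Set.image_univ, Set.range_domRestrict] at this
      have e : Measure.hausdorffMeasure 1 (Set.univ : Set B) = Measure.hausdorffMeasure 1 B := by
        have := (isometry_subtype_coe (s := B)).hausdorffMeasure_image (d := 1)
          (Or.inl zero_le_one) Set.univ
        rw [← this]; simp
      rw [e] at this
      simpa [ENNReal.ofReal] using this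
    have h3 : ENNReal.ofReal (c z₀ / t) * Measure.hausdorffMeasure 1 B ≤
        ∫⁻ z in B, ENNReal.ofReal (c z) ∂(Measure.hausdorffMeasure 1) := by
      rw [← setLIntegral_const]
      exact setLIntegral_mono hcm' fun z hz => ENNReal.ofReal_le_ofReal (hB hz).2.2.2.le
    have h4 : ∫⁻ z in B, ENNReal.ofReal (c z) ∂(Measure.hausdorffMeasure 1) ≤
        ENNReal.ofReal (t * c z₀) * Measure.hausdorffMeasure 1 B := by
      rw [← setLIntegral_const]
      exact setLIntegral_mono measurable_const fun z hz =>
        ENNReal.ofReal_le_ofReal (hB hz).2.2.1.le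
    constructor
    · refine h1.trans ?_
      refine le_trans ?_ (mul_le_mul_right h3 _)
      rw [← mul_assoc, ← ENNReal.ofReal_mul (by positivity)]
      rw [show t ^ 2 * (c z₀ / t) = t * c z₀ by field_simp]
    · refine h4.trans ((mul_le_mul_right h2 _).trans ?_)
      rw [← mul_assoc, ← ENNReal.ofReal_mul (by positivity)]
      rw [show t * c z₀ * (t / c z₀) = t ^ 2 by field_simp]
  have hηs := measure_compl_eq_zero_of_fiberSum hs (fun u hu => (hη u hu).2)
  have hνs : ν sᶜ = 0 := by
    refine withDensity_absolutelyContinuous _ _ ?_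
    rw [Measure.restrict_apply hs.compl]
    simp
  -- The factor `t ^ 2` may be taken arbitrarily close to `1`.
  have hle : ∀ (m₁ m₂ : Measure ℂ), (∀ t : ℝ, 1 < t → m₁ ≤ ENNReal.ofReal (t ^ 2) • m₂) →
      m₁ ≤ m₂ := by
    intro m₁ m₂ h
    rw [Measure.le_iff]
    intro B _
    have hlim : Tendsto (fun t : ℝ => ENNReal.ofReal (t ^ 2) * m₂ B) (𝓝[>] 1) (𝓝 (1 * m₂ B)) := by
      refine ENNReal.Tendsto.mul_const ?_ (Or.inl one_ne_zero)
      have : Tendsto (fun t : ℝ => ENNReal.ofReal (t ^ 2)) (𝓝 1) (𝓝 (ENNReal.ofReal (1 ^ 2))) :=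
        (ENNReal.continuous_ofReal.comp (continuous_pow 2)).tendsto 1
      rw [one_pow, ENNReal.ofReal_one] at this
      exact this.mono_left nhdsWithin_le_nhds
    rw [one_mul] at hlim
    refine ge_of_tendsto hlim ?_
    filter_upwards [self_mem_nhdsWithin] with t ht
    exact (h t ht) B
  have hην : η = ν := by
    apply le_antisymm
    · refine hle _ _ fun t ht => measure_le_of_locally_le hs hηs fun z hz => ?_
      obtain ⟨U, hU, h⟩ := hloc t ht z hz
      exact ⟨U, hU, fun B hB hBm => (h B hB hBm).1⟩
    · refine hle _ _ fun t ht => measure_le_of_locally_le hs hνs fun z hz => ?_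
      obtain ⟨U, hU, h⟩ := hloc t ht z hz
      exact ⟨U, hU, fun B hB hBm => (h B hB hBm).2⟩
  rw [← (hη u hu).2, hην, hνdef, lintegral_withDensity_eq_lintegral_mul _ hcm' hu,
    ← lintegral_indicator hs,
    ← lintegral_indicator (isClosed_eq hv.continuous continuous_const).measurableSet]
  refine lintegral_congr fun z => ?_
  by_cases h1 : v z = L
  · by_cases h2 : fderiv ℝ v z Complex.I = 0
    · simp [Set.indicator, hsdef, h1, h2]
    · simp [Set.indicator, hsdef, h1, h2, hcdef, mul_comm]
  · simp [Set.indicator, hsdef, h1]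

/-! ### Approximations of a step function along a line -/

/-- `P` is a sequence of nondecreasing functions from `[0, ∞)` to `[0, 1]`, with derivatives `P'`,
that converges to the unit step at `1` (nothing is asked at `1` itself). -/
structure IsStepApprox (P P' : ℕ → ℝ → ℝ) : Prop where
  hasDerivAt : ∀ n s, 0 ≤ s → HasDerivAt (P n) (P' n s) s
  continuousOn : ∀ n, ContinuousOn (P' n) (Set.Ici 0)
  deriv_nonneg : ∀ n s, 0 ≤ s → 0 ≤ P' n s
  nonneg : ∀ n s, 0 ≤ s → 0 ≤ P n s
  le_one : ∀ n s, 0 ≤ s → P n s ≤ 1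
  tendsto_zero : ∀ s, 0 ≤ s → s < 1 → Tendsto (fun n => P n s) atTop (𝓝 0)
  tendsto_one : ∀ s, 1 < s → Tendsto (fun n => P n s) atTop (𝓝 1)

/-- `g` is a nonnegative `C²` function on the line with derivatives `g1` and `g2`. -/
structure IsNonnegC2 (g g1 g2 : ℝ → ℝ) : Prop where
  nonneg : ∀ y, 0 ≤ g y
  hasDerivAt : ∀ y, HasDerivAt g (g1 y) y
  hasDerivAt' : ∀ y, HasDerivAt g1 (g2 y) y
  continuous_deriv2 : Continuous g2

lemma IsNonnegC2.continuous {g g1 g2 : ℝ → ℝ} (hg : IsNonnegC2 g g1 g2) : Continuous g :=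
  continuous_iff_continuousAt.2 fun y => (hg.hasDerivAt y).continuousAt

lemma IsNonnegC2.continuous_deriv {g g1 g2 : ℝ → ℝ} (hg : IsNonnegC2 g g1 g2) : Continuous g1 :=
  continuous_iff_continuousAt.2 fun y => (hg.hasDerivAt' y).continuousAt

namespace IsStepApprox

variable {P P' : ℕ → ℝ → ℝ} {g g1 g2 : ℝ → ℝ}

lemma continuousOn_self (hP : IsStepApprox P P') (n : ℕ) : ContinuousOn (P n) (Set.Ici 0) :=
  fun s hs => (hP.hasDerivAt n s hs).continuousAt.continuousWithinAt

lemma tendsto_step (hP : IsStepApprox P P') {s : ℝ} (hs : 0 ≤ s) (h1 : s ≠ 1) :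
    Tendsto (fun n => P n s) atTop (𝓝 (if 1 < s then 1 else 0)) := by
  split_ifs with h
  · exact hP.tendsto_one s h
  · exact hP.tendsto_zero s hs (lt_of_le_of_ne (not_lt.1 h) h1)

lemma continuous_deriv_comp_mul_sq (hP : IsStepApprox P P') (hg : IsNonnegC2 g g1 g2)
    (n : ℕ) : Continuous fun y => P' n (g y) * g1 y ^ 2 := by
  have hgc := hg.continuous
  have hg1c := hg.continuous_deriv
  exact ((hP.continuousOn n).comp_continuous hgc hg.nonneg).mul (hg1c.pow 2)

lemma continuous_comp_mul (hP : IsStepApprox P P') (hg : IsNonnegC2 g g1 g2)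
    (n : ℕ) : Continuous fun y => P n (g y) * g2 y := by
  have hgc := hg.continuous
  exact ((hP.continuousOn_self n).comp_continuous hgc hg.nonneg).mul hg.continuous_deriv2

/-- Integration by parts: `P' n (g) g'²` is `(P n (g))' g'`. -/
lemma integral_deriv_mul_sq (hP : IsStepApprox P P') (hg : IsNonnegC2 g g1 g2)
    (n : ℕ) (α β : ℝ) :
    ∫ y in α..β, P' n (g y) * g1 y ^ 2 =
      P n (g β) * g1 β - P n (g α) * g1 α - ∫ y in α..β, P n (g y) * g2 y := by
  have h1 := hP.continuous_deriv_comp_mul_sq hg n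
  have h2 := hP.continuous_comp_mul hg n
  rw [← intervalIntegral.integral_eq_sub_of_hasDerivAt (f := fun y => P n (g y) * g1 y)
    (f' := fun y => P' n (g y) * g1 y ^ 2 + P n (g y) * g2 y)]
  · rw [intervalIntegral.integral_add (h1.intervalIntegrable _ _) (h2.intervalIntegrable _ _)]
    ring
  · intro y _
    have := ((hP.hasDerivAt n _ (hg.nonneg y)).comp y (hg.hasDerivAt y)).mul (hg.hasDerivAt' y)
    refine this.congr_deriv ?_
    simp only [Function.comp_apply]; ring
  · exact (h1.add h2).intervalIntegrable _ _

/-- The mass that `P' n (g) g'²` puts on an interval is bounded independently of `n`. -/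
lemma integral_deriv_mul_sq_le (hP : IsStepApprox P P') (hg : IsNonnegC2 g g1 g2)
    (n : ℕ) {α β C : ℝ} (hαβ : α ≤ β)
    (hC1 : ∀ y ∈ Set.Icc α β, |g1 y| ≤ C) (hC2 : ∀ y ∈ Set.Icc α β, |g2 y| ≤ C) :
    ∫ y in α..β, P' n (g y) * g1 y ^ 2 ≤ 2 * C + C * (β - α) := by
  rw [hP.integral_deriv_mul_sq hg]
  have hb : ∀ y (c : ℝ), |c| ≤ C → |P n (g y) * c| ≤ C := by
    intro y c hc
    rw [abs_mul, abs_of_nonneg (hP.nonneg n _ (hg.nonneg y))]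
    exact (mul_le_of_le_one_left (abs_nonneg _) (hP.le_one n _ (hg.nonneg y))).trans hc
  have h1 := hb β _ (hC1 β (Set.right_mem_Icc.2 hαβ))
  have h2 := hb α _ (hC1 α (Set.left_mem_Icc.2 hαβ))
  have h3 : ‖∫ y in α..β, P n (g y) * g2 y‖ ≤ C * |β - α| := by
    refine intervalIntegral.norm_integral_le_of_norm_le_const fun y hy => ?_
    rw [Set.uIoc_of_le hαβ] at hy
    exact hb y _ (hC2 y (Set.Ioc_subset_Icc_self hy))
  rw [abs_of_nonneg (by linarith), Real.norm_eq_abs] at h3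
  have := abs_le.1 h1
  have := abs_le.1 h2
  have := abs_le.1 h3
  linarith

/-- Around an isolated solution `y₀` of `g = 1` the mass tends to the jump of the derivative of
`max (g - 1) 0`; if `g y₀ ≠ 1` the mass tends to `0`. -/
lemma tendsto_integral_deriv_mul_sq (hP : IsStepApprox P P') (hg : IsNonnegC2 g g1 g2)
    {α β y₀ : ℝ} (hα : α < y₀) (hβ : y₀ < β)
    (hne : ∀ y ∈ Set.Icc α β, y ≠ y₀ → g y ≠ 1) :
    Tendsto (fun n => ∫ y in α..β, P' n (g y) * g1 y ^ 2) atTop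
      (𝓝 (if g y₀ = 1 then |g1 y₀| else 0)) := by
  have hgc := hg.continuous
  have hg1c := hg.continuous_deriv
  set h : ℝ → ℝ := fun s => if 1 < s then 1 else 0 with hh
  have hlimI : Tendsto (fun n => ∫ y in α..β, P n (g y) * g2 y) atTop
      (𝓝 (∫ y in α..β, h (g y) * g2 y)) := by
    refine intervalIntegral.tendsto_integral_filter_of_dominated_convergence (fun y => |g2 y|)
      (Eventually.of_forall fun n =>
        (hP.continuous_comp_mul hg n).aestronglyMeasurable)
      (Eventually.of_forall fun n => Eventually.of_forall fun y _ => ?_)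
      (hg.continuous_deriv2.abs.intervalIntegrable _ _) ?_
    · rw [Real.norm_eq_abs, abs_mul, abs_of_nonneg (hP.nonneg n _ (hg.nonneg y))]
      exact mul_le_of_le_one_left (abs_nonneg _) (hP.le_one n _ (hg.nonneg y))
    · have : ∀ᵐ y : ℝ, y ≠ y₀ := by simp [ae_iff]
      filter_upwards [this] with y hy hyI
      rw [Set.uIoc_of_le (hα.trans hβ).le] at hyI
      exact (hP.tendsto_step (hg.nonneg y) (hne y (Set.Ioc_subset_Icc_self hyI) hy)).mul_const _
  have hlim : Tendsto (fun n => ∫ y in α..β, P' n (g y) * g1 y ^ 2) atTop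
      (𝓝 (h (g β) * g1 β - h (g α) * g1 α - ∫ y in α..β, h (g y) * g2 y)) := by
    simp_rw [hP.integral_deriv_mul_sq hg]
    refine Tendsto.sub (Tendsto.sub ?_ ?_) hlimI
    · exact (hP.tendsto_step (hg.nonneg β) (hne β (Set.right_mem_Icc.2 (hα.trans hβ).le)
        hβ.ne')).mul_const _
    · exact (hP.tendsto_step (hg.nonneg α) (hne α (Set.left_mem_Icc.2 (hα.trans hβ).le)
        hα.ne)).mul_const _
  convert hlim using 2
  -- `g - 1` has a constant sign on either side of `y₀`.
  have hsign : ∀ S : Set ℝ, S ⊆ Set.Icc α β → IsPreconnected S → y₀ ∉ S → ∀ y ∈ S, ∀ z ∈ S,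
      h (g y) = h (g z) := by
    have aux : ∀ S : Set ℝ, S ⊆ Set.Icc α β → IsPreconnected S → y₀ ∉ S → ∀ y ∈ S, ∀ z ∈ S,
        1 < g y → 1 < g z := by
      intro S hS hpre hy₀ y hy z hz h1
      by_contra h2
      obtain ⟨w, hw, hw1⟩ := hpre.intermediate_value hz hy hgc.continuousOn
        ⟨not_lt.1 h2, h1.le⟩
      exact hne w (hS hw) (fun e => hy₀ (e ▸ hw)) hw1
    intro S hS hpre hy₀ y hy z hz
    have := aux S hS hpre hy₀ y hy z hz
    have := aux S hS hpre hy₀ z hz y hy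
    simp only [hh]
    by_cases h1 : 1 < g y
    · rw [if_pos h1, if_pos (aux S hS hpre hy₀ y hy z hz h1)]
    · rw [if_neg h1, if_neg (fun h2 => h1 (aux S hS hpre hy₀ z hz y hy h2))]
  have hR : ∀ y ∈ Set.Ioc y₀ β, h (g y) = h (g β) := fun y hy =>
    hsign (Set.Ioc y₀ β) (fun w hw => ⟨hα.le.trans hw.1.le, hw.2⟩) isPreconnected_Ioc (by simp)
      y hy β ⟨hβ, le_rfl⟩
  have hL : ∀ y ∈ Set.Ico α y₀, h (g y) = h (g α) := fun y hy =>
    hsign (Set.Ico α y₀) (fun w hw => ⟨hw.1, hw.2.le.trans hβ.le⟩) isPreconnected_Ico (by simp)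
      y hy α ⟨le_rfl, hα⟩
  have hiR : ∫ y in y₀..β, h (g y) * g2 y = h (g β) * (g1 β - g1 y₀) := by
    rw [← intervalIntegral.integral_eq_sub_of_hasDerivAt (fun y _ => hg.hasDerivAt' y)
      (hg.continuous_deriv2.intervalIntegrable _ _), ← intervalIntegral.integral_const_mul]
    refine intervalIntegral.integral_congr_ae (Eventually.of_forall fun y hy => ?_)
    rw [Set.uIoc_of_le hβ.le] at hy
    rw [hR y hy]
  have hiL : ∫ y in α..y₀, h (g y) * g2 y = h (g α) * (g1 y₀ - g1 α) := by
    rw [← intervalIntegral.integral_eq_sub_of_hasDerivAt (fun y _ => hg.hasDerivAt' y)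
      (hg.continuous_deriv2.intervalIntegrable _ _), ← intervalIntegral.integral_const_mul]
    have : ∀ᵐ y : ℝ, y ≠ y₀ := by simp [ae_iff]
    refine intervalIntegral.integral_congr_ae ?_
    filter_upwards [this] with y hne hy
    rw [Set.uIoc_of_le hα.le] at hy
    rw [hL y ⟨hy.1.le, lt_of_le_of_ne hy.2 hne⟩]
  have hhm : Measurable fun y => h (g y) :=
    (Measurable.ite measurableSet_Ioi measurable_const measurable_const).comp hgc.measurable
  have hint : ∀ a b : ℝ, IntervalIntegrable (fun y => h (g y) * g2 y) volume a b := by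
    intro a b
    refine (hg.continuous_deriv2.abs.intervalIntegrable a b).mono_fun
      (hhm.mul hg.continuous_deriv2.measurable).aestronglyMeasurable
      (Eventually.of_forall fun y => ?_)
    simp only [norm_mul, Real.norm_eq_abs, abs_abs]
    refine mul_le_of_le_one_left (abs_nonneg _) ?_
    simp only [hh]; split_ifs <;> simp
  rw [← intervalIntegral.integral_add_adjacent_intervals (hint α y₀) (hint y₀ β), hiL, hiR]
  have hval : h (g β) * g1 β - h (g α) * g1 α - (h (g α) * (g1 y₀ - g1 α) +
      h (g β) * (g1 β - g1 y₀)) = (h (g β) - h (g α)) * g1 y₀ := by ring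
  rw [hval]
  split_ifs with h1
  · rcases lt_trichotomy (g1 y₀) 0 with hneg | hz | hpos
    · -- a decreasing crossing
      have e := (hg.hasDerivAt y₀).tendsto_slope
      have ev := e.eventually_lt_const hneg
      rw [eventually_nhdsWithin_iff] at ev
      obtain ⟨δ, hδ, hball⟩ := Metric.eventually_nhds_iff.1 ev
      set w := min (β - y₀) (δ / 2) with hw
      set w' := min (y₀ - α) (δ / 2) with hw'
      have hwp : 0 < w := lt_min (by linarith) (by linarith)
      have hwp' : 0 < w' := lt_min (by linarith) (by linarith)
      have a1 : g (y₀ + w) < 1 := by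
        have := hball (y := y₀ + w) (by
          rw [Real.dist_eq, add_sub_cancel_left, abs_of_pos hwp]
          exact (min_le_right _ _).trans_lt (by linarith)) (by simp [hwp.ne'])
        rw [slope_def_field, add_sub_cancel_left, h1, div_lt_iff₀ hwp] at this
        linarith
      have a2 : 1 < g (y₀ - w') := by
        have := hball (y := y₀ - w') (by
          rw [Real.dist_eq, sub_sub_cancel_left, abs_neg, abs_of_pos hwp']
          exact (min_le_right _ _).trans_lt (by linarith)) (by simp [hwp'.ne'])
        rw [slope_def_field, sub_sub_cancel_left, h1, div_lt_iff_of_neg (by linarith)] at this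
        linarith
      have b1 : h (g β) = 0 := by
        rw [← hR (y₀ + w) ⟨by linarith, by have := min_le_left (β - y₀) (δ / 2); linarith⟩]
        simp [hh, a1.le]
      have b2 : h (g α) = 1 := by
        rw [← hL (y₀ - w') ⟨by have := min_le_left (y₀ - α) (δ / 2); linarith, by linarith⟩]
        simp [hh, a2]
      rw [b1, b2, abs_of_neg hneg]; ring
    · rw [hz]; simp
    · -- an increasing crossing
      have e := (hg.hasDerivAt y₀).tendsto_slope
      have ev := e.eventually_const_lt hpos
      rw [eventually_nhdsWithin_iff] at ev
      obtain ⟨δ, hδ, hball⟩ := Metric.eventually_nhds_iff.1 ev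
      set w := min (β - y₀) (δ / 2) with hw
      set w' := min (y₀ - α) (δ / 2) with hw'
      have hwp : 0 < w := lt_min (by linarith) (by linarith)
      have hwp' : 0 < w' := lt_min (by linarith) (by linarith)
      have a1 : 1 < g (y₀ + w) := by
        have := hball (y := y₀ + w) (by
          rw [Real.dist_eq, add_sub_cancel_left, abs_of_pos hwp]
          exact (min_le_right _ _).trans_lt (by linarith)) (by simp [hwp.ne'])
        rw [slope_def_field, add_sub_cancel_left, h1, lt_div_iff₀ hwp] at this
        linarith
      have a2 : g (y₀ - w') < 1 := by
        have := hball (y := y₀ - w') (by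
          rw [Real.dist_eq, sub_sub_cancel_left, abs_neg, abs_of_pos hwp']
          exact (min_le_right _ _).trans_lt (by linarith)) (by simp [hwp'.ne'])
        rw [slope_def_field, sub_sub_cancel_left, h1, lt_div_iff_of_neg (by linarith)] at this
        linarith
      have b1 : h (g β) = 1 := by
        rw [← hR (y₀ + w) ⟨by linarith, by have := min_le_left (β - y₀) (δ / 2); linarith⟩]
        simp [hh, a1]
      have b2 : h (g α) = 0 := by
        rw [← hL (y₀ - w') ⟨by have := min_le_left (y₀ - α) (δ / 2); linarith, by linarith⟩]
        simp [hh, a2.le]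
      rw [b1, b2, abs_of_pos hpos]; ring
  · have hall : ∀ y ∈ Set.Icc α β, g y ≠ 1 := by
      intro y hy
      by_cases e : y = y₀
      · rw [e]; exact h1
      · exact hne y hy e
    have : h (g β) = h (g α) := by
      have aux : ∀ y ∈ Set.Icc α β, ∀ z ∈ Set.Icc α β, 1 < g y → 1 < g z := by
        intro y hy z hz h1
        by_contra h2
        obtain ⟨w, hw, hw1⟩ := isPreconnected_Icc.intermediate_value hz hy hgc.continuousOn
          ⟨not_lt.1 h2, h1.le⟩
        exact hall w hw hw1
      have hαm : α ∈ Set.Icc α β := Set.left_mem_Icc.2 (hα.trans hβ).le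
      have hβm : β ∈ Set.Icc α β := Set.right_mem_Icc.2 (hα.trans hβ).le
      simp only [hh]
      by_cases h1 : 1 < g β
      · rw [if_pos h1, if_pos (aux β hβm α hαm h1)]
      · rw [if_neg h1, if_neg (fun h2 => h1 (aux α hαm β hβm h2))]
    rw [this]; simp

end IsStepApprox

namespace IsStepApprox

variable {P P' : ℕ → ℝ → ℝ} {g g1 g2 χ : ℝ → ℝ}

/-- Around an isolated solution of `g = 1` the mass concentrates at that solution, so a continuous
weight may be replaced by its value there. -/
lemma tendsto_intervalIntegral_mul (hP : IsStepApprox P P') (hg : IsNonnegC2 g g1 g2)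
    (hχ : Continuous χ) {α β y₀ : ℝ} (hα : α < y₀) (hβ : y₀ < β)
    (hne : ∀ y ∈ Set.Icc α β, y ≠ y₀ → g y ≠ 1) :
    Tendsto (fun n => ∫ y in α..β, χ y * (P' n (g y) * g1 y ^ 2)) atTop
      (𝓝 (χ y₀ * if g y₀ = 1 then |g1 y₀| else 0)) := by
  set J : ℝ := if g y₀ = 1 then |g1 y₀| else 0 with hJ
  have hJ0 : 0 ≤ J := by rw [hJ]; split_ifs <;> positivity
  rw [Metric.tendsto_atTop']
  intro η hη
  set ε := η / (J + 1) with hε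
  have hεp : 0 < ε := by positivity
  obtain ⟨M, hM⟩ := isCompact_Icc.exists_bound_of_continuousOn (s := Set.Icc α β)
    (f := fun y => χ y - χ y₀) (hχ.sub continuous_const).continuousOn
  obtain ⟨δ, hδ, hball⟩ := Metric.continuousAt_iff.1 (hχ.continuousAt (x := y₀)) ε hεp
  -- On `[α', β']` the weight differs from `χ y₀` by at most `ε`; the remaining mass tends to `0`.
  set α' := max α (y₀ - δ / 2) with hα'
  set β' := min β (y₀ + δ / 2) with hβ'
  have hαα' : α ≤ α' := le_max_left _ _
  have hα'y : α' < y₀ := max_lt hα (by linarith)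
  have hyβ' : y₀ < β' := lt_min hβ (by linarith)
  have hβ'β : β' ≤ β := min_le_left _ _
  have hρ := fun n => hP.continuous_deriv_comp_mul_sq hg n
  have hρ0 : ∀ n y, 0 ≤ P' n (g y) * g1 y ^ 2 := fun n y =>
    mul_nonneg (hP.deriv_nonneg n _ (hg.nonneg y)) (sq_nonneg _)
  set m := fun n => ∫ y in α..β, P' n (g y) * g1 y ^ 2 with hm
  set m' := fun n => ∫ y in α'..β', P' n (g y) * g1 y ^ 2 with hm'
  have hlim : Tendsto m atTop (𝓝 J) := hP.tendsto_integral_deriv_mul_sq hg hα hβ hne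
  have hlim' : Tendsto m' atTop (𝓝 J) := hP.tendsto_integral_deriv_mul_sq hg hα'y hyβ'
    fun y hy => hne y ⟨hαα'.trans hy.1, hy.2.trans hβ'β⟩
  have hA : Tendsto (fun n => ε * m' n + M * (m n - m' n) + |χ y₀| * |m n - J|) atTop
      (𝓝 (ε * J + M * (J - J) + |χ y₀| * |J - J|)) :=
    ((hlim'.const_mul ε).add ((hlim.sub hlim').const_mul M)).add
      (((hlim.sub_const J).abs).const_mul _)
  have hfin : ε * J + M * (J - J) + |χ y₀| * |J - J| < η := by
    have : ε * (J + 1) = η := by rw [hε]; field_simp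
    simp; nlinarith
  obtain ⟨N, hN⟩ := eventually_atTop.1 (hA.eventually_lt_const hfin)
  refine ⟨N, fun n hn => lt_of_le_of_lt ?_ (hN n hn.le)⟩
  set ψ := fun y => |χ y - χ y₀| * (P' n (g y) * g1 y ^ 2) with hψ
  have hψc : Continuous ψ := ((hχ.sub continuous_const).abs).mul (hρ n)
  have hMab : ∀ y ∈ Set.Icc α β, ψ y ≤ M * (P' n (g y) * g1 y ^ 2) := fun y hy =>
    mul_le_mul_of_nonneg_right (hM y hy) (hρ0 n y)
  have hεab : ∀ y ∈ Set.Icc α' β', ψ y ≤ ε * (P' n (g y) * g1 y ^ 2) := fun y hy => by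
    refine mul_le_mul_of_nonneg_right ?_ (hρ0 n y)
    have h1 := hy.1
    have h2 := hy.2
    have h3 : y₀ - δ / 2 ≤ α' := le_max_right _ _
    have h4 : β' ≤ y₀ + δ / 2 := min_le_right _ _
    have := hball (x := y) (by rw [Real.dist_eq, abs_lt]; constructor <;> linarith)
    rw [Real.dist_eq] at this
    exact this.le
  have i1 : ∀ a b, IntervalIntegrable ψ volume a b := fun a b => hψc.intervalIntegrable a b
  have i2 : ∀ a b, IntervalIntegrable (fun y => P' n (g y) * g1 y ^ 2) volume a b :=
    fun a b => (hρ n).intervalIntegrable a b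
  have b1 : ∫ y in α..α', ψ y ≤ M * ∫ y in α..α', P' n (g y) * g1 y ^ 2 := by
    rw [← intervalIntegral.integral_const_mul]
    exact intervalIntegral.integral_mono_on hαα' (i1 _ _) ((i2 _ _).const_mul _)
      fun y hy => hMab y ⟨hy.1, hy.2.trans (hα'y.trans hβ).le⟩
  have b2 : ∫ y in α'..β', ψ y ≤ ε * m' n := by
    rw [hm', ← intervalIntegral.integral_const_mul]
    exact intervalIntegral.integral_mono_on (hα'y.trans hyβ').le (i1 _ _)
      ((i2 _ _).const_mul _) hεab
  have b3 : ∫ y in β'..β, ψ y ≤ M * ∫ y in β'..β, P' n (g y) * g1 y ^ 2 := by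
    rw [← intervalIntegral.integral_const_mul]
    exact intervalIntegral.integral_mono_on hβ'β (i1 _ _) ((i2 _ _).const_mul _)
      fun y hy => hMab y ⟨(hα.trans hyβ').le.trans hy.1, hy.2⟩
  have s1 : ∫ y in α..β, ψ y = (∫ y in α..α', ψ y) + (∫ y in α'..β', ψ y) + ∫ y in β'..β, ψ y := by
    rw [intervalIntegral.integral_add_adjacent_intervals (i1 _ _) (i1 _ _),
      intervalIntegral.integral_add_adjacent_intervals (i1 _ _) (i1 _ _)]
  have s2 : m n = (∫ y in α..α', P' n (g y) * g1 y ^ 2) + m' n +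
      ∫ y in β'..β, P' n (g y) * g1 y ^ 2 := by
    rw [hm, hm', intervalIntegral.integral_add_adjacent_intervals (i2 _ _) (i2 _ _),
      intervalIntegral.integral_add_adjacent_intervals (i2 _ _) (i2 _ _)]
  have s3 : (∫ y in α..β, χ y * (P' n (g y) * g1 y ^ 2)) - χ y₀ * J =
      (∫ y in α..β, (χ y - χ y₀) * (P' n (g y) * g1 y ^ 2)) + χ y₀ * (m n - J) := by
    have : ∀ y, (χ y - χ y₀) * (P' n (g y) * g1 y ^ 2) =
      χ y * (P' n (g y) * g1 y ^ 2) - χ y₀ * (P' n (g y) * g1 y ^ 2) := fun y => by ring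
    simp_rw [this]
    have hc : Continuous fun y => χ y * (P' n (g y) * g1 y ^ 2) := hχ.mul (hρ n)
    rw [intervalIntegral.integral_sub (hc.intervalIntegrable _ _)
      ((i2 _ _).const_mul _), intervalIntegral.integral_const_mul]
    ring
  have s4 : |∫ y in α..β, (χ y - χ y₀) * (P' n (g y) * g1 y ^ 2)| ≤ ∫ y in α..β, ψ y := by
    refine (intervalIntegral.abs_integral_le_integral_abs (hα.trans hβ).le).trans_eq ?_
    refine intervalIntegral.integral_congr fun y _ => ?_
    simp only [hψ, abs_mul, abs_of_nonneg (hP.deriv_nonneg n _ (hg.nonneg y)), abs_pow, sq_abs]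
  rw [Real.dist_eq, s3]
  refine (abs_add_le _ _).trans ?_
  rw [abs_mul (χ y₀)]
  have e : M * (m n - m' n) = M * (∫ y in α..α', P' n (g y) * g1 y ^ 2) +
    M * ∫ y in β'..β, P' n (g y) * g1 y ^ 2 := by rw [s2]; ring
  linarith

lemma tendsto_integral_mul_of_isolated (hP : IsStepApprox P P') (hg : IsNonnegC2 g g1 g2)
    (hχ : Continuous χ) (hχc : HasCompactSupport χ) (hχ0 : ∀ y, 0 ≤ χ y)
    (hiso : ∀ y₀, ∀ᶠ y in 𝓝[≠] y₀, g y ≠ 1) :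
    ∃ J : ℝ, 0 ≤ J ∧ Tendsto (fun n => ∫ y, χ y * (P' n (g y) * g1 y ^ 2)) atTop (𝓝 J) ∧
      ENNReal.ofReal J =
        ∑' y, {y | g y = 1}.indicator (fun y => ENNReal.ofReal (χ y * |g1 y|)) y := by
  have hαβ : ∀ y₀, ∃ α β, α < y₀ ∧ y₀ < β ∧ ∀ y ∈ Set.Icc α β, y ≠ y₀ → g y ≠ 1 := by
    intro y₀
    have := hiso y₀
    rw [eventually_nhdsWithin_iff] at this
    obtain ⟨δ, hδ, hball⟩ := Metric.eventually_nhds_iff.1 this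
    refine ⟨y₀ - δ / 2, y₀ + δ / 2, by linarith, by linarith, fun y hy hne => hball ?_ hne⟩
    rw [Real.dist_eq, abs_lt]
    constructor <;> linarith [hy.1, hy.2]
  choose α β hα hβ hne using hαβ
  obtain ⟨t, ht⟩ := hχc.isCompact.elim_finite_subcover (fun y => Set.Ioo (α y) (β y))
    (fun y => isOpen_Ioo) fun y _ => Set.mem_iUnion.2 ⟨y, hα y, hβ y⟩
  -- A partition of unity reduces to intervals that contain at most one solution.
  set c : Fin t.card → ℝ := fun i => (t.equivFin.symm i : ℝ) with hc
  have hcinj : Function.Injective c := fun i j h => t.equivFin.symm.injective (Subtype.ext h)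
  obtain ⟨f, hfs, hf1, -, -⟩ := exists_continuous_sum_one_of_isOpen_isCompact
    (s := fun i => Set.Ioo (α (c i)) (β (c i))) (t := tsupport χ) (fun i => isOpen_Ioo)
    hχc.isCompact (by
      intro y hy
      obtain ⟨z, hz, hyz⟩ := Set.mem_iUnion₂.1 (ht hy)
      exact Set.mem_iUnion.2 ⟨t.equivFin ⟨z, hz⟩, by simpa [hc] using hyz⟩)
  set J : ℝ → ℝ := fun y => if g y = 1 then |g1 y| else 0 with hJ
  have hJ0 : ∀ y, 0 ≤ J y := fun y => by simp only [hJ]; split_ifs <;> positivity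
  have hroot : ∀ y ∈ tsupport χ, g y = 1 → ∃ i, y = c i := by
    intro y hy hgy
    obtain ⟨z, hz, hyz⟩ := Set.mem_iUnion₂.1 (ht hy)
    refine ⟨t.equivFin ⟨z, hz⟩, ?_⟩
    simp only [hc, Equiv.symm_apply_apply]
    by_contra h
    exact hne z y (Set.Ioo_subset_Icc_self hyz) h hgy
  have hpart : ∀ y, χ y = ∑ i, χ y * f i y := by
    intro y
    by_cases hy : y ∈ tsupport χ
    · have := hf1 hy
      simp only [Finset.sum_apply, Pi.one_apply] at this
      rw [← Finset.mul_sum, this, mul_one]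
    · rw [image_eq_zero_of_notMem_tsupport hy]; simp
  have hkey : ∀ i, χ (c i) * f i (c i) * J (c i) = χ (c i) * J (c i) := by
    intro i
    by_cases hgi : g (c i) = 1
    · by_cases hy : c i ∈ tsupport χ
      · have h1 := hf1 hy
        simp only [Finset.sum_apply, Pi.one_apply] at h1
        rw [Finset.sum_eq_single i] at h1
        · rw [h1, mul_one]
        · intro j _ hj
          apply image_eq_zero_of_notMem_tsupport
          intro hmem
          exact hne (c j) (c i) (Set.Ioo_subset_Icc_self (hfs j hmem)) (fun e => hj (hcinj e).symm)
            hgi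
        · simp
      · rw [image_eq_zero_of_notMem_tsupport hy]; simp
    · simp [hJ, hgi]
  refine ⟨∑ i, χ (c i) * J (c i), Finset.sum_nonneg fun i _ => mul_nonneg (hχ0 _) (hJ0 _), ?_, ?_⟩
  · have hρ := fun n => hP.continuous_deriv_comp_mul_sq hg n
    have h1 : ∀ n, ∫ y, χ y * (P' n (g y) * g1 y ^ 2) =
        ∑ i, ∫ y in α (c i)..β (c i), (χ y * f i y) * (P' n (g y) * g1 y ^ 2) := by
      intro n
      have h2 : ∀ y, χ y * (P' n (g y) * g1 y ^ 2) =
          ∑ i, (χ y * f i y) * (P' n (g y) * g1 y ^ 2) := by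
        intro y
        rw [← Finset.sum_mul, ← hpart]
      simp_rw [h2]
      rw [integral_finsetSum]
      · refine Finset.sum_congr rfl fun i _ => ?_
        symm
        apply intervalIntegral.integral_eq_integral_of_support_subset
        intro y hy
        have : f i y ≠ 0 := fun h => hy (by simp [h])
        exact Set.Ioo_subset_Ioc_self (hfs i (subset_tsupport _ this))
      · intro i _
        refine Continuous.integrable_of_hasCompactSupport ((hχ.mul (f i).continuous).mul (hρ n)) ?_
        exact (hχc.mul_right).mul_right
    simp_rw [h1]
    refine tendsto_finsetSum _ fun i _ => ?_
    rw [← hkey]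
    exact hP.tendsto_intervalIntegral_mul hg (hχ.mul (f i).continuous) (hα _) (hβ _) (hne _)
  · rw [ENNReal.ofReal_sum_of_nonneg fun i _ => mul_nonneg (hχ0 _) (hJ0 _)]
    have hsupp : (Function.support fun y =>
        {y | g y = 1}.indicator (fun y => ENNReal.ofReal (χ y * |g1 y|)) y) ⊆ Set.range c := by
      intro y hy
      have hgy : g y = 1 := by
        by_contra h
        exact hy (by simp [Set.indicator, h])
      have hχy : y ∈ tsupport χ := by
        by_contra h
        apply hy
        simp [image_eq_zero_of_notMem_tsupport h]
      obtain ⟨i, hi⟩ := hroot y hχy hgy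
      exact ⟨i, hi.symm⟩
    rw [← hcinj.tsum_eq hsupp, tsum_fintype]
    refine Finset.sum_congr rfl fun i _ => ?_
    by_cases h : g (c i) = 1
    · simp [hJ, h, Set.indicator]
    · simp [hJ, h, Set.indicator]

/-- The limit of the mass along a line, where the solutions of `g = 1` are isolated or `g` is
identically `1`. The dichotomy holds for real analytic `g`. -/
lemma tendsto_integral_mul (hP : IsStepApprox P P') (hg : IsNonnegC2 g g1 g2)
    (hχ : Continuous χ) (hχc : HasCompactSupport χ) (hχ0 : ∀ y, 0 ≤ χ y)
    (hiso : (∀ y₀, ∀ᶠ y in 𝓝[≠] y₀, g y ≠ 1) ∨ ∀ y, g y = 1) :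
    ∃ J : ℝ, 0 ≤ J ∧ Tendsto (fun n => ∫ y, χ y * (P' n (g y) * g1 y ^ 2)) atTop (𝓝 J) ∧
      ENNReal.ofReal J =
        ∑' y, {y | g y = 1}.indicator (fun y => ENNReal.ofReal (χ y * |g1 y|)) y := by
  rcases hiso with h | h
  · exact hP.tendsto_integral_mul_of_isolated hg hχ hχc hχ0 h
  · have h1 : ∀ y, g1 y = 0 := by
      intro y
      have e : g = fun _ => 1 := funext h
      have := hg.hasDerivAt y
      rw [e] at this
      exact this.unique (hasDerivAt_const y 1)
    exact ⟨0, le_rfl, by simp [h1], by simp [h1]⟩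

end IsStepApprox

/-! ### The coarea limit in the plane -/

lemma integral_complex_eq_integral_integral {F : ℂ → ℝ} (hF : Integrable F) :
    ∫ z, F z = ∫ x : ℝ, ∫ y : ℝ, F ⟨x, y⟩ := by
  have hmp := Complex.volume_preserving_equiv_real_prod.symm
  have h1 : Integrable (fun p : ℝ × ℝ => F ⟨p.1, p.2⟩) (volume.prod volume) :=
    (hmp.integrable_comp_emb Complex.measurableEquivRealProd.symm.measurableEmbedding).2 hF
  rw [← integral_prod _ h1]
  exact (hmp.integral_comp Complex.measurableEquivRealProd.symm.measurableEmbedding F).symm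

lemma hasDerivAt_complex_mk (x y : ℝ) : HasDerivAt (fun y : ℝ => (⟨x, y⟩ : ℂ)) Complex.I y := by
  have h : HasDerivAt (fun y : ℝ => (x : ℂ) + (y : ℂ) * Complex.I) (0 + 1 * Complex.I) y :=
    (hasDerivAt_const y (x : ℂ)).add ((Complex.ofRealCLM.hasDerivAt (x := y)).mul_const Complex.I)
  rw [zero_add, one_mul] at h
  refine h.congr_of_eventuallyEq (Eventually.of_forall fun y => ?_)
  exact Complex.mk_eq_add_mul_I x y

lemma continuous_complex_mk (x : ℝ) : Continuous (fun y : ℝ => (⟨x, y⟩ : ℂ)) :=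
  continuous_iff_continuousAt.2 fun y => (hasDerivAt_complex_mk x y).continuousAt

lemma analyticAt_complex_mk (x y : ℝ) : AnalyticAt ℝ (fun y : ℝ => (⟨x, y⟩ : ℂ)) y := by
  have : (fun y : ℝ => (⟨x, y⟩ : ℂ)) = fun y : ℝ => (x : ℂ) + Complex.ofRealCLM y * Complex.I := by
    ext y; exact Complex.mk_eq_add_mul_I x y
  rw [this]
  exact analyticAt_const.add ((Complex.ofRealCLM.analyticAt y).mul analyticAt_const)

lemma isNonnegC2_slice {v : ℂ → ℝ} (hv : ContDiff ℝ 2 v) (hv0 : ∀ z, 0 ≤ v z) (x : ℝ) :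
    IsNonnegC2 (fun y => v ⟨x, y⟩) (fun y => fderiv ℝ v ⟨x, y⟩ Complex.I)
      (fun y => fderiv ℝ (fun w => fderiv ℝ v w Complex.I) ⟨x, y⟩ Complex.I) := by
  have h1 : ContDiff ℝ 1 fun w => fderiv ℝ v w Complex.I :=
    (hv.fderiv_right (m := 1) (by norm_num)).clm_apply contDiff_const
  refine ⟨fun y => hv0 _, fun y => ?_, fun y => ?_, ?_⟩
  · exact ((hv.differentiable (by norm_num)) _).hasFDerivAt.comp_hasDerivAt y
      (hasDerivAt_complex_mk x y)
  · exact ((h1.differentiable (by norm_num)) _).hasFDerivAt.comp_hasDerivAt y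
      (hasDerivAt_complex_mk x y)
  · exact (continuous_fderiv_apply_const h1 Complex.I).comp (continuous_complex_mk x)

lemma isolated_slice {v : ℂ → ℝ} (hv : AnalyticOnNhd ℝ v Set.univ) (x : ℝ) :
    (∀ y₀, ∀ᶠ y in 𝓝[≠] y₀, v ⟨x, y⟩ ≠ 1) ∨ ∀ y, v ⟨x, y⟩ = 1 := by
  by_cases h : ∀ y₀, ∀ᶠ y in 𝓝[≠] y₀, v ⟨x, y⟩ ≠ 1
  · exact Or.inl h
  · right
    push Not at h
    obtain ⟨y₀, hy₀⟩ := h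
    have hg : AnalyticOnNhd ℝ (fun y : ℝ => v ⟨x, y⟩) Set.univ := fun y _ =>
      AnalyticAt.comp (hv _ (Set.mem_univ _)) (analyticAt_complex_mk x y)
    have := hg.eqOn_of_preconnected_of_frequently_eq (g := fun _ => (1 : ℝ))
      (fun y _ => analyticAt_const) isPreconnected_univ (Set.mem_univ y₀) hy₀
    exact fun y => this (Set.mem_univ y)

lemma fiberSum_re_eq_tsum (s : Set ℂ) (u : ℂ → ℝ≥0∞) (x : ℝ) :
    fiberSum Complex.re s u x = ∑' y : ℝ, s.indicator u ⟨x, y⟩ := by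
  unfold fiberSum
  have hinj : Function.Injective (fun y : ℝ => (⟨x, y⟩ : ℂ)) := fun a b h => by
    simpa using congrArg Complex.im h
  rw [← hinj.tsum_eq]
  · refine tsum_congr fun y => ?_
    by_cases h : (⟨x, y⟩ : ℂ) ∈ s <;> simp [Set.indicator, h]
  · intro z hz
    have : z.re = x := by
      by_contra h
      exact hz (by simp [Set.indicator, h])
    exact ⟨z.im, by rw [← this]⟩

/-- Coarea limit in one direction: the mass that `P' n (v) (∂v/∂y)²` carries concentrates on the
level curve `v = 1`. On each vertical line this is the one-dimensional limit, and the limits are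
integrated by the area formula for the projection of the curve to the horizontal axis. -/
theorem IsStepApprox.exists_tendsto_integral_partial {P P' : ℕ → ℝ → ℝ} (hP : IsStepApprox P P')
    {v : ℂ → ℝ} (hv : AnalyticOnNhd ℝ v Set.univ) (hv0 : ∀ z, 0 ≤ v z) {χ : ℂ → ℝ}
    (hχ : Continuous χ) (hχc : HasCompactSupport χ) (hχ0 : ∀ z, 0 ≤ χ z) :
    ∃ I : ℝ, 0 ≤ I ∧
      Tendsto (fun n => ∫ z, χ z * (P' n (v z) * fderiv ℝ v z Complex.I ^ 2)) atTop (𝓝 I) ∧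
      ENNReal.ofReal I = ∫⁻ z in {z | v z = 1},
        ENNReal.ofReal (χ z * |fderiv ℝ v z Complex.I|) *
          ENNReal.ofReal (|fderiv ℝ v z Complex.I| / gradNorm v z)
        ∂(Measure.hausdorffMeasure 1) := by
  have hv2 : ContDiff ℝ 2 v := hv.contDiff
  have hv1 : ContDiff ℝ 1 v := hv.contDiff
  have hY1 : ContDiff ℝ 1 fun w => fderiv ℝ v w Complex.I :=
    (hv2.fderiv_right (m := 1) (by norm_num)).clm_apply contDiff_const
  have hY := hY1.continuous
  have hYY := continuous_fderiv_apply_const hY1 Complex.I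
  have hslice := fun x => isNonnegC2_slice hv2 hv0 x
  have hχs : ∀ x : ℝ, HasCompactSupport fun y : ℝ => χ ⟨x, y⟩ := fun x =>
    HasCompactSupport.intro (hχc.isCompact.image Complex.continuous_im) fun y hy => by
      apply image_eq_zero_of_notMem_tsupport
      exact fun h => hy ⟨_, h, rfl⟩
  choose J hJ0 hJlim hJsum using fun x => hP.tendsto_integral_mul (hslice x)
    (hχ.comp (continuous_complex_mk x)) (hχs x) (fun y => hχ0 _) (isolated_slice hv x)
  simp only [Function.comp_apply] at hJlim hJsum
  obtain ⟨R, hR⟩ := hχc.isCompact.isBounded.subset_closedBall 0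
  obtain ⟨M, hM⟩ := hχ.bounded_above_of_compact_support hχc
  have hM0 : 0 ≤ M := (norm_nonneg _).trans (hM 0)
  obtain ⟨C1, hC1⟩ := (isCompact_closedBall (0 : ℂ) (2 * R)).exists_bound_of_continuousOn
    hY.continuousOn
  obtain ⟨C2, hC2⟩ := (isCompact_closedBall (0 : ℂ) (2 * R)).exists_bound_of_continuousOn
    hYY.continuousOn
  set C := max C1 C2 with hC
  set F : ℕ → ℂ → ℝ := fun n z => χ z * (P' n (v z) * fderiv ℝ v z Complex.I ^ 2) with hF
  have hFc : ∀ n, Continuous (F n) := fun n =>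
    hχ.mul (((hP.continuousOn n).comp_continuous hv1.continuous hv0).mul (hY.pow 2))
  have hF0 : ∀ n z, 0 ≤ F n z := fun n z =>
    mul_nonneg (hχ0 z) (mul_nonneg (hP.deriv_nonneg n _ (hv0 z)) (sq_nonneg _))
  have hFs : ∀ n, HasCompactSupport (F n) := fun n => hχc.mul_right
  have hFi : ∀ n, Integrable (F n) := fun n => (hFc n).integrable_of_hasCompactSupport (hFs n)
  have hout : ∀ z : ℂ, R < ‖z‖ → χ z = 0 := fun z hz => by
    apply image_eq_zero_of_notMem_tsupport
    intro h
    have := hR h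
    rw [mem_closedBall_zero_iff] at this
    linarith
  have hbound : ∀ n x, ‖∫ y, F n ⟨x, y⟩‖ ≤
      (Set.Icc (-R) R).indicator (fun _ => M * (2 * C + C * (R - -R))) x := by
    intro n x
    by_cases hx : x ∈ Set.Icc (-R) R
    · rw [Set.indicator_of_mem hx, Real.norm_eq_abs,
        abs_of_nonneg (integral_nonneg fun y => hF0 _ _)]
      have hR0 : -R ≤ R := hx.1.trans hx.2
      have hin : ∀ y ∈ Set.Icc (-R) R, (⟨x, y⟩ : ℂ) ∈ Metric.closedBall (0 : ℂ) (2 * R) := by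
        intro y hy
        rw [mem_closedBall_zero_iff]
        refine (Complex.norm_le_abs_re_add_abs_im _).trans ?_
        have := abs_le.2 hx
        have := abs_le.2 hy
        simp only; linarith
      have h1 : ∫ y, F n ⟨x, y⟩ = ∫ y in (-R)..R, F n ⟨x, y⟩ := by
        rw [intervalIntegral.integral_of_le hR0, ← integral_Icc_eq_integral_Ioc,
          setIntegral_eq_integral_of_forall_compl_eq_zero]
        intro y hy
        have : χ ⟨x, y⟩ = 0 := by
          apply hout
          refine lt_of_lt_of_le ?_ (Complex.abs_im_le_norm _)
          by_contra h
          exact hy (abs_le.1 (not_lt.1 h))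
        simp [hF, this]
      have hρ := hP.continuous_deriv_comp_mul_sq (hslice x) n
      rw [h1]
      calc ∫ y in (-R)..R, F n ⟨x, y⟩
          ≤ ∫ y in (-R)..R, M * (P' n (v ⟨x, y⟩) * fderiv ℝ v ⟨x, y⟩ Complex.I ^ 2) := by
            refine intervalIntegral.integral_mono_on hR0
              (((hFc n).comp (continuous_complex_mk x)).intervalIntegrable _ _)
              ((hρ.intervalIntegrable _ _).const_mul _) fun y _ => ?_
            exact mul_le_mul_of_nonneg_right ((le_abs_self _).trans (hM _))
              (mul_nonneg (hP.deriv_nonneg n _ (hv0 _)) (sq_nonneg _))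
        _ ≤ M * (2 * C + C * (R - -R)) := by
            rw [intervalIntegral.integral_const_mul]
            refine mul_le_mul_of_nonneg_left ?_ hM0
            exact hP.integral_deriv_mul_sq_le (hslice x) n hR0
              (fun y hy => (hC1 _ (hin y hy)).trans (le_max_left _ _))
              (fun y hy => (hC2 _ (hin y hy)).trans (le_max_right _ _))
    · rw [Set.indicator_of_notMem hx]
      have : ∀ y, F n ⟨x, y⟩ = 0 := by
        intro y
        have : χ ⟨x, y⟩ = 0 := by
          apply hout
          refine lt_of_lt_of_le ?_ (Complex.abs_re_le_norm _)
          by_contra h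
          exact hx (abs_le.1 (not_lt.1 h))
        simp [hF, this]
      simp [this]
  have hbi : Integrable ((Set.Icc (-R) R).indicator fun _ : ℝ => M * (2 * C + C * (R - -R))) :=
    (integrable_indicator_iff measurableSet_Icc).2
      (integrableOn_const (by simp))
  have hmeas : ∀ n, AEStronglyMeasurable (fun x : ℝ => ∫ y : ℝ, F n ⟨x, y⟩) := fun n => by
    have : StronglyMeasurable (Function.uncurry fun x y : ℝ => F n ⟨x, y⟩) :=
      ((hFc n).measurable.comp Complex.measurableEquivRealProd.symm.measurable).stronglyMeasurable
    exact this.integral_prod_right.aestronglyMeasurable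
  have hlim : Tendsto (fun n => ∫ x : ℝ, ∫ y : ℝ, F n ⟨x, y⟩) atTop (𝓝 (∫ x, J x)) :=
    tendsto_integral_of_dominated_convergence _ hmeas hbi
      (fun n => Eventually.of_forall (hbound n)) (Eventually.of_forall hJlim)
  have hJm : AEStronglyMeasurable J volume :=
    aestronglyMeasurable_of_tendsto_ae atTop hmeas (Eventually.of_forall hJlim)
  have hJi : Integrable J := hbi.mono' hJm (Eventually.of_forall fun x =>
    le_of_tendsto (hJlim x).norm (Eventually.of_forall fun n => hbound n x))
  refine ⟨∫ x, J x, integral_nonneg hJ0, ?_, ?_⟩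
  · exact hlim.congr fun n => (integral_complex_eq_integral_integral (hFi n)).symm
  · have hum : Measurable fun z => ENNReal.ofReal (χ z * |fderiv ℝ v z Complex.I|) :=
      (hχ.mul hY.abs).measurable.ennreal_ofReal
    rw [ofReal_integral_eq_lintegral_ofReal hJi (Eventually.of_forall hJ0),
      ← lintegral_fiberSum_levelSet hv1 1 hum]
    refine lintegral_congr fun x => ?_
    rw [hJsum, fiberSum_re_eq_tsum]
    refine tsum_congr fun y => ?_
    by_cases h1 : v ⟨x, y⟩ = 1
    · by_cases h2 : fderiv ℝ v ⟨x, y⟩ Complex.I = 0 <;> simp [Set.indicator, h1, h2]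
    · simp [Set.indicator, h1]

/-- Multiplication by `√-1`, as an isometry of the plane. -/
noncomputable def mulI : ℂ ≃ₗᵢ[ℝ] ℂ := rotation ⟨Complex.I, by simp [Submonoid.unitSphere]⟩

lemma fderiv_comp_mulI {v : ℂ → ℝ} (hv : Differentiable ℝ v) (w d : ℂ) :
    fderiv ℝ (v ∘ mulI) w d = fderiv ℝ v (mulI w) (Complex.I * d) := by
  have h : HasFDerivAt (v ∘ mulI) ((fderiv ℝ v (mulI w)).comp
      (mulI.toContinuousLinearEquiv : ℂ →L[ℝ] ℂ)) w :=
    (hv _).hasFDerivAt.comp w mulI.toContinuousLinearEquiv.hasFDerivAt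
  rw [h.fderiv]
  rfl

lemma gradNorm_comp_mulI {v : ℂ → ℝ} (hv : Differentiable ℝ v) (w : ℂ) :
    gradNorm (v ∘ mulI) w = gradNorm v (mulI w) := by
  unfold gradNorm
  rw [fderiv_comp_mulI hv, fderiv_comp_mulI hv, Complex.I_mul_I, mul_one, map_neg, neg_sq, add_comm]

/-- Coarea limit: the mass that `P' n (v) |∇v|²` carries tends to `|∇v|` times arc length on the
level curve `v = 1`. The two partial derivatives are treated separately, and exchanged by a rotation
of the plane. -/
theorem IsStepApprox.exists_tendsto_integral_gradNorm {P P' : ℕ → ℝ → ℝ} (hP : IsStepApprox P P')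
    {v : ℂ → ℝ} (hv : AnalyticOnNhd ℝ v Set.univ) (hv0 : ∀ z, 0 ≤ v z) {χ : ℂ → ℝ}
    (hχ : Continuous χ) (hχc : HasCompactSupport χ) (hχ0 : ∀ z, 0 ≤ χ z) :
    ∃ I : ℝ, 0 ≤ I ∧
      Tendsto (fun n => ∫ z, χ z * (P' n (v z) * gradNorm v z ^ 2)) atTop (𝓝 I) ∧
      ENNReal.ofReal I = ∫⁻ z in {z | v z = 1}, ENNReal.ofReal (χ z * gradNorm v z)
        ∂(Measure.hausdorffMeasure 1) := by
  have hv1 : ContDiff ℝ 1 v := hv.contDiff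
  have hvd : Differentiable ℝ v := hv1.differentiable (by norm_num)
  obtain ⟨I₁, hI₁0, hI₁, hI₁e⟩ := hP.exists_tendsto_integral_partial hv hv0 hχ hχc hχ0
  obtain ⟨I₂, hI₂0, hI₂, hI₂e⟩ := hP.exists_tendsto_integral_partial (v := v ∘ mulI)
    (fun z _ => AnalyticAt.comp (hv _ (Set.mem_univ _))
      ((mulI.toContinuousLinearEquiv : ℂ →L[ℝ] ℂ).analyticAt z))
    (fun z => hv0 _) (hχ.comp mulI.continuous)
    (hχc.comp_isClosedEmbedding mulI.toHomeomorph.isClosedEmbedding) (fun z => hχ0 _)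
  simp only [fderiv_comp_mulI hvd, gradNorm_comp_mulI hvd, Complex.I_mul_I, map_neg, neg_sq,
    abs_neg, Function.comp_apply] at hI₂ hI₂e
  have hmp := mulI.measurePreserving
  have hmpH := mulI.toIsometryEquiv.measurePreserving_hausdorffMeasure 1
  have hemb := mulI.toHomeomorph.measurableEmbedding
  have hI₂' : Tendsto (fun n => ∫ z, χ z * (P' n (v z) * fderiv ℝ v z 1 ^ 2)) atTop (𝓝 I₂) :=
    hI₂.congr fun n => hmp.integral_comp hemb (fun z => χ z * (P' n (v z) * fderiv ℝ v z 1 ^ 2))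
  have hI₂e' : ENNReal.ofReal I₂ = ∫⁻ z in {z | v z = 1}, ENNReal.ofReal (χ z * |fderiv ℝ v z 1|) *
      ENNReal.ofReal (|fderiv ℝ v z 1| / gradNorm v z) ∂(Measure.hausdorffMeasure 1) := by
    rw [hI₂e]
    exact hmpH.setLIntegral_comp_preimage_emb hemb (fun z =>
      ENNReal.ofReal (χ z * |fderiv ℝ v z 1|) *
        ENNReal.ofReal (|fderiv ℝ v z 1| / gradNorm v z)) {z | v z = 1}
  have hY := continuous_fderiv_apply_const hv1 Complex.I
  have hX := continuous_fderiv_apply_const hv1 1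
  have hN := continuous_gradNorm hv1
  have hsq : ∀ z, gradNorm v z ^ 2 = fderiv ℝ v z 1 ^ 2 + fderiv ℝ v z Complex.I ^ 2 := fun z =>
    Real.sq_sqrt (by positivity)
  have hPc : ∀ n, Continuous fun z => P' n (v z) := fun n =>
    (hP.continuousOn n).comp_continuous hv1.continuous hv0
  refine ⟨I₁ + I₂, by positivity, (hI₁.add hI₂').congr fun n => ?_, ?_⟩
  · rw [← integral_add]
    · refine integral_congr_ae (Eventually.of_forall fun z => ?_)
      simp only [hsq]; ring
    · exact (hχ.mul ((hPc n).mul (hY.pow 2))).integrable_of_hasCompactSupport hχc.mul_right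
    · exact (hχ.mul ((hPc n).mul (hX.pow 2))).integrable_of_hasCompactSupport hχc.mul_right
  · have hm : Measurable fun z => ENNReal.ofReal (χ z * |fderiv ℝ v z Complex.I|) *
        ENNReal.ofReal (|fderiv ℝ v z Complex.I| / gradNorm v z) :=
      (hχ.mul hY.abs).measurable.ennreal_ofReal.mul
        (hY.measurable.abs.div hN.measurable).ennreal_ofReal
    rw [ENNReal.ofReal_add hI₁0 hI₂0, hI₁e, hI₂e', ← lintegral_add_left hm]
    refine lintegral_congr fun z => ?_
    have hN0 : 0 ≤ gradNorm v z := Real.sqrt_nonneg _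
    rw [← ENNReal.ofReal_mul (mul_nonneg (hχ0 z) (abs_nonneg _)),
      ← ENNReal.ofReal_mul (mul_nonneg (hχ0 z) (abs_nonneg _)),
      ← ENNReal.ofReal_add (mul_nonneg (mul_nonneg (hχ0 z) (abs_nonneg _))
        (div_nonneg (abs_nonneg _) hN0)) (mul_nonneg (mul_nonneg (hχ0 z) (abs_nonneg _))
        (div_nonneg (abs_nonneg _) hN0))]
    congr 1
    rcases eq_or_lt_of_le hN0 with h | h
    · rw [← h]; simp
    · have := hsq z
      have e1 : |fderiv ℝ v z 1| * |fderiv ℝ v z 1| = fderiv ℝ v z 1 ^ 2 := by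
        rw [← sq, sq_abs]
      have e2 : |fderiv ℝ v z Complex.I| * |fderiv ℝ v z Complex.I| =
          fderiv ℝ v z Complex.I ^ 2 := by
        rw [← sq, sq_abs]
      field_simp
      rw [this, sq_abs, sq_abs, add_comm]

/-! ### Linear forms in independent complex Gaussians -/

lemma measurable_gaussianDensity :
    Measurable fun z : ℂ => ENNReal.ofReal (Real.exp (-‖z‖ ^ 2) / Real.pi) := by fun_prop

lemma lintegral_stdComplexGaussian {u : ℂ → ℝ≥0∞} (hu : Measurable u) :
    ∫⁻ z, u z ∂stdComplexGaussian =
      ∫⁻ z, ENNReal.ofReal (Real.exp (-‖z‖ ^ 2) / Real.pi) * u z := by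
  unfold stdComplexGaussian
  rw [lintegral_withDensity_eq_lintegral_mul _ measurable_gaussianDensity hu]
  rfl

lemma integral_normSq_mul_exp (q : ℕ) {b : ℝ} (hb : 0 < b) :
    Integrable (fun z : ℂ => ‖z‖ ^ (2 * q) * Real.exp (-b * ‖z‖ ^ 2)) ∧
    ∫ z : ℂ, ‖z‖ ^ (2 * q) * Real.exp (-b * ‖z‖ ^ 2) = Real.pi * q.factorial / b ^ (q + 1) := by
  have h := Complex.integral_rpow_mul_exp_neg_mul_rpow (p := 2) (q := 2 * q) one_le_two
    (by have : (0 : ℝ) ≤ q := Nat.cast_nonneg q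
        linarith) hb
  have e1 : ((2 * q : ℝ) + 2) / 2 = q + 1 := by ring
  have e2 : -((2 * q : ℝ) + 2) / 2 = -((q + 1 : ℕ) : ℝ) := by push_cast; ring
  rw [e1, e2, Real.Gamma_nat_eq_factorial, Real.rpow_neg hb.le, Real.rpow_natCast] at h
  have e3 : ∀ z : ℂ, ‖z‖ ^ (2 * (q : ℝ)) * Real.exp (-b * ‖z‖ ^ (2 : ℝ)) =
      ‖z‖ ^ (2 * q) * Real.exp (-b * ‖z‖ ^ 2) := by
    intro z
    rw [← Real.rpow_natCast, ← Real.rpow_natCast]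
    push_cast
    rfl
  simp_rw [e3] at h
  have hval : ∫ z : ℂ, ‖z‖ ^ (2 * q) * Real.exp (-b * ‖z‖ ^ 2) =
      Real.pi * q.factorial / b ^ (q + 1) := by rw [h]; field_simp
  refine ⟨?_, hval⟩
  by_contra hni
  rw [integral_undef hni] at hval
  have : 0 < Real.pi * q.factorial / b ^ (q + 1) := by
    have := Nat.factorial_pos q
    positivity
  linarith

lemma lintegral_normSq_mul_exp_gaussian (q : ℕ) {b : ℝ} (hb : 0 ≤ b) :
    ∫⁻ z, ENNReal.ofReal (‖z‖ ^ (2 * q) * Real.exp (-b * ‖z‖ ^ 2)) ∂stdComplexGaussian =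
      ENNReal.ofReal (q.factorial / (1 + b) ^ (q + 1)) := by
  rw [lintegral_stdComplexGaussian (by fun_prop)]
  obtain ⟨hi, hv⟩ := integral_normSq_mul_exp q (b := 1 + b) (by linarith)
  have e : ∀ z : ℂ, ENNReal.ofReal (Real.exp (-‖z‖ ^ 2) / Real.pi) *
      ENNReal.ofReal (‖z‖ ^ (2 * q) * Real.exp (-b * ‖z‖ ^ 2)) =
      ENNReal.ofReal ((‖z‖ ^ (2 * q) * Real.exp (-(1 + b) * ‖z‖ ^ 2)) / Real.pi) := by
    intro z
    rw [← ENNReal.ofReal_mul (by positivity)]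
    congr 1
    rw [show -(1 + b) * ‖z‖ ^ 2 = -‖z‖ ^ 2 + -b * ‖z‖ ^ 2 by ring, Real.exp_add]
    ring
  simp_rw [e]
  rw [← ofReal_integral_eq_lintegral_ofReal (hi.div_const _)
    (Eventually.of_forall fun z => by positivity), integral_div, hv]
  congr 1
  field_simp

instance isProbabilityMeasure_stdComplexGaussian : IsProbabilityMeasure stdComplexGaussian := by
  constructor
  have := lintegral_normSq_mul_exp_gaussian 0 (le_refl (0 : ℝ))
  simpa [lintegral_one] using this

/-- The characteristic function of the standard complex Gaussian. -/
lemma integral_exp_re_mul_gaussian (c : ℂ) :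
    ∫ z, Complex.exp (((c * z).re : ℂ) * Complex.I) ∂stdComplexGaussian =
      Complex.exp (-(‖c‖ ^ 2 / 4 : ℝ)) := by
  have hd : ∀ z : ℂ, ENNReal.ofReal (Real.exp (-‖z‖ ^ 2) / Real.pi) < ∞ := fun z =>
    ENNReal.ofReal_lt_top
  unfold stdComplexGaussian
  rw [integral_withDensity_eq_integral_toReal_smul measurable_gaussianDensity
    (Eventually.of_forall hd)]
  have h := GaussianFourier.integral_cexp_neg_mul_sq_norm_add (b := 1) (V := ℂ) (by simp)
    Complex.I (conj c)
  have e : ∀ z : ℂ, (ENNReal.ofReal (Real.exp (-‖z‖ ^ 2) / Real.pi)).toReal •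
      Complex.exp (((c * z).re : ℂ) * Complex.I) =
      (1 / Real.pi : ℂ) *
        Complex.exp (-1 * (‖z‖ : ℂ) ^ 2 + Complex.I * (inner ℝ (conj c) z : ℝ)) := by
    intro z
    rw [ENNReal.toReal_ofReal (by positivity), Complex.exp_add, Complex.inner, Complex.conj_conj,
      Complex.real_smul]
    push_cast
    rw [mul_comm Complex.I, mul_comm z c, neg_one_mul]
    ring
  simp_rw [e]
  rw [integral_const_mul, h]
  have : (Module.finrank ℝ ℂ : ℂ) / 2 = 1 := by simp [Complex.finrank_real_complex]
  rw [this, Complex.cpow_one, Complex.I_sq, RCLike.norm_conj]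
  have hpi : (Real.pi : ℂ) ≠ 0 := by exact_mod_cast Real.pi_ne_zero
  rw [div_one, ← mul_assoc, one_div, inv_mul_cancel₀ hpi, one_mul]
  push_cast
  congr 1
  ring

lemma map_neg_stdComplexGaussian : stdComplexGaussian.map (fun z => -z) = stdComplexGaussian := by
  refine Measure.ext_of_lintegral _ fun u hu => ?_
  have hu' : Measurable fun z => u (-z) := hu.comp measurable_neg
  rw [lintegral_map hu measurable_neg, lintegral_stdComplexGaussian hu',
    lintegral_stdComplexGaussian hu, ← lintegral_neg_eq_self]
  simp

/-- The linear forms `a ↦ ∑ a_i g_i` and `a ↦ ∑ a_i w_i` in independent standard complex Gaussians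
are independent complex Gaussians if `g ⊥ w`. -/
lemma map_linearForms_gaussian {ι : Type*} [Fintype ι] (g w : ι → ℂ)
    (h : ∑ i, w i * conj (g i) = 0) :
    (Measure.pi fun _ : ι => stdComplexGaussian).map (fun a => (∑ i, a i * g i, ∑ i, a i * w i)) =
      (stdComplexGaussian.map fun z => (Real.sqrt (∑ i, ‖g i‖ ^ 2) : ℂ) * z).prod
        (stdComplexGaussian.map fun z => (Real.sqrt (∑ i, ‖w i‖ ^ 2) : ℂ) * z) := by
  set σ := Real.sqrt (∑ i, ‖g i‖ ^ 2) with hσ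
  set ρ := Real.sqrt (∑ i, ‖w i‖ ^ 2) with hρ
  have hσ2 : σ ^ 2 = ∑ i, ‖g i‖ ^ 2 := Real.sq_sqrt (Finset.sum_nonneg fun i _ => by positivity)
  have hρ2 : ρ ^ 2 = ∑ i, ‖w i‖ ^ 2 := Real.sq_sqrt (Finset.sum_nonneg fun i _ => by positivity)
  have hmX : Measurable fun a : ι → ℂ => (∑ i, a i * g i, ∑ i, a i * w i) := by fun_prop
  have m1 : Measurable fun z : ℂ => (σ : ℂ) * z := by fun_prop
  have m2 : Measurable fun z : ℂ => (ρ : ℂ) * z := by fun_prop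
  have := Measure.isProbabilityMeasure_map (μ := Measure.pi fun _ : ι => stdComplexGaussian)
    hmX.aemeasurable
  have := Measure.isProbabilityMeasure_map (μ := stdComplexGaussian) m1.aemeasurable
  have := Measure.isProbabilityMeasure_map (μ := stdComplexGaussian) m2.aemeasurable
  refine Measure.ext_of_charFunDual ?_
  ext L
  have hlin : ∀ M : ℂ →L[ℝ] ℝ, ∃ s : ℂ, ∀ z, M z = (s * z).re := fun M => by
    refine ⟨M 1 - M Complex.I * Complex.I, fun z => ?_⟩
    conv_lhs => rw [show z = z.re • (1 : ℂ) + z.im • Complex.I by simp [Complex.re_add_im]]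
    rw [map_add, map_smul, map_smul]
    simp [mul_comm]
  obtain ⟨s, hs⟩ := hlin (L.comp (ContinuousLinearMap.inl ℝ ℂ ℂ))
  obtain ⟨t, ht⟩ := hlin (L.comp (ContinuousLinearMap.inr ℝ ℂ ℂ))
  have hL : ∀ x y, L (x, y) = (s * x).re + (t * y).re := fun x y => by
    rw [← hs, ← ht]
    simp [← map_add]
  have hc : ∀ i, ‖s * g i + t * w i‖ ^ 2 = ‖s‖ ^ 2 * ‖g i‖ ^ 2 + ‖t‖ ^ 2 * ‖w i‖ ^ 2 +
      2 * (conj s * t * (w i * conj (g i))).re := by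
    intro i
    simp only [← Complex.normSq_eq_norm_sq]
    rw [Complex.normSq_add, Complex.normSq_mul, Complex.normSq_mul]
    congr 2
    rw [← Complex.conj_re]
    congr 1
    simp only [map_mul, Complex.conj_conj]
    ring
  have hcs : ∑ i, ‖s * g i + t * w i‖ ^ 2 = ‖s‖ ^ 2 * σ ^ 2 + ‖t‖ ^ 2 * ρ ^ 2 := by
    simp_rw [hc]
    rw [Finset.sum_add_distrib, Finset.sum_add_distrib, ← Finset.mul_sum, ← Finset.mul_sum,
      ← Finset.mul_sum, ← Complex.re_sum, ← Finset.mul_sum, h, hσ2, hρ2]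
    simp
  have hexp : Continuous fun v : ℂ × ℂ => Complex.exp ((L v : ℂ) * Complex.I) := by fun_prop
  rw [charFunDual_apply, charFunDual_apply, integral_map hmX.aemeasurable
    hexp.aestronglyMeasurable]
  have e1 : ∀ a : ι → ℂ, Complex.exp ((L (∑ i, a i * g i, ∑ i, a i * w i) : ℂ) * Complex.I) =
      ∏ i, Complex.exp ((((s * g i + t * w i) * a i).re : ℂ) * Complex.I) := by
    intro a
    rw [← Complex.exp_sum, ← Finset.sum_mul, ← Complex.ofReal_sum, ← Complex.re_sum, hL,
      ← Complex.add_re]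
    congr 4
    rw [Finset.mul_sum, Finset.mul_sum, ← Finset.sum_add_distrib]
    exact Finset.sum_congr rfl fun i _ => by ring
  simp_rw [e1]
  rw [integral_fintype_prod_eq_prod
    (f := fun i z => Complex.exp ((((s * g i + t * w i) * z).re : ℂ) * Complex.I))]
  simp_rw [integral_exp_re_mul_gaussian]
  have e2 : ∀ v : ℂ × ℂ, Complex.exp ((L v : ℂ) * Complex.I) =
      Complex.exp (((s * v.1).re : ℂ) * Complex.I) *
        Complex.exp (((t * v.2).re : ℂ) * Complex.I) := by
    rintro ⟨x, y⟩
    rw [hL, ← Complex.exp_add, ← add_mul, Complex.ofReal_add]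
  simp_rw [e2]
  rw [integral_prod_mul (fun x : ℂ => Complex.exp (((s * x).re : ℂ) * Complex.I))
    (fun y : ℂ => Complex.exp (((t * y).re : ℂ) * Complex.I)),
    integral_map m1.aemeasurable (by fun_prop),
    integral_map m2.aemeasurable (by fun_prop)]
  simp_rw [← mul_assoc]
  rw [integral_exp_re_mul_gaussian, integral_exp_re_mul_gaussian, ← Complex.exp_sum,
    ← Complex.exp_add]
  congr 1
  rw [Finset.sum_neg_distrib, ← Complex.ofReal_sum, ← Finset.sum_div, hcs, norm_mul, norm_mul,
    Complex.norm_real, Complex.norm_real, mul_pow, mul_pow, Real.norm_eq_abs, Real.norm_eq_abs,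
    sq_abs, sq_abs]
  push_cast
  ring

/-- For linear forms `X = ∑ a_i g_i` and `Y = ∑ a_i h_i` in independent standard complex Gaussians,
the expectation of `|Y|² exp(-|X|²)`. Splitting `h` into a multiple of `g` and a part orthogonal to
`g` reduces it to one-dimensional moments. -/
theorem lintegral_normSq_mul_exp_linearForms {ι : Type*} [Fintype ι] (g h : ι → ℂ) {K : ℝ}
    (hK : K = 1 + ∑ i, ‖g i‖ ^ 2) :
    ∫⁻ a, ENNReal.ofReal (‖∑ i, a i * h i‖ ^ 2 * Real.exp (-‖∑ i, a i * g i‖ ^ 2))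
        ∂(Measure.pi fun _ : ι => stdComplexGaussian) =
      ENNReal.ofReal ((∑ i, ‖h i‖ ^ 2) / K - ‖∑ i, h i * conj (g i)‖ ^ 2 / K ^ 2) := by
  set S := ∑ i, ‖g i‖ ^ 2 with hS
  have hS0 : 0 ≤ S := Finset.sum_nonneg fun i _ => by positivity
  set b := ∑ i, h i * conj (g i) with hb
  set c := b / (S : ℂ) with hc
  have hgS : ∑ i, g i * conj (g i) = (S : ℂ) := by
    rw [hS, Complex.ofReal_sum]
    exact Finset.sum_congr rfl fun i _ => by rw [Complex.mul_conj, Complex.normSq_eq_norm_sq]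
  have hcS : c * S = b := by
    rcases eq_or_lt_of_le hS0 with h0 | h0
    · have hg : ∀ i, g i = 0 := by
        intro i
        have := (Finset.sum_eq_zero_iff_of_nonneg (fun i _ => by positivity)).1 h0.symm i
          (Finset.mem_univ i)
        simpa using this
      have : b = 0 := by rw [hb]; simp [hg]
      rw [this, ← h0]; simp
    · rw [hc, div_mul_cancel₀]
      exact_mod_cast h0.ne'
  -- `w` is the component of `h` orthogonal to `g`.
  set w : ι → ℂ := fun i => h i - c * g i with hw
  have hort : ∑ i, w i * conj (g i) = 0 := by
    simp only [hw, sub_mul, Finset.sum_sub_distrib, mul_assoc]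
    rw [← Finset.mul_sum, hgS, hcS, hb, sub_self]
  set T := ∑ i, ‖w i‖ ^ 2 with hT
  have hT0 : 0 ≤ T := Finset.sum_nonneg fun i _ => by positivity
  have hTh : T = ∑ i, ‖h i‖ ^ 2 - ‖c‖ ^ 2 * S := by
    have e : ∀ i, ‖h i‖ ^ 2 = ‖w i‖ ^ 2 + ‖c‖ ^ 2 * ‖g i‖ ^ 2 +
        2 * (conj c * (w i * conj (g i))).re := by
      intro i
      have : h i = w i + c * g i := by simp [hw]
      rw [this]
      simp only [← Complex.normSq_eq_norm_sq]
      rw [Complex.normSq_add, Complex.normSq_mul]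
      congr 3
      simp only [map_mul]
      ring
    rw [hT, Finset.sum_congr rfl fun i _ => e i, Finset.sum_add_distrib, Finset.sum_add_distrib,
      ← Finset.mul_sum, ← Finset.mul_sum, ← Complex.re_sum, ← Finset.mul_sum, hort, ← hS]
    simp
  have hY : ∀ a : ι → ℂ, ∑ i, a i * h i = c * (∑ i, a i * g i) + ∑ i, a i * w i := by
    intro a
    rw [Finset.mul_sum, ← Finset.sum_add_distrib]
    exact Finset.sum_congr rfl fun i _ => by simp only [hw]; ring
  set Φ : ℂ × ℂ → ℝ≥0∞ := fun p =>
    ENNReal.ofReal (‖c * p.1 + p.2‖ ^ 2 * Real.exp (-‖p.1‖ ^ 2)) with hΦ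
  have hΦm : Measurable Φ := by fun_prop
  have hmX : Measurable fun a : ι → ℂ => (∑ i, a i * g i, ∑ i, a i * w i) := by fun_prop
  have step1 : ∫⁻ a, ENNReal.ofReal (‖∑ i, a i * h i‖ ^ 2 * Real.exp (-‖∑ i, a i * g i‖ ^ 2))
      ∂(Measure.pi fun _ : ι => stdComplexGaussian) =
      ∫⁻ x, ∫⁻ y, Φ (Real.sqrt S * x, Real.sqrt T * y) ∂stdComplexGaussian ∂stdComplexGaussian := by
    simp_rw [hY]
    rw [← lintegral_map (f := Φ) hΦm hmX, map_linearForms_gaussian g w hort,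
      Measure.map_prod_map _ _ (by fun_prop) (by fun_prop), lintegral_map hΦm (by fun_prop),
      lintegral_prod _ (by fun_prop)]
    rfl
  -- The cross term cancels because the law of the second variable is symmetric.
  have step2 : ∀ x : ℂ, ∫⁻ y, Φ (Real.sqrt S * x, Real.sqrt T * y) ∂stdComplexGaussian =
      ENNReal.ofReal (‖c‖ ^ 2 * S) * ENNReal.ofReal (‖x‖ ^ (2 * 1) * Real.exp (-S * ‖x‖ ^ 2)) +
        ENNReal.ofReal T * ENNReal.ofReal (‖x‖ ^ (2 * 0) * Real.exp (-S * ‖x‖ ^ 2)) := by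
    intro x
    set A := ∫⁻ y, Φ (Real.sqrt S * x, Real.sqrt T * y) ∂stdComplexGaussian with hA
    have hA' : A = ∫⁻ y, Φ (Real.sqrt S * x, Real.sqrt T * -y) ∂stdComplexGaussian := by
      rw [hA]
      conv_lhs => rw [← map_neg_stdComplexGaussian]
      rw [lintegral_map (by fun_prop) measurable_neg]
    have hsum : A + A = ∫⁻ y,
        ENNReal.ofReal (2 * (‖c‖ ^ 2 * S * (‖x‖ ^ 2 * Real.exp (-S * ‖x‖ ^ 2)))) +
        ENNReal.ofReal (2 * T * Real.exp (-S * ‖x‖ ^ 2)) *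
          ENNReal.ofReal (‖y‖ ^ (2 * 1) * Real.exp (-0 * ‖y‖ ^ 2)) ∂stdComplexGaussian := by
      conv_lhs => rw [hA']
      conv_lhs => enter [1]; rw [← hA', hA]
      rw [← lintegral_add_left (by fun_prop)]
      refine lintegral_congr fun y => ?_
      simp only [hΦ]
      rw [← ENNReal.ofReal_add (by positivity) (by positivity),
        ← ENNReal.ofReal_mul (by positivity), ← ENNReal.ofReal_add (by positivity) (by positivity)]
      congr 1
      have hpar := parallelogram_law_with_norm ℝ (c * (Real.sqrt S * x)) (Real.sqrt T * y)
      have n1 : ‖c * ((Real.sqrt S : ℂ) * x)‖ ^ 2 = ‖c‖ ^ 2 * (S * ‖x‖ ^ 2) := by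
        rw [norm_mul, norm_mul, Complex.norm_real, Real.norm_eq_abs, mul_pow, mul_pow, sq_abs,
          Real.sq_sqrt hS0]
      have n2 : ‖(Real.sqrt T : ℂ) * y‖ ^ 2 = T * ‖y‖ ^ 2 := by
        rw [norm_mul, Complex.norm_real, Real.norm_eq_abs, mul_pow, sq_abs, Real.sq_sqrt hT0]
      have n3 : ‖(Real.sqrt S : ℂ) * x‖ ^ 2 = S * ‖x‖ ^ 2 := by
        rw [norm_mul, Complex.norm_real, Real.norm_eq_abs, mul_pow, sq_abs, Real.sq_sqrt hS0]
      rw [mul_neg, ← sub_eq_add_neg, ← add_mul, n3]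
      have : ‖c * ((Real.sqrt S : ℂ) * x) + (Real.sqrt T : ℂ) * y‖ ^ 2 +
          ‖c * ((Real.sqrt S : ℂ) * x) - (Real.sqrt T : ℂ) * y‖ ^ 2 =
          2 * (‖c‖ ^ 2 * (S * ‖x‖ ^ 2) + T * ‖y‖ ^ 2) := by
        rw [← n1, ← n2]; nlinarith [hpar]
      rw [this]
      simp
      ring
    rw [lintegral_add_left measurable_const, lintegral_const, measure_univ, mul_one,
      lintegral_const_mul _ (by fun_prop), lintegral_normSq_mul_exp_gaussian 1 le_rfl] at hsum
    have h2 : (2 : ℝ≥0∞) * A = 2 * (ENNReal.ofReal (‖c‖ ^ 2 * S) *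
        ENNReal.ofReal (‖x‖ ^ (2 * 1) * Real.exp (-S * ‖x‖ ^ 2)) +
        ENNReal.ofReal T * ENNReal.ofReal (‖x‖ ^ (2 * 0) * Real.exp (-S * ‖x‖ ^ 2))) := by
      rw [two_mul, hsum, ← ENNReal.ofReal_mul (by positivity), ← ENNReal.ofReal_mul (by positivity),
        ← ENNReal.ofReal_mul (by positivity), ← ENNReal.ofReal_add (by positivity) (by positivity),
        ← ENNReal.ofReal_add (by positivity) (by positivity),
        show (2 : ℝ≥0∞) = ENNReal.ofReal 2 by simp, ← ENNReal.ofReal_mul (by positivity)]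
      congr 1
      simp
      ring
    exact (ENNReal.mul_right_inj two_ne_zero ENNReal.ofNat_ne_top).1 h2
  rw [step1]
  simp_rw [step2]
  rw [lintegral_add_left (by fun_prop), lintegral_const_mul _ (by fun_prop),
    lintegral_const_mul _ (by fun_prop), lintegral_normSq_mul_exp_gaussian 1 hS0,
    lintegral_normSq_mul_exp_gaussian 0 hS0, ← ENNReal.ofReal_mul (by positivity),
    ← ENNReal.ofReal_mul hT0, ← ENNReal.ofReal_add (by positivity) (by positivity), ← hK]
  congr 1
  have hb2 : ‖b‖ ^ 2 = ‖c‖ ^ 2 * S ^ 2 := by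
    rw [← hcS, norm_mul, Complex.norm_real, Real.norm_eq_abs, mul_pow, sq_abs]
  have hKp : 0 < K := by rw [hK]; linarith
  rw [hb2, hTh]
  have : S = K - 1 := by rw [hK]; ring
  rw [this]
  field_simp
  simp
  ring

/-! ### Measurability of sums over zeros -/

lemma isClosed_exists_zero_mem {X : Type*} [TopologicalSpace X] {F : X → ℂ → ℂ}
    (hF : Continuous (Function.uncurry F)) {B : Set ℂ} (hB : IsCompact B) :
    IsClosed {a | ∃ z ∈ B, F a z = 0} := by
  have : CompactSpace B := isCompact_iff_compactSpace.1 hB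
  have hC : IsClosed {p : X × B | F p.1 p.2 = 0} :=
    isClosed_eq (hF.comp (continuous_fst.prodMk (continuous_subtype_val.comp continuous_snd)))
      continuous_const
  have := isClosedMap_fst_of_compactSpace (X := X) (Y := B) _ hC
  convert this using 1
  ext a
  simp

/-- A sum over the points of `Z` is the supremum, over finite families of disjoint small balls that
meet `Z`, of the sums of the infima of `u` over the balls. This reduces measurability in `Z` to the
events that `Z` meets a given ball. -/
lemma tsum_indicator_eq_iSup_balls {u : ℂ → ℝ≥0∞} (hu : Continuous u) (Z : Set ℂ) :
    ∑' z, Z.indicator u z =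
      ⨆ (m : ℕ) (K : Finset ℕ) (_ : (K : Set ℕ).PairwiseDisjoint
        fun k => Metric.closedBall (TopologicalSpace.denseSeq ℂ k) (1 / (m + 1) : ℝ)),
      ∑ k ∈ K, (⨅ z ∈ Metric.closedBall (TopologicalSpace.denseSeq ℂ k) (1 / (m + 1) : ℝ), u z) *
        Set.indicator {k | ∃ z ∈ Metric.closedBall (TopologicalSpace.denseSeq ℂ k)
          (1 / (m + 1) : ℝ), z ∈ Z} 1 k := by
  set B : ℕ → ℕ → Set ℂ := fun m k =>
    Metric.closedBall (TopologicalSpace.denseSeq ℂ k) (1 / (m + 1) : ℝ) with hBdef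
  apply le_antisymm
  · rw [ENNReal.tsum_eq_iSup_sum]
    refine iSup_le fun s => ?_
    classical
    rw [← Finset.sum_filter_add_sum_filter_not s (fun z => z ∈ Z)]
    have hz : ∑ z ∈ s with z ∉ Z, Z.indicator u z = 0 :=
      Finset.sum_eq_zero fun z hz => Set.indicator_of_notMem (Finset.mem_filter.1 hz).2 _
    rw [hz, add_zero]
    set t := s.filter (fun z => z ∈ Z) with ht
    have htZ : ∀ z ∈ t, z ∈ Z := fun z hz => (Finset.mem_filter.1 hz).2
    rw [Finset.sum_congr rfl fun z hz => Set.indicator_of_mem (htZ z hz) u]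
    -- Balls of radius `1 / (m + 1)` that contain the points of `t`.
    have hk : ∀ (m : ℕ) (z : ℂ), ∃ k, z ∈ B m k := by
      intro m z
      obtain ⟨k, hk⟩ := (TopologicalSpace.denseRange_denseSeq ℂ).exists_dist_lt z
        (show (0 : ℝ) < 1 / (m + 1) by positivity)
      exact ⟨k, hk.le⟩
    choose κ hκ using hk
    have hinf : ∀ z, Tendsto (fun m => ⨅ w ∈ B m (κ m z), u w) atTop (𝓝 (u z)) := by
      intro z
      rw [tendsto_order]
      constructor
      · intro c hc
        obtain ⟨c', hc', hc'u⟩ := exists_between hc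
        have := hu.continuousAt.eventually_const_lt hc'u
        obtain ⟨δ, hδ, hball⟩ := Metric.eventually_nhds_iff.1 this
        have hlim := tendsto_one_div_add_atTop_nhds_zero_nat (𝕜 := ℝ)
        filter_upwards [hlim.eventually_lt_const (show (0 : ℝ) < δ / 2 by linarith)] with m hm
        refine hc'.trans_le (le_iInf₂ fun w hw => (hball ?_).le)
        have h1 : dist z (TopologicalSpace.denseSeq ℂ (κ m z)) ≤ 1 / (m + 1) := hκ m z
        have h2 : dist w (TopologicalSpace.denseSeq ℂ (κ m z)) ≤ 1 / (m + 1) := hw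
        have := dist_triangle_right w z (TopologicalSpace.denseSeq ℂ (κ m z))
        linarith
      · intro c hc
        exact Eventually.of_forall fun m => (iInf₂_le z (hκ m z)).trans_lt hc
    have hlim : Tendsto (fun m => ∑ z ∈ t, ⨅ w ∈ B m (κ m z), u w) atTop (𝓝 (∑ z ∈ t, u z)) :=
      tendsto_finsetSum _ fun z _ => hinf z
    refine le_of_tendsto hlim ?_
    have hsep : ∀ᶠ m : ℕ in atTop, ∀ z ∈ t, ∀ w ∈ t, z ≠ w →
        Disjoint (B m (κ m z)) (B m (κ m w)) := by
      rw [Filter.eventually_all_finset]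
      intro z _
      rw [Filter.eventually_all_finset]
      intro w _
      by_cases hzw : z = w
      · exact Eventually.of_forall fun m h => (h hzw).elim
      have hd := dist_pos.2 hzw
      have hlim := tendsto_one_div_add_atTop_nhds_zero_nat (𝕜 := ℝ)
      filter_upwards [hlim.eventually_lt_const (show (0 : ℝ) < dist z w / 4 by linarith)]
        with m hm _
      rw [Set.disjoint_left]
      intro x hx hx'
      have h1 : dist z (TopologicalSpace.denseSeq ℂ (κ m z)) ≤ 1 / (m + 1) := hκ m z
      have h2 : dist w (TopologicalSpace.denseSeq ℂ (κ m w)) ≤ 1 / (m + 1) := hκ m w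
      have h3 : dist x (TopologicalSpace.denseSeq ℂ (κ m z)) ≤ 1 / (m + 1) := hx
      have h4 : dist x (TopologicalSpace.denseSeq ℂ (κ m w)) ≤ 1 / (m + 1) := hx'
      have := dist_triangle_right z x (TopologicalSpace.denseSeq ℂ (κ m z))
      have := dist_triangle_right x w (TopologicalSpace.denseSeq ℂ (κ m w))
      have := dist_triangle z x w
      linarith
    filter_upwards [hsep] with m hm
    have hinj : Set.InjOn (κ m) t := by
      intro z hz w hw e
      by_contra h
      have := hm z hz w hw h
      rw [← e] at this
      exact Set.disjoint_left.1 this (hκ m z) (hκ m z)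
    have hdis : ((t.image (κ m) : Finset ℕ) : Set ℕ).PairwiseDisjoint (B m) := by
      intro i hi j hj hij
      obtain ⟨z, hz, rfl⟩ := Finset.mem_image.1 (Finset.mem_coe.1 hi)
      obtain ⟨w, hw, rfl⟩ := Finset.mem_image.1 (Finset.mem_coe.1 hj)
      exact hm z hz w hw fun e => hij (by rw [e])
    refine le_trans ?_ (le_iSup_of_le m (le_iSup_of_le (t.image (κ m)) (le_iSup_of_le hdis le_rfl)))
    rw [Finset.sum_image hinj]
    refine Finset.sum_le_sum fun z hz => ?_
    rw [Set.indicator_of_mem (show κ m z ∈ {k | ∃ z ∈ B m k, z ∈ Z} from ⟨z, hκ m z, htZ z hz⟩)]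
    simp [hBdef]
  · refine iSup_le fun m => iSup_le fun K => iSup_le fun hK => ?_
    classical
    set K' := K.filter fun k => ∃ z ∈ B m k, z ∈ Z with hK'
    have hex : ∀ k, ∃ z, k ∈ K' → z ∈ B m k ∧ z ∈ Z := by
      intro k
      by_cases hk : k ∈ K'
      · obtain ⟨z, hz, hzZ⟩ := (Finset.mem_filter.1 hk).2
        exact ⟨z, fun _ => ⟨hz, hzZ⟩⟩
      · exact ⟨0, fun h => (hk h).elim⟩
    choose ζ hζ using hex
    have hinj : Set.InjOn ζ K' := by
      intro i hi j hj e
      by_contra h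
      have := hK (Finset.mem_filter.1 hi).1 (Finset.mem_filter.1 hj).1 h
      exact Set.disjoint_left.1 this (hζ i hi).1 (e ▸ (hζ j hj).1)
    calc _ = ∑ k ∈ K', ⨅ z ∈ B m k, u z := by
          rw [hK', Finset.sum_filter]
          refine Finset.sum_congr rfl fun k _ => ?_
          by_cases h : ∃ z ∈ B m k, z ∈ Z
          · rw [if_pos h, Set.indicator_of_mem (show k ∈ {k | ∃ z ∈ B m k, z ∈ Z} from h)]
            simp [hBdef]
          · rw [if_neg h, Set.indicator_of_notMem (show k ∉ {k | ∃ z ∈ B m k, z ∈ Z} from h)]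
            simp
      _ ≤ ∑ k ∈ K', Z.indicator u (ζ k) := Finset.sum_le_sum fun k hk => by
          rw [Set.indicator_of_mem (hζ k hk).2]
          exact iInf₂_le _ (hζ k hk).1
      _ = ∑ z ∈ K'.image ζ, Z.indicator u z := (Finset.sum_image hinj).symm
      _ ≤ _ := ENNReal.sum_le_tsum _

/-- The sum of a continuous function over the zeros, counted without multiplicity, of a function
that depends continuously on a parameter is a measurable function of the parameter. -/
lemma measurable_tsum_zeros {X : Type*} [TopologicalSpace X] [MeasurableSpace X]
    [OpensMeasurableSpace X] {F : X → ℂ → ℂ} (hF : Continuous (Function.uncurry F))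
    {u : ℂ → ℝ≥0∞} (hu : Continuous u) :
    Measurable fun a => ∑' z, {z | F a z = 0}.indicator u z := by
  simp_rw [tsum_indicator_eq_iSup_balls hu]
  refine Measurable.iSup fun m => Measurable.iSup fun K => Measurable.iSup fun _ =>
    Finset.measurable_sum _ fun k _ => Measurable.const_mul ?_ _
  have hm := (isClosed_exists_zero_mem hF (isCompact_closedBall (TopologicalSpace.denseSeq ℂ k)
    (1 / (m + 1) : ℝ))).measurableSet
  have e : (fun a => Set.indicator {k | ∃ z ∈ Metric.closedBall (TopologicalSpace.denseSeq ℂ k)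
      (1 / (m + 1) : ℝ), z ∈ {z | F a z = 0}} (1 : ℕ → ℝ≥0∞) k) =
      Set.indicator {a | ∃ z ∈ Metric.closedBall (TopologicalSpace.denseSeq ℂ k)
      (1 / (m + 1) : ℝ), F a z = 0} 1 := by
    ext a
    simp [Set.indicator]
  rw [e]
  exact measurable_one.indicator hm

/-- Resampling one coordinate of independent variables does not change expectations. -/
lemma lintegral_pi_update {ι : Type*} [Fintype ι] [DecidableEq ι] {E : Type*} [MeasurableSpace E]
    (γ : Measure E) [IsProbabilityMeasure γ] (i₀ : ι) {F : (ι → E) → ℝ≥0∞} (hF : Measurable F) :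
    ∫⁻ a, F a ∂(Measure.pi fun _ => γ) =
      ∫⁻ a, ∫⁻ w, F (Function.update a i₀ w) ∂γ ∂(Measure.pi fun _ => γ) := by
  set F₂ : (ι → E) → ℝ≥0∞ := fun a => ∫⁻ w, F (Function.update a i₀ w) ∂γ with hF₂
  have hF₂m : Measurable F₂ := by
    have : Measurable (Function.uncurry fun (a : ι → E) (w : E) => F (Function.update a i₀ w)) := by
      refine hF.comp ?_
      exact measurable_update'
    exact this.lintegral_prod_right'
  rcases isEmpty_or_nonempty E with hE | ⟨⟨e⟩⟩
  · have : IsEmpty (ι → E) := ⟨fun a => hE.elim (a i₀)⟩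
    rw [lintegral_of_isEmpty, lintegral_of_isEmpty]
  set x₀ : ι → E := fun _ => e
  rw [lintegral_eq_lmarginal_univ x₀, lintegral_eq_lmarginal_univ x₀]
  have hi : i₀ ∉ Finset.univ.erase i₀ := Finset.notMem_erase _ _
  rw [← Finset.insert_erase (Finset.mem_univ i₀), lmarginal_insert' _ hF hi,
    lmarginal_insert' _ hF₂m hi]
  congr 1
  ext x
  simp [hF₂]

/-! ### Zeros of Gaussian linear combinations of entire functions -/

section GaussianCombination

variable {ι : Type*} [Fintype ι] {g : ι → ℂ → ℂ} {i₀ : ι}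

lemma continuous_uncurry_linComb (hg : ∀ i, Continuous (g i)) :
    Continuous (Function.uncurry fun (a : ι → ℂ) (z : ℂ) => ∑ i, a i * g i z) := by
  unfold Function.uncurry
  exact continuous_finsetSum _ fun i _ => ((continuous_apply i).comp continuous_fst).mul
    ((hg i).comp continuous_snd)

lemma hasDerivAt_linComb (hg : ∀ i, Differentiable ℂ (g i)) (a : ι → ℂ) (z : ℂ) :
    HasDerivAt (fun z => ∑ i, a i * g i z) (∑ i, a i * deriv (g i) z) z :=
  HasDerivAt.fun_sum fun i _ => ((hg i z).hasDerivAt).const_mul (a i)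

variable [DecidableEq ι]

lemma hasDerivAt_linComb_erase (hg : ∀ i, Differentiable ℂ (g i)) (hi₀ : ∀ z, g i₀ z = 1)
    (a : ι → ℂ) (z : ℂ) :
    HasDerivAt (fun z => ∑ i, a i * (if i = i₀ then 0 else g i z))
      (∑ i, a i * deriv (g i) z) z := by
  refine HasDerivAt.fun_sum fun i _ => HasDerivAt.const_mul (a i) ?_
  by_cases h : i = i₀
  · subst h
    have : g i = fun _ => 1 := funext hi₀
    simp only [if_true, this, deriv_const]
    exact hasDerivAt_const z 0
  · simp only [h, if_false]
    exact (hg i z).hasDerivAt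

lemma linComb_update (hi₀ : ∀ z, g i₀ z = 1) (a : ι → ℂ) (w z : ℂ) :
    ∑ i, Function.update a i₀ w i * g i z = w + ∑ i, a i * (if i = i₀ then 0 else g i z) := by
  have : ∀ i, Function.update a i₀ w i * g i z =
      (if i = i₀ then w else 0) + a i * (if i = i₀ then 0 else g i z) := by
    intro i
    by_cases h : i = i₀
    · subst h; simp [hi₀]
    · simp [h]
  simp_rw [this]
  rw [Finset.sum_add_distrib]
  simp

lemma deriv_linComb_update (hi₀ : ∀ z, g i₀ z = 1) (a : ι → ℂ) (w z : ℂ) :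
    ∑ i, Function.update a i₀ w i * deriv (g i) z = ∑ i, a i * deriv (g i) z := by
  refine Finset.sum_congr rfl fun i _ => ?_
  by_cases h : i = i₀
  · subst h
    have : g i = fun _ => 1 := funext hi₀
    simp [this]
  · simp [h]

/-- Almost surely a Gaussian linear combination of entire functions that include a constant has only
simple zeros: the constant coefficient has to avoid the critical values of the rest. -/
lemma ae_simple_zeros (hg : ∀ i, Differentiable ℂ (g i)) (hi₀ : ∀ z, g i₀ z = 1) :
    ∀ᵐ a ∂(Measure.pi fun _ : ι => stdComplexGaussian),
      ∀ z, ∑ i, a i * g i z = 0 → ∑ i, a i * deriv (g i) z ≠ 0 := by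
  have hgc : ∀ i, Continuous (g i) := fun i => (hg i).continuous
  have hgc' : ∀ i, Continuous (deriv (g i)) := fun i =>
    ((hg i).contDiff (n := 1)).continuous_deriv le_rfl
  set S : Set (ι → ℂ) := {a | ∃ z, ∑ i, a i * g i z = 0 ∧ ∑ i, a i * deriv (g i) z = 0} with hS
  have hSm : MeasurableSet S := by
    set F : (ι → ℂ) → ℂ → ℂ := fun a z =>
      ((‖∑ i, a i * g i z‖ + ‖∑ i, a i * deriv (g i) z‖ : ℝ) : ℂ) with hF
    have hFc : Continuous (Function.uncurry F) :=
      Complex.continuous_ofReal.comp ((continuous_uncurry_linComb hgc).norm.add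
        (continuous_uncurry_linComb hgc').norm)
    have hFz : ∀ a z, F a z = 0 ↔ ∑ i, a i * g i z = 0 ∧ ∑ i, a i * deriv (g i) z = 0 := by
      intro a z
      simp only [hF]
      rw [Complex.ofReal_eq_zero, add_eq_zero_iff_of_nonneg (norm_nonneg _) (norm_nonneg _),
        norm_eq_zero, norm_eq_zero]
    have : S = ⋃ m : ℕ, {a | ∃ z ∈ Metric.closedBall (0 : ℂ) m, F a z = 0} := by
      ext a
      simp only [hS, Set.mem_ofPred_eq, Set.mem_iUnion, hFz]
      constructor
      · rintro ⟨z, hz⟩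
        obtain ⟨m, hm⟩ := exists_nat_ge ‖z‖
        exact ⟨m, z, by simpa using hm, hz⟩
      · rintro ⟨m, z, -, hz⟩
        exact ⟨z, hz⟩
    rw [this]
    exact MeasurableSet.iUnion fun m =>
      (isClosed_exists_zero_mem hFc (isCompact_closedBall 0 m)).measurableSet
  have hnull : (Measure.pi fun _ : ι => stdComplexGaussian) S = 0 := by
    rw [← lintegral_indicator_one hSm, lintegral_pi_update stdComplexGaussian i₀
      (measurable_one.indicator hSm)]
    rw [lintegral_eq_zero_of_ae_eq_zero]
    refine Eventually.of_forall fun a => ?_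
    simp only [Pi.zero_apply]
    set H : ℂ → ℂ := fun z => -∑ i, a i * (if i = i₀ then 0 else g i z) with hH
    have hHd : ∀ z, HasDerivAt H (-∑ i, a i * deriv (g i) z) z := fun z =>
      (hasDerivAt_linComb_erase hg hi₀ a z).neg
    set T : Set ℂ := {z | ∑ i, a i * deriv (g i) z = 0} with hT
    have hcrit : volume (H '' T) = 0 := by
      refine addHaar_image_eq_zero_of_det_fderivWithin_eq_zero volume
        (fun z _ => ((hHd z).hasFDerivAt.restrictScalars ℝ).hasFDerivWithinAt) fun z hz => ?_
      have : ∑ i, a i * deriv (g i) z = 0 := hz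
      rw [← abs_eq_zero, abs_det_restrictScalars_toSpanSingleton, this]
      simp
    have hcrit' : stdComplexGaussian (H '' T) = 0 := withDensity_absolutelyContinuous _ _ hcrit
    have hae : ∀ᵐ w ∂stdComplexGaussian, w ∉ H '' T := measure_eq_zero_iff_ae_notMem.1 hcrit'
    rw [lintegral_eq_zero_of_ae_eq_zero]
    filter_upwards [hae] with w hw
    apply Set.indicator_of_notMem
    rintro ⟨z, hz1, hz2⟩
    rw [linComb_update hi₀] at hz1
    rw [deriv_linComb_update hi₀] at hz2
    exact hw ⟨z, hz2, (eq_neg_of_add_eq_zero_left hz1).symm⟩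
  filter_upwards [measure_eq_zero_iff_ae_notMem.1 hnull] with a ha z hz hz'
  exact ha ⟨z, hz, hz'⟩

/-- Density of the expected number of zeros (without multiplicity) of a Gaussian linear combination
of entire functions that include the constant `1`. Given the other coefficients, the zeros are the
solutions of `H = w`, where `w` is the coefficient of the constant and `-H` is the rest of the
combination, so the area formula for `H` integrates `w` out. -/
theorem lintegral_tsum_zeros_gaussian (hg : ∀ i, Differentiable ℂ (g i)) (hi₀ : ∀ z, g i₀ z = 1)
    {u : ℂ → ℝ≥0∞} (hu : Continuous u) :
    ∫⁻ a, ∑' z, {z | ∑ i, a i * g i z = 0}.indicator u z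
        ∂(Measure.pi fun _ : ι => stdComplexGaussian) =
      ∫⁻ z, u z * ENNReal.ofReal (1 / Real.pi *
        ((∑ i, ‖deriv (g i) z‖ ^ 2) / (∑ i, ‖g i z‖ ^ 2) -
          ‖∑ i, deriv (g i) z * conj (g i z)‖ ^ 2 / (∑ i, ‖g i z‖ ^ 2) ^ 2)) := by
  have hgc : ∀ i, Continuous (g i) := fun i => (hg i).continuous
  have hgc' : ∀ i, Continuous (deriv (g i)) := fun i =>
    ((hg i).contDiff (n := 1)).continuous_deriv le_rfl
  have hgtc : ∀ i, Continuous fun z => if i = i₀ then 0 else g i z := by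
    intro i
    by_cases h : i = i₀
    · simp only [h, if_true]; exact continuous_const
    · simp only [h, if_false]; exact hgc i
  rw [lintegral_pi_update stdComplexGaussian i₀
    (measurable_tsum_zeros (continuous_uncurry_linComb hgc) hu)]
  have step1 : ∀ a : ι → ℂ,
      ∫⁻ w, ∑' z, {z | ∑ i, Function.update a i₀ w i * g i z = 0}.indicator u z
        ∂stdComplexGaussian =
      ∫⁻ z, u z * (ENNReal.ofReal (1 / Real.pi) * ENNReal.ofReal (‖∑ i, a i * deriv (g i) z‖ ^ 2 *
        Real.exp (-‖∑ i, a i * (if i = i₀ then 0 else g i z)‖ ^ 2))) := by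
    intro a
    set H : ℂ → ℂ := fun z => -∑ i, a i * (if i = i₀ then 0 else g i z) with hH
    have hHd : ∀ z, HasDerivAt H (-∑ i, a i * deriv (g i) z) z := fun z =>
      (hasDerivAt_linComb_erase hg hi₀ a z).neg
    have hfs : ∀ w, ∑' z, {z | ∑ i, Function.update a i₀ w i * g i z = 0}.indicator u z =
        fiberSum H Set.univ u w := by
      intro w
      unfold fiberSum
      congr 1
      ext z
      have : (∑ i, Function.update a i₀ w i * g i z = 0) ↔ H z = w := by
        rw [linComb_update hi₀, hH, neg_eq_iff_add_eq_zero, add_comm]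
      simp [Set.indicator, this]
    simp_rw [hfs]
    have hm : Measurable fun w => fiberSum H Set.univ u w := by
      simp_rw [← hfs]
      exact (measurable_tsum_zeros (continuous_uncurry_linComb hgc) hu).comp (measurable_update a)
    rw [lintegral_stdComplexGaussian hm]
    rw [lintegral_congr fun w => mul_comm (ENNReal.ofReal (Real.exp (-‖w‖ ^ 2) / Real.pi))
      (fiberSum H Set.univ u w),
      lintegral_fiberSum_entire (fun z => (hHd z).differentiableAt) hu.measurable
        measurable_gaussianDensity]
    refine lintegral_congr fun z => ?_
    rw [(hHd z).deriv, hH, norm_neg, enorm_neg, mul_assoc, ← ofReal_norm,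
      ← ENNReal.ofReal_pow (norm_nonneg _), ← ENNReal.ofReal_mul (by positivity),
      ← ENNReal.ofReal_mul (by positivity)]
    congr 2
    ring
  simp_rw [step1]
  rw [lintegral_lintegral_swap]
  · refine lintegral_congr fun z => ?_
    have m1 : Measurable fun a : ι → ℂ => ENNReal.ofReal (‖∑ i, a i * deriv (g i) z‖ ^ 2 *
        Real.exp (-‖∑ i, a i * (if i = i₀ then 0 else g i z)‖ ^ 2)) := by fun_prop
    rw [lintegral_const_mul _ (m1.const_mul _), lintegral_const_mul _ m1]
    have hK : ∑ i, ‖g i z‖ ^ 2 = 1 + ∑ i, ‖(if i = i₀ then 0 else g i z)‖ ^ 2 := by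
      rw [← Finset.add_sum_erase _ _ (Finset.mem_univ i₀), hi₀,
        ← Finset.add_sum_erase _ (fun i => ‖(if i = i₀ then 0 else g i z)‖ ^ 2)
          (Finset.mem_univ i₀)]
      simp only [if_true, norm_one, one_pow, norm_zero]
      rw [zero_pow two_ne_zero, zero_add]
      congr 1
      refine Finset.sum_congr rfl fun i hi => ?_
      rw [if_neg (Finset.ne_of_mem_erase hi)]
    have hb : ∑ i, deriv (g i) z * conj (if i = i₀ then 0 else g i z) =
        ∑ i, deriv (g i) z * conj (g i z) := by
      refine Finset.sum_congr rfl fun i _ => ?_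
      by_cases h : i = i₀
      · subst h
        have : g i = fun _ => 1 := funext hi₀
        simp [this]
      · simp [h]
    rw [lintegral_normSq_mul_exp_linearForms _ _ hK, ← ENNReal.ofReal_mul (by positivity), hb]
  · refine Measurable.aemeasurable ?_
    have c1 := continuous_uncurry_linComb hgc'
    have c2 := continuous_uncurry_linComb hgtc
    exact (hu.measurable.comp measurable_snd).mul (measurable_const.mul
      ((c1.norm.pow 2).mul
        (Real.continuous_exp.comp (c2.norm.pow 2).neg)).measurable.ennreal_ofReal)

end GaussianCombination

/-! ### The geometric sum and its logarithmic derivative -/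

/-- The truncated geometric series `1 + s + ⋯ + s ^ n`. -/
def geomSum {R : Type*} [CommRing R] (n : ℕ) (s : R) : R := ∑ ν ∈ Finset.range (n + 1), s ^ ν

/-- The first derivative of `geomSum`. -/
def geomSumDeriv {R : Type*} [CommRing R] (n : ℕ) (s : R) : R :=
  ∑ ν ∈ Finset.range (n + 1), (ν : R) * s ^ (ν - 1)

/-- The second derivative of `geomSum`. -/
def geomSumDeriv2 {R : Type*} [CommRing R] (n : ℕ) (s : R) : R :=
  ∑ ν ∈ Finset.range (n + 1), (ν : R) * (((ν - 1 : ℕ) : R) * s ^ (ν - 1 - 1))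

lemma hasDerivAt_geomSum {𝕜 : Type*} [NontriviallyNormedField 𝕜] (n : ℕ) (s : 𝕜) :
    HasDerivAt (geomSum n) (geomSumDeriv n s) s :=
  HasDerivAt.fun_sum fun ν _ => hasDerivAt_pow ν s

lemma hasDerivAt_geomSumDeriv {𝕜 : Type*} [NontriviallyNormedField 𝕜] (n : ℕ) (s : 𝕜) :
    HasDerivAt (geomSumDeriv n) (geomSumDeriv2 n s) s :=
  HasDerivAt.fun_sum fun ν _ => (hasDerivAt_pow (ν - 1) s).const_mul _

lemma one_le_geomSum (n : ℕ) {s : ℝ} (hs : 0 ≤ s) : 1 ≤ geomSum n s := by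
  unfold geomSum
  rw [Finset.sum_range_succ']
  simp only [pow_zero, le_add_iff_nonneg_left]
  exact Finset.sum_nonneg fun i _ => by positivity

lemma pow_le_geomSum (n : ℕ) {s : ℝ} (hs : 0 ≤ s) : s ^ n ≤ geomSum n s :=
  Finset.single_le_sum (f := fun ν => s ^ ν) (fun i _ => by positivity)
    (Finset.mem_range.2 (Nat.lt_succ_self n))

lemma geomSumDeriv_nonneg (n : ℕ) {s : ℝ} (hs : 0 ≤ s) : 0 ≤ geomSumDeriv n s :=
  Finset.sum_nonneg fun i _ => by positivity

lemma mul_geomSumDeriv (n : ℕ) (s : ℝ) :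
    s * geomSumDeriv n s = ∑ ν ∈ Finset.range (n + 1), (ν : ℝ) * s ^ ν := by
  unfold geomSumDeriv
  rw [Finset.mul_sum]
  refine Finset.sum_congr rfl fun ν _ => ?_
  rcases ν with _ | ν
  · simp
  · rw [Nat.add_sub_cancel, pow_succ]; ring

lemma geomSumDeriv_add_mul (n : ℕ) (s : ℝ) :
    geomSumDeriv n s + s * geomSumDeriv2 n s =
      ∑ ν ∈ Finset.range (n + 1), (ν : ℝ) ^ 2 * s ^ (ν - 1) := by
  unfold geomSumDeriv geomSumDeriv2
  rw [Finset.mul_sum, ← Finset.sum_add_distrib]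
  refine Finset.sum_congr rfl fun ν _ => ?_
  rcases ν with _ | _ | ν
  · simp
  · simp
  · simp only [Nat.add_sub_cancel]
    push_cast
    rw [pow_succ]; ring

/-- The logarithmic derivative of `geomSum n`, divided by `n`. -/
noncomputable def logDerivGeom (n : ℕ) (s : ℝ) : ℝ := geomSumDeriv n s / (n * geomSum n s)

/-- `s · (log geomSum n)'(s) / n`, the mean degree of a monomial divided by `n`; it increases from
`0` to `1` on `[0, ∞)`. -/
noncomputable def meanDegree (n : ℕ) (s : ℝ) : ℝ := s * geomSumDeriv n s / (n * geomSum n s)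

/-- The derivative of `meanDegree n`. -/
noncomputable def meanDegreeDeriv (n : ℕ) (s : ℝ) : ℝ :=
  ((geomSumDeriv n s + s * geomSumDeriv2 n s) * geomSum n s - s * geomSumDeriv n s ^ 2) /
    (n * geomSum n s ^ 2)

lemma meanDegree_eq (n : ℕ) (s : ℝ) : meanDegree n s = s * logDerivGeom n s := by
  unfold meanDegree logDerivGeom; ring

lemma logDerivGeom_nonneg (n : ℕ) {s : ℝ} (hs : 0 ≤ s) : 0 ≤ logDerivGeom n s := by
  have := one_le_geomSum n hs
  have := geomSumDeriv_nonneg n hs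
  unfold logDerivGeom
  positivity

lemma logDerivGeom_le_one (n : ℕ) {s : ℝ} (hs : 0 ≤ s) : logDerivGeom n s ≤ 1 := by
  have h1 := one_le_geomSum n hs
  unfold logDerivGeom
  refine div_le_one_of_le₀ ?_ (by positivity)
  unfold geomSumDeriv geomSum
  rw [Finset.sum_range_succ', Finset.sum_range_succ]
  simp only [Nat.add_sub_cancel, Nat.cast_zero, zero_mul, add_zero]
  rw [mul_add, Finset.mul_sum]
  have : 0 ≤ (n : ℝ) * s ^ n := by positivity
  refine le_add_of_le_of_nonneg (Finset.sum_le_sum fun ν hν => ?_) this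
  refine mul_le_mul_of_nonneg_right ?_ (by positivity)
  have := Finset.mem_range.1 hν
  exact_mod_cast this

lemma meanDegree_le_one (n : ℕ) {s : ℝ} (hs : 0 ≤ s) : meanDegree n s ≤ 1 := by
  have h1 := one_le_geomSum n hs
  unfold meanDegree
  refine div_le_one_of_le₀ ?_ (by positivity)
  rw [mul_geomSumDeriv]
  unfold geomSum
  rw [Finset.mul_sum]
  refine Finset.sum_le_sum fun ν hν => mul_le_mul_of_nonneg_right ?_ (by positivity)
  have := Finset.mem_range.1 hν
  exact_mod_cast Nat.lt_succ_iff.1 this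

lemma hasDerivAt_meanDegree (n : ℕ) {s : ℝ} (hs : 0 ≤ s) :
    HasDerivAt (meanDegree n) (meanDegreeDeriv n s) s := by
  have h1 := one_le_geomSum n hs
  rcases Nat.eq_zero_or_pos n with rfl | hn
  · have e : meanDegree 0 = fun _ => 0 := by ext s; simp [meanDegree]
    rw [e]
    exact (hasDerivAt_const s (0 : ℝ)).congr_deriv (by simp [meanDegreeDeriv])
  have hn' : (0 : ℝ) < n := by exact_mod_cast hn
  have hd : (n : ℝ) * geomSum n s ≠ 0 := by positivity
  have := ((hasDerivAt_id s).mul (hasDerivAt_geomSumDeriv n s)).div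
    ((hasDerivAt_geomSum n s).const_mul (n : ℝ)) hd
  refine this.congr_deriv ?_
  unfold meanDegreeDeriv
  have : geomSum n s ≠ 0 := by positivity
  simp only [Pi.mul_apply, id]
  field_simp

/-- The mean degree increases because its derivative is a variance. -/
lemma meanDegreeDeriv_nonneg (n : ℕ) {s : ℝ} (hs : 0 ≤ s) : 0 ≤ meanDegreeDeriv n s := by
  have h1 := one_le_geomSum n hs
  unfold meanDegreeDeriv
  refine div_nonneg ?_ (by positivity)
  rcases eq_or_lt_of_le hs with rfl | hs0
  · have := geomSumDeriv_nonneg n (le_refl (0 : ℝ))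
    simp only [zero_mul, add_zero, sub_zero]
    positivity
  have hCS := Finset.sum_mul_sq_le_sq_mul_sq (Finset.range (n + 1))
    (fun ν => (ν : ℝ) * Real.sqrt (s ^ ν)) (fun ν => Real.sqrt (s ^ ν))
  have e1 : ∑ ν ∈ Finset.range (n + 1), (ν : ℝ) * Real.sqrt (s ^ ν) * Real.sqrt (s ^ ν) =
      s * geomSumDeriv n s := by
    rw [mul_geomSumDeriv]
    refine Finset.sum_congr rfl fun ν _ => ?_
    rw [mul_assoc, Real.mul_self_sqrt (by positivity)]
  have e2 : ∑ ν ∈ Finset.range (n + 1), ((ν : ℝ) * Real.sqrt (s ^ ν)) ^ 2 =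
      s * (geomSumDeriv n s + s * geomSumDeriv2 n s) := by
    rw [geomSumDeriv_add_mul, Finset.mul_sum]
    refine Finset.sum_congr rfl fun ν _ => ?_
    rw [mul_pow, Real.sq_sqrt (by positivity)]
    rcases ν with _ | ν
    · simp
    · rw [Nat.add_sub_cancel, pow_succ]; ring
  have e3 : ∑ ν ∈ Finset.range (n + 1), Real.sqrt (s ^ ν) ^ 2 = geomSum n s :=
    Finset.sum_congr rfl fun ν _ => Real.sq_sqrt (by positivity)
  rw [e1, e2, e3] at hCS
  have : 0 ≤ s * ((geomSumDeriv n s + s * geomSumDeriv2 n s) * geomSum n s -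
      s * geomSumDeriv n s ^ 2) := by linarith
  exact nonneg_of_mul_nonneg_right this hs0

lemma continuous_geomSum (n : ℕ) : Continuous (geomSum n : ℝ → ℝ) :=
  continuous_iff_continuousAt.2 fun s => (hasDerivAt_geomSum n s).continuousAt

lemma continuous_geomSumDeriv (n : ℕ) : Continuous (geomSumDeriv n : ℝ → ℝ) :=
  continuous_iff_continuousAt.2 fun s => (hasDerivAt_geomSumDeriv n s).continuousAt

lemma continuous_geomSumDeriv2 (n : ℕ) : Continuous (geomSumDeriv2 n : ℝ → ℝ) :=
  continuous_finsetSum _ fun i _ => by fun_prop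

lemma continuousOn_logDerivGeom (n : ℕ) : ContinuousOn (logDerivGeom n) (Set.Ici 0) := by
  rcases Nat.eq_zero_or_pos n with rfl | hn
  · have e : logDerivGeom 0 = fun _ => 0 := by ext s; simp [logDerivGeom]
    rw [e]; exact continuousOn_const
  have hn' : (0 : ℝ) < n := by exact_mod_cast hn
  refine (continuous_geomSumDeriv n).continuousOn.div
    (continuous_const.mul (continuous_geomSum n)).continuousOn fun s hs => ?_
  have := one_le_geomSum n (Set.mem_Ici.1 hs)
  positivity

lemma continuousOn_meanDegreeDeriv (n : ℕ) : ContinuousOn (meanDegreeDeriv n) (Set.Ici 0) := by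
  rcases Nat.eq_zero_or_pos n with rfl | hn
  · have e : meanDegreeDeriv 0 = fun _ => 0 := by ext s; simp [meanDegreeDeriv]
    rw [e]; exact continuousOn_const
  have hn' : (0 : ℝ) < n := by exact_mod_cast hn
  have c0 := continuous_geomSum n
  have c1 := continuous_geomSumDeriv n
  have c2 := continuous_geomSumDeriv2 n
  refine ContinuousOn.div (by fun_prop) (by fun_prop) fun s hs => ?_
  have := one_le_geomSum n (Set.mem_Ici.1 hs)
  positivity

lemma summable_sq_mul_pow_pred {s : ℝ} (hs : 0 ≤ s) (hs1 : s < 1) :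
    Summable fun ν : ℕ => (ν : ℝ) ^ 2 * s ^ (ν - 1) := by
  rw [← summable_nat_add_iff 1]
  have hn : ‖s‖ < 1 := by rwa [Real.norm_eq_abs, abs_of_nonneg hs]
  have h2 := summable_pow_mul_geometric_of_norm_lt_one 2 hn
  have h1 := summable_pow_mul_geometric_of_norm_lt_one 1 hn
  have h0 := summable_geometric_of_norm_lt_one hn
  refine ((h2.add (h1.mul_left 2)).add h0).congr fun ν => ?_
  simp only [Nat.add_sub_cancel]
  push_cast
  ring

lemma exists_geomSumDeriv_bound {ρ : ℝ} (hρ : 0 ≤ ρ) (hρ1 : ρ < 1) :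
    ∃ C : ℝ, ∀ (n : ℕ) (s : ℝ), 0 ≤ s → s ≤ ρ →
      geomSumDeriv n s + s * geomSumDeriv2 n s ≤ C ∧ geomSumDeriv n s ≤ C := by
  refine ⟨∑' ν : ℕ, (ν : ℝ) ^ 2 * ρ ^ (ν - 1), fun n s hs hsρ => ?_⟩
  have h := summable_sq_mul_pow_pred hρ hρ1
  have h1 : geomSumDeriv n s + s * geomSumDeriv2 n s ≤ ∑' ν : ℕ, (ν : ℝ) ^ 2 * ρ ^ (ν - 1) := by
    rw [geomSumDeriv_add_mul]
    refine le_trans (Finset.sum_le_sum fun ν _ => ?_)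
      (h.sum_le_tsum (Finset.range (n + 1)) fun i _ => by positivity)
    exact mul_le_mul_of_nonneg_left (pow_le_pow_left₀ hs hsρ _) (by positivity)
  refine ⟨h1, le_trans ?_ h1⟩
  have : 0 ≤ geomSumDeriv2 n s := Finset.sum_nonneg fun i _ => by positivity
  have : 0 ≤ s * geomSumDeriv2 n s := by positivity
  linarith

/-- The derivative of the mean degree is `O(1/n)` on `[0, 1/2]`. -/
lemma exists_meanDegreeDeriv_bound :
    ∃ C : ℝ, 0 ≤ C ∧ ∀ (n : ℕ) (s : ℝ), 0 ≤ s → s ≤ 1 / 2 → meanDegreeDeriv n s ≤ C / n := by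
  obtain ⟨C, hC⟩ := exists_geomSumDeriv_bound (ρ := 1 / 2) (by norm_num) (by norm_num)
  have hC0 : 0 ≤ C := (geomSumDeriv_nonneg 0 le_rfl).trans (hC 0 0 le_rfl (by norm_num)).2
  refine ⟨C, hC0, fun n s hs hs1 => ?_⟩
  rcases Nat.eq_zero_or_pos n with rfl | hn
  · simp [meanDegreeDeriv]
  have hn' : (0 : ℝ) < n := by exact_mod_cast hn
  have h1 := one_le_geomSum n hs
  have h2 := (hC n s hs hs1).1
  unfold meanDegreeDeriv
  rw [div_le_div_iff₀ (by positivity) hn']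
  have h3 : 0 ≤ s * geomSumDeriv n s ^ 2 := by positivity
  have h4 : (geomSumDeriv n s + s * geomSumDeriv2 n s) * geomSum n s ≤ C * geomSum n s ^ 2 := by
    rw [sq, ← mul_assoc]
    have : C ≤ C * geomSum n s := le_mul_of_one_le_right hC0 h1
    exact mul_le_mul_of_nonneg_right (h2.trans this) (by linarith)
  have h5 := mul_le_mul_of_nonneg_right (show (geomSumDeriv n s + s * geomSumDeriv2 n s) *
    geomSum n s - s * geomSumDeriv n s ^ 2 ≤ C * geomSum n s ^ 2 by linarith) hn'.le
  linarith

lemma tendsto_logDerivGeom_of_lt_one {s : ℝ} (hs : 0 ≤ s) (hs1 : s < 1) :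
    Tendsto (fun n => logDerivGeom n s) atTop (𝓝 0) := by
  obtain ⟨C, hC⟩ := exists_geomSumDeriv_bound hs hs1
  have hlim : Tendsto (fun n : ℕ => C / n) atTop (𝓝 0) := tendsto_const_div_atTop_nhds_zero_nat C
  refine squeeze_zero' (Eventually.of_forall fun n => logDerivGeom_nonneg n hs) ?_ hlim
  filter_upwards [eventually_gt_atTop 0] with n hn
  have hn' : (0 : ℝ) < n := by exact_mod_cast hn
  have h1 := one_le_geomSum n hs
  have h2 := (hC n s hs le_rfl).2
  unfold logDerivGeom
  refine div_le_div₀ ((geomSumDeriv_nonneg n hs).trans h2) h2 hn' ?_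
  nlinarith

lemma logDerivGeom_one {n : ℕ} (hn : 0 < n) : logDerivGeom n 1 = 1 / 2 := by
  have hn' : (0 : ℝ) < n := by exact_mod_cast hn
  unfold logDerivGeom geomSumDeriv geomSum
  simp only [one_pow, mul_one, Finset.sum_const, Finset.card_range, nsmul_eq_mul]
  have := Finset.sum_range_id_mul_two (n + 1)
  have h2 : (∑ ν ∈ Finset.range (n + 1), (ν : ℝ)) * 2 = (n + 1) * n := by
    have := congrArg (Nat.cast (R := ℝ)) this
    push_cast at this
    simpa using this
  rw [div_eq_div_iff (by positivity) two_ne_zero, h2]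
  push_cast; ring

/-- For `s > 1` the degree `n - m` has weight `s⁻ᵐ` relative to the top degree, so the mean of `m`
is bounded. -/
lemma tendsto_meanDegree_of_one_lt {s : ℝ} (hs : 1 < s) :
    Tendsto (fun n => meanDegree n s) atTop (𝓝 1) := by
  have hs0 : 0 < s := by linarith
  have ht : ‖s⁻¹‖ < 1 := by
    rw [norm_inv, Real.norm_eq_abs, abs_of_pos hs0]
    exact inv_lt_one_of_one_lt₀ hs
  have hsum := summable_pow_mul_geometric_of_norm_lt_one 1 ht
  simp only [pow_one] at hsum
  set C := ∑' m : ℕ, (m : ℝ) * s⁻¹ ^ m with hC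
  have hlim : Tendsto (fun n : ℕ => C / n) atTop (𝓝 0) := tendsto_const_div_atTop_nhds_zero_nat C
  have key : Tendsto (fun n => 1 - meanDegree n s) atTop (𝓝 0) := by
    refine squeeze_zero' (Eventually.of_forall fun n =>
      sub_nonneg.2 (meanDegree_le_one n hs0.le)) ?_ hlim
    filter_upwards [eventually_gt_atTop 0] with n hn
    have hn' : (0 : ℝ) < n := by exact_mod_cast hn
    have h1 := one_le_geomSum n hs0.le
    have h2 : (n : ℝ) * geomSum n s - s * geomSumDeriv n s ≤ s ^ n * C := by
      rw [mul_geomSumDeriv]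
      unfold geomSum
      rw [Finset.mul_sum, ← Finset.sum_sub_distrib, ← Finset.sum_range_reflect]
      calc _ = ∑ m ∈ Finset.range (n + 1), s ^ n * ((m : ℝ) * s⁻¹ ^ m) := by
            refine Finset.sum_congr rfl fun m hm => ?_
            have hmn : m ≤ n := Nat.lt_succ_iff.1 (Finset.mem_range.1 hm)
            have e : n + 1 - 1 - m = n - m := by omega
            rw [e, Nat.cast_sub hmn, inv_pow, pow_sub₀ s hs0.ne' hmn]
            ring
        _ ≤ s ^ n * C := by
            rw [← Finset.mul_sum]
            exact mul_le_mul_of_nonneg_left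
              (hsum.sum_le_tsum _ fun i _ => by positivity) (by positivity)
    have h3 := pow_le_geomSum n hs0.le
    have hC0 : 0 ≤ C := tsum_nonneg fun m => by positivity
    unfold meanDegree
    rw [show 1 - s * geomSumDeriv n s / (n * geomSum n s) =
      ((n : ℝ) * geomSum n s - s * geomSumDeriv n s) / (n * geomSum n s) by field_simp,
      div_le_div_iff₀ (by positivity) hn']
    have := mul_le_mul_of_nonneg_right h3 hC0
    have := mul_le_mul_of_nonneg_right (h2.trans this) hn'.le
    linarith
  have := key.const_sub 1
  simpa using this

lemma tendsto_logDerivGeom_of_one_lt {s : ℝ} (hs : 1 < s) :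
    Tendsto (fun n => logDerivGeom n s) atTop (𝓝 (1 / s)) := by
  have hs0 : s ≠ 0 := by linarith
  refine ((tendsto_meanDegree_of_one_lt hs).div_const s).congr fun n => ?_
  rw [meanDegree_eq]; field_simp

lemma isStepApprox_meanDegree : IsStepApprox meanDegree meanDegreeDeriv where
  hasDerivAt n s hs := hasDerivAt_meanDegree n hs
  continuousOn := continuousOn_meanDegreeDeriv
  deriv_nonneg n s hs := meanDegreeDeriv_nonneg n hs
  nonneg n s hs := by rw [meanDegree_eq]; exact mul_nonneg hs (logDerivGeom_nonneg n hs)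
  le_one n s hs := meanDegree_le_one n hs
  tendsto_zero s hs hs1 := by
    simp_rw [meanDegree_eq]
    simpa using (tendsto_logDerivGeom_of_lt_one hs hs1).const_mul s
  tendsto_one s hs := tendsto_meanDegree_of_one_lt hs

/-! ### The covariance kernel of the random function -/

section Kernel

variable {ℓ : ℕ}

/-- `|f|²`. -/
noncomputable def sqF (f : Fin ℓ → ℂ → ℂ) (z : ℂ) : ℝ := ∑ j, ‖f j z‖ ^ 2

/-- `⟨f', f⟩ = ∂|f|²/∂z`. -/
noncomputable def crossF (f : Fin ℓ → ℂ → ℂ) (z : ℂ) : ℂ := ∑ j, deriv (f j) z * conj (f j z)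

/-- `|f'|²`. -/
noncomputable def sqDerivF (f : Fin ℓ → ℂ → ℂ) (z : ℂ) : ℝ := ∑ j, ‖deriv (f j) z‖ ^ 2

/-- The monomial `f_{j_1} ⋯ f_{j_ν}`. -/
noncomputable def monomialF (f : Fin ℓ → ℂ → ℂ) (n : ℕ) (i : MultiIndex ℓ n)
    (z : ℂ) : ℂ := ∏ k, f (i.2 k) z

lemma sqF_nonneg (f : Fin ℓ → ℂ → ℂ) (z : ℂ) : 0 ≤ sqF f z :=
  Finset.sum_nonneg fun _ _ => by positivity

lemma sqDerivF_nonneg (f : Fin ℓ → ℂ → ℂ) (z : ℂ) : 0 ≤ sqDerivF f z :=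
  Finset.sum_nonneg fun _ _ => by positivity

lemma ofReal_sqF (f : Fin ℓ → ℂ → ℂ) (z : ℂ) : (sqF f z : ℂ) = ∑ j, f j z * conj (f j z) := by
  unfold sqF
  rw [Complex.ofReal_sum]
  exact Finset.sum_congr rfl fun i _ => by rw [Complex.mul_conj, Complex.normSq_eq_norm_sq]

lemma ofReal_sqDerivF (f : Fin ℓ → ℂ → ℂ) (z : ℂ) :
    (sqDerivF f z : ℂ) = ∑ j, deriv (f j) z * conj (deriv (f j) z) := by
  unfold sqDerivF
  rw [Complex.ofReal_sum]
  exact Finset.sum_congr rfl fun i _ => by rw [Complex.mul_conj, Complex.normSq_eq_norm_sq]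

lemma conj_crossF (f : Fin ℓ → ℂ → ℂ) (z : ℂ) :
    conj (crossF f z) = ∑ j, f j z * conj (deriv (f j) z) := by
  unfold crossF
  rw [map_sum]
  exact Finset.sum_congr rfl fun i _ => by rw [map_mul, Complex.conj_conj, mul_comm]

lemma normSq_crossF_le (f : Fin ℓ → ℂ → ℂ) (z : ℂ) :
    ‖crossF f z‖ ^ 2 ≤ sqF f z * sqDerivF f z := by
  have h1 : ‖crossF f z‖ ≤ ∑ j, ‖deriv (f j) z‖ * ‖f j z‖ := by
    refine (norm_sum_le _ _).trans (Finset.sum_le_sum fun j _ => ?_)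
    rw [norm_mul, RCLike.norm_conj]
  calc ‖crossF f z‖ ^ 2 ≤ (∑ j, ‖deriv (f j) z‖ * ‖f j z‖) ^ 2 :=
        pow_le_pow_left₀ (norm_nonneg _) h1 2
    _ ≤ (∑ j, ‖deriv (f j) z‖ ^ 2) * ∑ j, ‖f j z‖ ^ 2 := Finset.sum_mul_sq_le_sq_mul_sq _ _ _
    _ = sqF f z * sqDerivF f z := mul_comm _ _

lemma differentiable_monomialF {f : Fin ℓ → ℂ → ℂ} (hf : ∀ j, Differentiable ℂ (f j)) (n : ℕ)
    (i : MultiIndex ℓ n) : Differentiable ℂ (monomialF f n i) := by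
  unfold monomialF
  exact Differentiable.fun_finsetProd fun k _ => hf _

/-- The multinomial identity behind the covariance kernel. -/
lemma sum_prod_mul_prod (n : ℕ) (c d : Fin ℓ → ℂ) :
    ∑ i : MultiIndex ℓ n, (∏ k, c (i.2 k)) * ∏ k, d (i.2 k) = geomSum n (∑ j, c j * d j) := by
  unfold geomSum
  rw [Fintype.sum_sigma, Finset.sum_range]
  refine Finset.sum_congr rfl fun ν _ => ?_
  rw [Fintype.sum_pow]
  exact Finset.sum_congr rfl fun p _ => by rw [Finset.prod_mul_distrib]

lemma sum_monomialF_mul_conj (f : Fin ℓ → ℂ → ℂ) (n : ℕ) (z w : ℂ) :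
    ∑ i, monomialF f n i z * conj (monomialF f n i w) =
      geomSum n (∑ j, f j z * conj (f j w)) := by
  rw [← sum_prod_mul_prod]
  refine Finset.sum_congr rfl fun i _ => ?_
  unfold monomialF
  rw [map_prod]

lemma sum_normSq_monomialF (f : Fin ℓ → ℂ → ℂ) (n : ℕ) (z : ℂ) :
    ∑ i, ‖monomialF f n i z‖ ^ 2 = geomSum n (sqF f z) := by
  have h := sum_monomialF_mul_conj f n z z
  rw [← ofReal_sqF] at h
  have e : ∑ i, monomialF f n i z * conj (monomialF f n i z) =
      ((∑ i, ‖monomialF f n i z‖ ^ 2 : ℝ) : ℂ) := by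
    rw [Complex.ofReal_sum]
    exact Finset.sum_congr rfl fun i _ => by rw [Complex.mul_conj, Complex.normSq_eq_norm_sq]
  rw [e] at h
  have h2 : geomSum n (sqF f z : ℂ) = ((geomSum n (sqF f z) : ℝ) : ℂ) := by
    unfold geomSum; push_cast; rfl
  rw [h2] at h
  exact_mod_cast h

lemma sum_deriv_monomialF_mul_conj {f : Fin ℓ → ℂ → ℂ} (hf : ∀ j, Differentiable ℂ (f j)) (n : ℕ)
    (z w : ℂ) :
    ∑ i, deriv (monomialF f n i) z * conj (monomialF f n i w) =
      geomSumDeriv n (∑ j, f j z * conj (f j w)) * ∑ j, deriv (f j) z * conj (f j w) := by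
  have h1 : HasDerivAt (fun z => ∑ i, monomialF f n i z * conj (monomialF f n i w))
      (∑ i, deriv (monomialF f n i) z * conj (monomialF f n i w)) z :=
    HasDerivAt.fun_sum fun i _ =>
      ((differentiable_monomialF hf n i) z).hasDerivAt.mul_const _
  have h2 : HasDerivAt (fun z => ∑ j, f j z * conj (f j w)) (∑ j, deriv (f j) z * conj (f j w)) z :=
    HasDerivAt.fun_sum fun j _ => (hf j z).hasDerivAt.mul_const _
  have h3 := (hasDerivAt_geomSum n (∑ j, f j z * conj (f j w))).comp z h2
  refine h1.unique (h3.congr_of_eventuallyEq (Eventually.of_forall fun z => ?_))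
  exact sum_monomialF_mul_conj f n z w

lemma sum_deriv_monomialF_mul_conj_self {f : Fin ℓ → ℂ → ℂ} (hf : ∀ j, Differentiable ℂ (f j))
    (n : ℕ) (z : ℂ) :
    ‖∑ i, deriv (monomialF f n i) z * conj (monomialF f n i z)‖ ^ 2 =
      geomSumDeriv n (sqF f z) ^ 2 * ‖crossF f z‖ ^ 2 := by
  rw [sum_deriv_monomialF_mul_conj hf, ← ofReal_sqF, norm_mul, mul_pow]
  have : geomSumDeriv n (sqF f z : ℂ) = ((geomSumDeriv n (sqF f z) : ℝ) : ℂ) := by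
    unfold geomSumDeriv; push_cast; rfl
  rw [this, Complex.norm_real, Real.norm_eq_abs, sq_abs]
  rfl

/-- Polarization: differentiate the kernel in `z`, conjugate, and differentiate in the second
variable, in which it is then holomorphic. -/
lemma sum_normSq_deriv_monomialF {f : Fin ℓ → ℂ → ℂ} (hf : ∀ j, Differentiable ℂ (f j)) (n : ℕ)
    (z : ℂ) :
    ∑ i, ‖deriv (monomialF f n i) z‖ ^ 2 =
      geomSumDeriv2 n (sqF f z) * ‖crossF f z‖ ^ 2 + geomSumDeriv n (sqF f z) * sqDerivF f z := by
  have hconj : ∀ w, ∑ i, monomialF f n i w * conj (deriv (monomialF f n i) z) =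
      geomSumDeriv n (∑ j, f j w * conj (f j z)) * ∑ j, f j w * conj (deriv (f j) z) := by
    intro w
    have h := congrArg conj (sum_deriv_monomialF_mul_conj hf n z w)
    simp only [map_sum, map_mul, Complex.conj_conj, geomSumDeriv, map_pow, map_natCast] at h
    unfold geomSumDeriv
    simp only [mul_comm (f _ w), mul_comm (monomialF f n _ w)]
    exact h
  have h1 : HasDerivAt (fun w => ∑ i, monomialF f n i w * conj (deriv (monomialF f n i) z))
      (∑ i, deriv (monomialF f n i) z * conj (deriv (monomialF f n i) z)) z :=
    HasDerivAt.fun_sum fun i _ =>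
      ((differentiable_monomialF hf n i) z).hasDerivAt.mul_const _
  have h2 : HasDerivAt (fun w => ∑ j, f j w * conj (f j z)) (∑ j, deriv (f j) z * conj (f j z)) z :=
    HasDerivAt.fun_sum fun j _ => (hf j z).hasDerivAt.mul_const _
  have h3 : HasDerivAt (fun w => ∑ j, f j w * conj (deriv (f j) z))
      (∑ j, deriv (f j) z * conj (deriv (f j) z)) z :=
    HasDerivAt.fun_sum fun j _ => (hf j z).hasDerivAt.mul_const _
  have h4 := ((hasDerivAt_geomSumDeriv n (∑ j, f j z * conj (f j z))).comp z h2).mul h3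
  have h5 := h1.unique (h4.congr_of_eventuallyEq (Eventually.of_forall fun w => hconj w))
  simp only [Function.comp_apply] at h5
  rw [← ofReal_sqF, ← ofReal_sqDerivF, ← conj_crossF] at h5
  have e : ∑ i, deriv (monomialF f n i) z * conj (deriv (monomialF f n i) z) =
      ((∑ i, ‖deriv (monomialF f n i) z‖ ^ 2 : ℝ) : ℂ) := by
    rw [Complex.ofReal_sum]
    exact Finset.sum_congr rfl fun i _ => by rw [Complex.mul_conj, Complex.normSq_eq_norm_sq]
  have e1 : geomSumDeriv n (sqF f z : ℂ) = ((geomSumDeriv n (sqF f z) : ℝ) : ℂ) := by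
    unfold geomSumDeriv; push_cast; rfl
  have e2 : geomSumDeriv2 n (sqF f z : ℂ) = ((geomSumDeriv2 n (sqF f z) : ℝ) : ℂ) := by
    unfold geomSumDeriv2; push_cast; rfl
  have e3 : (∑ j, deriv (f j) z * conj (f j z)) * conj (crossF f z) =
      ((‖crossF f z‖ ^ 2 : ℝ) : ℂ) := by
    rw [← Complex.normSq_eq_norm_sq, ← Complex.mul_conj]
    rfl
  rw [e, e1, e2, mul_assoc, e3] at h5
  exact_mod_cast h5

/-- The density of the expected number of zeros of `G_n`, divided by `n`. -/
noncomputable def expectedDensity (f : Fin ℓ → ℂ → ℂ) (n : ℕ) (z : ℂ) : ℝ :=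
  1 / (n : ℝ) * (1 / Real.pi *
    ((∑ i, ‖deriv (monomialF f n i) z‖ ^ 2) / (∑ i, ‖monomialF f n i z‖ ^ 2) -
      ‖∑ i, deriv (monomialF f n i) z * conj (monomialF f n i z)‖ ^ 2 /
        (∑ i, ‖monomialF f n i z‖ ^ 2) ^ 2))

/-- The expected density splits into a part that concentrates on `|f| = 1` and a part that converges
pointwise. At a common zero of the `f j` both quotients by `sqF f z` are `0 / 0 = 0`. -/
lemma expectedDensity_eq {f : Fin ℓ → ℂ → ℂ} (hf : ∀ j, Differentiable ℂ (f j)) {n : ℕ}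
    (hn : 0 < n) (z : ℂ) :
    expectedDensity f n z =
    1 / Real.pi * (meanDegreeDeriv n (sqF f z) * (‖crossF f z‖ ^ 2 / sqF f z) +
      logDerivGeom n (sqF f z) * (sqDerivF f z - ‖crossF f z‖ ^ 2 / sqF f z)) := by
  unfold expectedDensity
  rw [sum_normSq_monomialF, sum_deriv_monomialF_mul_conj_self hf, sum_normSq_deriv_monomialF hf]
  have h1 := one_le_geomSum n (sqF_nonneg f z)
  have hn' : (0 : ℝ) < n := by exact_mod_cast hn
  have hk : (0 : ℝ) < geomSum n (sqF f z) := by linarith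
  unfold meanDegreeDeriv logDerivGeom
  rcases eq_or_lt_of_le (sqF_nonneg f z) with h0 | h0
  · have hc : ‖crossF f z‖ ^ 2 = 0 := by
      have := normSq_crossF_le f z
      rw [← h0, zero_mul] at this
      exact le_antisymm this (by positivity)
    rw [hc]
    field_simp
    ring
  · field_simp
    ring

end Kernel

/-! ### The function `|f|²` and the form `ω` -/

section Geometry

variable {ℓ : ℕ} {f : Fin ℓ → ℂ → ℂ}

lemma absF_eq (f : Fin ℓ → ℂ → ℂ) (z : ℂ) : absF f z = Real.sqrt (sqF f z) := rfl

lemma absF_eq_one_iff (f : Fin ℓ → ℂ → ℂ) (z : ℂ) : absF f z = 1 ↔ sqF f z = 1 := by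
  rw [absF_eq, Real.sqrt_eq_one]

lemma one_lt_absF_iff (f : Fin ℓ → ℂ → ℂ) (z : ℂ) : 1 < absF f z ↔ 1 < sqF f z := by
  rw [absF_eq, Real.lt_sqrt zero_le_one, one_pow]

lemma analyticOnNhd_sqF (hf : ∀ j, Differentiable ℂ (f j)) : AnalyticOnNhd ℝ (sqF f) Set.univ := by
  intro z _
  have h : ∀ j, AnalyticAt ℝ (f j) z := fun j => ((hf j).analyticAt z).restrictScalars
  have e : sqF f = fun z => ∑ j, ((Complex.reCLM (f j z)) ^ 2 + (Complex.imCLM (f j z)) ^ 2) := by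
    ext w
    unfold sqF
    refine Finset.sum_congr rfl fun j _ => ?_
    rw [← Complex.normSq_eq_norm_sq, Complex.normSq_apply]
    simp [sq]
  rw [e]
  refine Finset.analyticAt_fun_sum _ fun j _ => ?_
  exact (((Complex.reCLM.analyticAt _).comp (h j)).pow 2).add
    (((Complex.imCLM.analyticAt _).comp (h j)).pow 2)

lemma contDiff_sqF (hf : ∀ j, Differentiable ℂ (f j)) {n : WithTop ℕ∞} : ContDiff ℝ n (sqF f) :=
  (analyticOnNhd_sqF hf).contDiff

lemma continuous_sqF (hf : ∀ j, Differentiable ℂ (f j)) : Continuous (sqF f) :=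
  (contDiff_sqF hf (n := 1)).continuous

lemma continuous_deriv_entire {g : ℂ → ℂ} (hg : Differentiable ℂ g) : Continuous (deriv g) :=
  (hg.contDiff (n := 1)).continuous_deriv le_rfl

lemma continuous_crossF (hf : ∀ j, Differentiable ℂ (f j)) : Continuous (crossF f) :=
  continuous_finsetSum _ fun j _ => (continuous_deriv_entire (hf j)).mul
    (Complex.continuous_conj.comp (hf j).continuous)

lemma continuous_sqDerivF (hf : ∀ j, Differentiable ℂ (f j)) : Continuous (sqDerivF f) :=
  continuous_finsetSum _ fun j _ => (continuous_deriv_entire (hf j)).norm.pow 2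

lemma fderiv_sqF (hf : ∀ j, Differentiable ℂ (f j)) (z d : ℂ) :
    fderiv ℝ (sqF f) z d = 2 * (crossF f z * d).re := by
  have h : HasFDerivAt (sqF f) (∑ j, 2 • (innerSL ℝ (f j z)).comp
      ((ContinuousLinearMap.toSpanSingleton ℂ (deriv (f j) z)).restrictScalars ℝ)) z :=
    HasFDerivAt.fun_sum fun j _ =>
      ((((hf j) z).hasDerivAt.hasFDerivAt).restrictScalars ℝ).norm_sq
  rw [h.fderiv, sum_apply]
  unfold crossF
  rw [Finset.sum_mul, Complex.re_sum, Finset.mul_sum]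
  refine Finset.sum_congr rfl fun j _ => ?_
  simp only [smul_apply, ContinuousLinearMap.comp_apply, innerSL_apply_apply,
    ContinuousLinearMap.coe_restrictScalars', ContinuousLinearMap.toSpanSingleton_apply,
    Complex.inner, smul_eq_mul, nsmul_eq_mul]
  push_cast
  congr 2
  ring

lemma gradNorm_sqF (hf : ∀ j, Differentiable ℂ (f j)) (z : ℂ) :
    gradNorm (sqF f) z = 2 * ‖crossF f z‖ := by
  unfold gradNorm
  rw [fderiv_sqF hf, fderiv_sqF hf, mul_one,
    show (crossF f z * Complex.I).re = -(crossF f z).im by simp, Complex.norm_eq_sqrt_sq_add_sq,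
    show (2 * (crossF f z).re) ^ 2 + (2 * -(crossF f z).im) ^ 2 =
      2 ^ 2 * ((crossF f z).re ^ 2 + (crossF f z).im ^ 2) by ring,
    Real.sqrt_mul (by positivity), Real.sqrt_sq (by norm_num)]

/-- `ω(τ) = Im(⟨f', f⟩ τ) / 2π`. -/
lemma argForm_apply (hf : ∀ j, Differentiable ℂ (f j)) (z τ : ℂ) :
    argForm f z τ = (((crossF f z * τ).im / (2 * Real.pi) : ℝ) : ℂ) := by
  have h : ∀ j, HasFDerivAt (f j)
      ((ContinuousLinearMap.toSpanSingleton ℂ (deriv (f j) z)).restrictScalars ℝ) z := fun j =>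
    (((hf j) z).hasDerivAt.hasFDerivAt).restrictScalars ℝ
  have hc : ∀ j, HasFDerivAt (fun w => conj (f j w)) (Complex.conjCLE.toContinuousLinearMap.comp
      ((ContinuousLinearMap.toSpanSingleton ℂ (deriv (f j) z)).restrictScalars ℝ)) z := fun j =>
    Complex.conjCLE.toContinuousLinearMap.hasFDerivAt.comp z (h j)
  have e : ∑ j, (f j z * conj (τ * deriv (f j) z) - conj (f j z) * (τ * deriv (f j) z)) =
      conj (crossF f z * τ) - crossF f z * τ := by
    rw [Finset.sum_sub_distrib, map_mul, conj_crossF]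
    unfold crossF
    rw [Finset.sum_mul, Finset.sum_mul]
    congr 1 <;> refine Finset.sum_congr rfl fun j _ => ?_
    · rw [map_mul]; ring
    · ring
  unfold argForm
  rw [smul_apply, sum_apply]
  simp only [sub_apply, smul_apply, (h _).fderiv,
    (hc _).fderiv, ContinuousLinearMap.comp_apply, ContinuousLinearMap.coe_restrictScalars',
    ContinuousLinearMap.toSpanSingleton_apply, smul_eq_mul, ContinuousLinearEquiv.coe_coe,
    Complex.conjCLE_apply]
  rw [e]
  have h2 : conj (crossF f z * τ) - crossF f z * τ = -(2 * (crossF f z * τ).im * Complex.I) := by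
    rw [← neg_sub, Complex.sub_conj]
    push_cast; ring
  rw [h2]
  push_cast
  have hpi : (Real.pi : ℂ) ≠ 0 := by exact_mod_cast Real.pi_ne_zero
  field_simp
  rw [Complex.I_sq]; ring

end Geometry

/-! ### The measure defined by `ω` on the curve `C` -/

section CurveMeasure

variable {ℓ : ℕ} {f : Fin ℓ → ℂ → ℂ}

lemma smul_mem_tangentConeAt {s : Set ℂ} {x y : ℂ} (c : ℝ) (h : y ∈ tangentConeAt ℝ s x) :
    c • y ∈ tangentConeAt ℝ s x := by
  rw [mem_tangentConeAt_iff_exists_seq] at h ⊢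
  obtain ⟨a, d, hd, hs, hlim⟩ := h
  refine ⟨fun n => c * a n, d, hd, hs, ?_⟩
  simp_rw [mul_smul]
  exact hlim.const_smul c

lemma hasDerivAt_line (z e : ℂ) : HasDerivAt (fun t : ℝ => z + t • e) e 0 := by
  have h : HasDerivAt (fun t : ℝ => t • e) ((1 : ℝ) • e) 0 := (hasDerivAt_id (0 : ℝ)).smul_const e
  rw [one_smul] at h
  exact h.const_add z

/-- A regular point of a level set of a real function on the plane is not isolated in it: on every
small circle about it the function takes values on either side of the level. -/
lemma accPt_levelSet {v : ℂ → ℝ} (hv : ContDiff ℝ 1 v) {z e : ℂ} (he : fderiv ℝ v z e ≠ 0) :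
    AccPt z (𝓟 {w | v w = v z}) := by
  wlog hpos : 0 < fderiv ℝ v z e generalizing e with H
  · refine H (e := -e) (by simpa using he) ?_
    rw [map_neg]
    exact neg_pos.2 (lt_of_le_of_ne (not_lt.1 hpos) he)
  have he0 : e ≠ 0 := by rintro rfl; simp at he
  have hne : 0 < ‖e‖ := norm_pos_iff.2 he0
  rw [accPt_iff_nhds]
  intro U hU
  obtain ⟨ε, hε, hball⟩ := Metric.mem_nhds_iff.1 hU
  have hd : HasDerivAt (fun t : ℝ => v (z + t • e)) (fderiv ℝ v z e) 0 := by
    have h1 : HasFDerivAt v (fderiv ℝ v z) (z + (0 : ℝ) • e) := by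
      rw [zero_smul, add_zero]
      exact ((hv.differentiable (by norm_num)) z).hasFDerivAt
    exact h1.comp_hasDerivAt 0 (hasDerivAt_line z e)
  have hev := hd.tendsto_slope.eventually_const_lt hpos
  rw [eventually_nhdsWithin_iff] at hev
  obtain ⟨δ, hδ, hδb⟩ := Metric.eventually_nhds_iff.1 hev
  set t := min (δ / 2) (ε / (2 * ‖e‖)) with ht
  have htp : 0 < t := lt_min (by linarith) (by positivity)
  have htδ : t < δ := (min_le_left _ _).trans_lt (by linarith)
  have htε : t * ‖e‖ < ε := by
    have : t ≤ ε / (2 * ‖e‖) := min_le_right _ _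
    rw [le_div_iff₀ (by positivity)] at this
    nlinarith
  have a1 : v z < v (z + t • e) := by
    have := hδb (y := t) (by rw [Real.dist_eq, sub_zero, abs_of_pos htp]; exact htδ) (by
      simp [htp.ne'])
    rw [slope_def_field, sub_zero, lt_div_iff₀ htp] at this
    simp at this ⊢
    linarith
  have a2 : v (z + (-t) • e) < v z := by
    have := hδb (y := -t) (by rw [Real.dist_eq, sub_zero, abs_neg, abs_of_pos htp]; exact htδ) (by
      simp [htp.ne'])
    rw [slope_def_field, sub_zero, lt_div_iff_of_neg (by linarith)] at this
    simp at this ⊢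
    linarith
  have hconn : IsPreconnected (Metric.sphere z (t * ‖e‖)) :=
    isPreconnected_sphere (by rw [Complex.rank_real_complex]; exact Cardinal.one_lt_two) z _
  have hm : ∀ c : ℝ, |c| = t → z + c • e ∈ Metric.sphere z (t * ‖e‖) := by
    intro c hc
    rw [mem_sphere_iff_norm, add_sub_cancel_left, norm_smul, Real.norm_eq_abs, hc]
  obtain ⟨w, hw, hvw⟩ := hconn.intermediate_value (hm (-t) (by rw [abs_neg, abs_of_pos htp]))
    (hm t (abs_of_pos htp)) hv.continuous.continuousOn ⟨a2.le, a1.le⟩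
  refine ⟨w, ⟨hball ?_, hvw⟩, ?_⟩
  · rw [Metric.mem_ball, Metric.mem_sphere.1 hw]; exact htε
  · rintro rfl
    have := Metric.mem_sphere.1 hw
    rw [dist_self] at this
    have : 0 < t * ‖e‖ := by positivity
    linarith

lemma exists_deriv_ne_zero_of_crossF {z : ℂ} (h : crossF f z ≠ 0) : ∃ j, deriv (f j) z ≠ 0 := by
  by_contra hcon
  push Not at hcon
  apply h
  unfold crossF
  simp [hcon]

lemma isOpen_exists_deriv_ne_zero (hf : ∀ j, Differentiable ℂ (f j)) :
    IsOpen {z | ∃ j, deriv (f j) z ≠ 0} := by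
  have : {z | ∃ j, deriv (f j) z ≠ 0} = ⋃ j, {z | deriv (f j) z ≠ 0} := by ext z; simp
  rw [this]
  exact isOpen_iUnion fun j => isOpen_ne_fun (continuous_deriv_entire (hf j)) continuous_const

lemma measurableSet_curveC (hf : ∀ j, Differentiable ℂ (f j)) : MeasurableSet (curveC f) := by
  have : curveC f = {z | sqF f z = 1} ∩ {z | ∃ j, deriv (f j) z ≠ 0} := by
    ext z
    exact and_congr_left' (absF_eq_one_iff f z)
  rw [this]
  exact (isClosed_eq (continuous_sqF hf) continuous_const).measurableSet.inter
    (isOpen_exists_deriv_ne_zero hf).measurableSet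

/-- On the unit tangent vectors of `C` the form has modulus `|⟨f', f⟩| / 2π`. Where `⟨f', f⟩ = 0`
the form vanishes, whatever the tangent cone is; elsewhere `C` is a regular curve, whose tangent
vectors are annihilated by `d|f|²`. -/
lemma iSup_enorm_argForm (hf : ∀ j, Differentiable ℂ (f j)) {z : ℂ} (hz : z ∈ curveC f) :
    ⨆ τ ∈ {τ : ℂ | τ ∈ tangentConeAt ℝ (curveC f) z ∧ ‖τ‖ = 1}, ‖argForm f z τ‖ₑ =
      ENNReal.ofReal (‖crossF f z‖ / (2 * Real.pi)) := by
  have hz1 : sqF f z = 1 := (absF_eq_one_iff f z).1 hz.1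
  by_cases ha : crossF f z = 0
  · simp only [argForm_apply hf, ha]
    simp
  have hval : ∀ τ ∈ {τ : ℂ | τ ∈ tangentConeAt ℝ (curveC f) z ∧ ‖τ‖ = 1},
      ‖argForm f z τ‖ₑ = ENNReal.ofReal (‖crossF f z‖ / (2 * Real.pi)) := by
    rintro τ ⟨hτ, hτ1⟩
    have hd : HasFDerivAt (sqF f) (fderiv ℝ (sqF f) z) z :=
      (((contDiff_sqF hf (n := 1)).differentiable (by norm_num)) z).hasFDerivAt
    have h1 := hd.hasFDerivWithinAt.mapsTo_tangent_cone hτ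
    have h2 : sqF f '' curveC f ⊆ {1} := by
      rintro _ ⟨w, hw, rfl⟩
      exact (absF_eq_one_iff f w).1 hw.1
    have h3 := tangentConeAt_mono h2 h1
    rw [hz1] at h3
    have h4 : ¬ AccPt (1 : ℝ) (𝓟 {1}) := by
      rw [accPt_iff_nhds]
      push Not
      exact ⟨Set.univ, univ_mem, fun y hy => by simpa using hy⟩
    have h5 : fderiv ℝ (sqF f) z τ = 0 := by simpa using tangentConeAt_subset_zero h4 h3
    rw [fderiv_sqF hf] at h5
    have hre : (crossF f z * τ).re = 0 := by linarith
    have him : |(crossF f z * τ).im| = ‖crossF f z‖ := by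
      have := Complex.norm_eq_sqrt_sq_add_sq (crossF f z * τ)
      rw [hre, norm_mul, hτ1, mul_one] at this
      rw [this]
      simp [Real.sqrt_sq_eq_abs]
    rw [argForm_apply hf, ← ofReal_norm, Complex.norm_real, Real.norm_eq_abs, abs_div, him,
      abs_of_pos Real.two_pi_pos]
  have hex : ∃ τ, τ ∈ {τ : ℂ | τ ∈ tangentConeAt ℝ (curveC f) z ∧ ‖τ‖ = 1} := by
    have hacc : AccPt z (𝓟 {w | sqF f w = sqF f z}) := by
      refine accPt_levelSet (contDiff_sqF hf) (e := conj (crossF f z)) ?_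
      rw [fderiv_sqF hf, Complex.mul_conj, Complex.ofReal_re]
      simpa using ha
    have hC : AccPt z (𝓟 (curveC f)) := by
      rw [accPt_iff_nhds] at hacc ⊢
      intro U hU
      obtain ⟨w, ⟨⟨hwU, hwd⟩, hw⟩, hwz⟩ := hacc (U ∩ {z | ∃ j, deriv (f j) z ≠ 0})
        (inter_mem hU ((isOpen_exists_deriv_ne_zero hf).mem_nhds hz.2))
      refine ⟨w, ⟨hwU, ?_, hwd⟩, hwz⟩
      rw [absF_eq_one_iff, ← hz1]
      exact hw
    obtain ⟨τ, hτ, hτ0⟩ := tangentConeAt_nonempty_of_properSpace (𝕜 := ℝ) hC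
    refine ⟨‖τ‖⁻¹ • τ, smul_mem_tangentConeAt _ hτ, ?_⟩
    have : ‖τ‖ ≠ 0 := norm_ne_zero_iff.2 hτ0
    rw [norm_smul, norm_inv, norm_norm, inv_mul_cancel₀ this]
  obtain ⟨τ₀, hτ₀⟩ := hex
  apply le_antisymm
  · exact iSup₂_le fun τ hτ => (hval τ hτ).le
  · rw [← hval τ₀ hτ₀]
    exact le_iSup₂ (f := fun τ (_ : τ ∈ {τ : ℂ | τ ∈ tangentConeAt ℝ (curveC f) z ∧ ‖τ‖ = 1}) =>
      ‖argForm f z τ‖ₑ) τ₀ hτ₀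

lemma formMeasure_eq (hf : ∀ j, Differentiable ℂ (f j)) :
    formMeasure (curveC f) (argForm f) = ((Measure.hausdorffMeasure 1 : Measure ℂ).restrict
      (curveC f)).withDensity fun z => ENNReal.ofReal (‖crossF f z‖ / (2 * Real.pi)) := by
  unfold formMeasure
  refine withDensity_congr_ae ?_
  exact (ae_restrict_iff' (measurableSet_curveC hf)).2
    (Eventually.of_forall fun z hz => iSup_enorm_argForm hf hz)

/-- The points of `|f| = 1` with `f' = 0`, which are not on `C`, do not contribute, since the
density vanishes there. -/
lemma lintegral_formMeasure (hf : ∀ j, Differentiable ℂ (f j)) {u : ℂ → ℝ≥0∞} (hu : Measurable u) :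
    ∫⁻ z, u z ∂(formMeasure (curveC f) (argForm f)) =
      ∫⁻ z in {z | sqF f z = 1}, u z * ENNReal.ofReal (‖crossF f z‖ / (2 * Real.pi))
        ∂(Measure.hausdorffMeasure 1) := by
  have hm : Measurable fun z => ENNReal.ofReal (‖crossF f z‖ / (2 * Real.pi)) :=
    ((continuous_crossF hf).norm.div_const _).measurable.ennreal_ofReal
  rw [formMeasure_eq hf, lintegral_withDensity_eq_lintegral_mul _ hm hu,
    ← lintegral_indicator (measurableSet_curveC hf),
    ← lintegral_indicator (isClosed_eq (continuous_sqF hf) continuous_const).measurableSet]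
  refine lintegral_congr fun z => ?_
  by_cases h1 : sqF f z = 1
  · by_cases h2 : crossF f z = 0
    · simp [Set.indicator, h2]
    · have hz : z ∈ curveC f := ⟨(absF_eq_one_iff f z).2 h1, exists_deriv_ne_zero_of_crossF h2⟩
      rw [Set.indicator_of_mem hz, Set.indicator_of_mem (show z ∈ {z | sqF f z = 1} from h1),
        Pi.mul_apply, mul_comm]
  · have hz : z ∉ curveC f := fun h => h1 ((absF_eq_one_iff f z).1 h.1)
    rw [Set.indicator_of_notMem hz, Set.indicator_of_notMem (show z ∉ {z | sqF f z = 1} from h1)]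

end CurveMeasure

/-! ### The Laplacian of `log|f|` -/

section Laplacian

variable {ℓ : ℕ} {f : Fin ℓ → ℂ → ℂ}

lemma hasDerivAt_comp_line {g : ℂ → ℂ} (hg : Differentiable ℂ g) (z e : ℂ) :
    HasDerivAt (fun t : ℝ => g (z + t • e)) (deriv g z * e) 0 := by
  have h1 : HasDerivAt g (deriv g z) (z + (0 : ℝ) • e) := by
    rw [zero_smul, add_zero]; exact (hg z).hasDerivAt
  exact h1.comp_of_eq (0 : ℝ) (hasDerivAt_line z e) rfl

lemma hasDerivAt_conj_comp_line {g : ℂ → ℂ} (hg : Differentiable ℂ g) (z e : ℂ) :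
    HasDerivAt (fun t : ℝ => conj (g (z + t • e))) (conj (deriv g z * e)) 0 :=
  Complex.conjCLE.toContinuousLinearMap.hasFDerivAt.comp_hasDerivAt (0 : ℝ)
    (hasDerivAt_comp_line hg z e)

lemma differentiable_deriv_entire {g : ℂ → ℂ} (hg : Differentiable ℂ g) :
    Differentiable ℂ (deriv g) := fun w => (hg.analyticAt w).deriv.differentiableAt

lemma hasDerivAt_crossF_line (hf : ∀ j, Differentiable ℂ (f j)) (z e : ℂ) :
    HasDerivAt (fun t : ℝ => crossF f (z + t • e))
      ((∑ j, deriv (deriv (f j)) z * conj (f j z)) * e + sqDerivF f z * conj e) 0 := by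
  have h : ∀ j, HasDerivAt (fun t : ℝ => deriv (f j) (z + t • e) * conj (f j (z + t • e)))
      (deriv (deriv (f j)) z * e * conj (f j (z + (0 : ℝ) • e)) +
        deriv (f j) (z + (0 : ℝ) • e) * conj (deriv (f j) z * e)) 0 := fun j =>
    (hasDerivAt_comp_line (differentiable_deriv_entire (hf j)) z e).mul
      (hasDerivAt_conj_comp_line (hf j) z e)
  refine (HasDerivAt.fun_sum (u := Finset.univ) fun j _ => h j).congr_deriv ?_
  rw [ofReal_sqDerivF, Finset.sum_mul, Finset.sum_mul, ← Finset.sum_add_distrib]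
  refine Finset.sum_congr rfl fun j _ => ?_
  rw [zero_smul, add_zero, map_mul]; ring

lemma hasDerivAt_sqF_line (hf : ∀ j, Differentiable ℂ (f j)) (z e : ℂ) :
    HasDerivAt (fun t : ℝ => sqF f (z + t • e)) (2 * (crossF f z * e).re) 0 := by
  have h1 : HasFDerivAt (sqF f) (fderiv ℝ (sqF f) z) (z + (0 : ℝ) • e) := by
    rw [zero_smul, add_zero]
    exact (((contDiff_sqF hf (n := 1)).differentiable (by norm_num)) z).hasFDerivAt
  rw [← fderiv_sqF hf]
  exact h1.comp_hasDerivAt 0 (hasDerivAt_line z e)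

lemma hasDerivAt_crossF_div_sqF_line (hf : ∀ j, Differentiable ℂ (f j)) {z : ℂ} (hz : 0 < sqF f z)
    (e : ℂ) :
    HasDerivAt (fun t : ℝ => (crossF f (z + t • e) * e).re / sqF f (z + t • e))
      ((((∑ j, deriv (deriv (f j)) z * conj (f j z)) * e + sqDerivF f z * conj e) * e).re / sqF f z
        - 2 * (crossF f z * e).re ^ 2 / sqF f z ^ 2) 0 := by
  have h3 : HasDerivAt (fun t : ℝ => (crossF f (z + t • e) * e).re)
      (((∑ j, deriv (deriv (f j)) z * conj (f j z)) * e + sqDerivF f z * conj e) * e).re 0 :=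
    Complex.reCLM.hasFDerivAt.comp_hasDerivAt (0 : ℝ)
      ((hasDerivAt_crossF_line hf z e).mul_const e)
  have hz0 : sqF f (z + (0 : ℝ) • e) ≠ 0 := by rw [zero_smul, add_zero]; exact hz.ne'
  refine (h3.div (hasDerivAt_sqF_line hf z e) hz0).congr_deriv ?_
  rw [zero_smul, add_zero]
  field_simp

lemma fderiv_log_sqF (hf : ∀ j, Differentiable ℂ (f j)) {z : ℂ} (hz : 0 < sqF f z) (e : ℂ) :
    fderiv ℝ (fun w => Real.log (sqF f w) / 2) z e = (crossF f z * e).re / sqF f z := by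
  have h1 : HasFDerivAt (sqF f) (fderiv ℝ (sqF f) z) z :=
    (((contDiff_sqF hf (n := 1)).differentiable (by norm_num)) z).hasFDerivAt
  have h2 : HasFDerivAt (fun w => Real.log (sqF f w) / 2)
      ((2 : ℝ)⁻¹ • ((sqF f z)⁻¹ • fderiv ℝ (sqF f) z)) z :=
    ((h1.log hz.ne').const_mul (2 : ℝ)⁻¹).congr_of_eventuallyEq
      (Eventually.of_forall fun x => by ring)
  rw [h2.fderiv, smul_apply, smul_apply, fderiv_sqF hf, smul_eq_mul, smul_eq_mul]
  ring

lemma iteratedFDeriv_log_sqF (hf : ∀ j, Differentiable ℂ (f j)) {z : ℂ} (hz : 0 < sqF f z) (e : ℂ) :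
    iteratedFDeriv ℝ 2 (fun w => Real.log (sqF f w) / 2) z ![e, e] =
      (((∑ j, deriv (deriv (f j)) z * conj (f j z)) * e + sqDerivF f z * conj e) * e).re / sqF f z
        - 2 * (crossF f z * e).re ^ 2 / sqF f z ^ 2 := by
  have huc : ContDiffAt ℝ 2 (fun w => Real.log (sqF f w) / 2) z :=
    ((contDiff_sqF hf (n := 2)).contDiffAt.log hz.ne').div_const 2
  have hpos : ∀ᶠ w in 𝓝 z, 0 < sqF f w := (continuous_sqF hf).continuousAt.eventually_const_lt hz
  have hdu : DifferentiableAt ℝ (fderiv ℝ fun w => Real.log (sqF f w) / 2) z :=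
    (huc.fderiv_right (m := 1) (by norm_num)).differentiableAt (by norm_num)
  rw [iteratedFDeriv_two_apply]
  simp only [Matrix.cons_val_zero, Matrix.cons_val_one]
  generalize hu : (fun w => Real.log (sqF f w) / 2) = u at *
  have h0 : HasFDerivAt (fderiv ℝ u) (fderiv ℝ (fderiv ℝ u) z) (z + (0 : ℝ) • e) := by
    rw [zero_smul, add_zero]; exact hdu.hasFDerivAt
  have h1 : HasDerivAt (fun t : ℝ => fderiv ℝ u (z + t • e) e) (fderiv ℝ (fderiv ℝ u) z e e) 0 :=
    (ContinuousLinearMap.apply ℝ ℝ e).hasFDerivAt.comp_hasDerivAt (0 : ℝ)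
      (h0.comp_hasDerivAt (0 : ℝ) (hasDerivAt_line z e))
  have hcont : Tendsto (fun t : ℝ => z + t • e) (𝓝 0) (𝓝 z) := by
    have := (hasDerivAt_line z e).continuousAt.tendsto
    rwa [zero_smul, add_zero] at this
  refine h1.unique ((hasDerivAt_crossF_div_sqF_line hf hz e).congr_of_eventuallyEq ?_)
  filter_upwards [hcont.eventually hpos] with t ht
  rw [← hu, fderiv_log_sqF hf ht]

/-- `∂∂̄ log|f|` where `f ≠ 0`. -/
lemma ddbarDensity_log_absF (hf : ∀ j, Differentiable ℂ (f j)) {z : ℂ} (hz : 0 < sqF f z) :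
    ddbarDensity (fun w => Real.log (absF f w)) z =
      1 / (2 * Real.pi) * ((sqDerivF f z - ‖crossF f z‖ ^ 2 / sqF f z) / sqF f z) := by
  have hlog : (fun w => Real.log (absF f w)) = fun w => Real.log (sqF f w) / 2 := by
    ext w
    rw [absF_eq, Real.log_sqrt (sqF_nonneg f w)]
  have hn : ‖crossF f z‖ ^ 2 = (crossF f z).re ^ 2 + (crossF f z).im ^ 2 := by
    rw [← Complex.normSq_eq_norm_sq, Complex.normSq_apply]; ring
  unfold ddbarDensity
  rw [hlog, InnerProductSpace.laplacian_eq_iteratedFDeriv_complexPlane]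
  simp only [iteratedFDeriv_log_sqF hf hz]
  rw [hn]
  generalize (∑ j, deriv (deriv (f j)) z * conj (f j z)) = A
  simp only [Complex.mul_re, Complex.add_re, Complex.add_im, Complex.mul_im, Complex.one_re,
    Complex.one_im, Complex.I_re, Complex.I_im, Complex.ofReal_re, Complex.ofReal_im, map_one,
    Complex.conj_I, Complex.neg_re, Complex.neg_im]
  field_simp
  ring

end Laplacian

/-! ### The counting divisor -/

section CountingDivisor

lemma finite_zeros_inter_isCompact {G : ℂ → ℂ} (hG : Differentiable ℂ G) (h0 : G ≠ 0) {K : Set ℂ}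
    (hK : IsCompact K) : ({z | G z = 0} ∩ K).Finite := by
  by_contra h
  obtain ⟨x, -, hx⟩ := Set.Infinite.exists_accPt_of_subset_isCompact h hK Set.inter_subset_right
  refine h0 (AnalyticOnNhd.eq_of_frequently_eq (z₀ := x) (fun z _ => hG.analyticAt z)
    (fun z _ => analyticAt_const) ?_)
  exact (accPt_iff_frequently_nhdsNE.1 hx).mono fun y hy => hy.1

lemma lintegral_countingDivisor (r : ℝ) (n : ℕ) (G : ℂ → ℂ) {u : ℂ → ℝ≥0∞} (hu : Measurable u) :
    ∫⁻ z, u z ∂(countingDivisor r n G) = ENNReal.ofReal (1 / n) *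
      ∑' z, {z | G z = 0 ∧ z ∈ puncturedDisk r}.indicator
        (fun z => (analyticOrderNatAt G z : ℝ≥0∞) *
          ENNReal.ofReal (Real.log (r / ‖z‖)) * u z) z := by
  unfold countingDivisor
  rw [lintegral_smul_measure, lintegral_sum_measure, smul_eq_mul, ← tsum_subtype]
  congr 1
  refine tsum_congr fun z => ?_
  rw [lintegral_smul_measure, lintegral_dirac' _ hu, smul_eq_mul]

/-- The sum over the zeros in the support of the test function is finite; if `G` vanishes
identically then `analyticOrderNatAt G = 0` and the divisor is zero. -/
lemma lintegral_countingDivisor_lt_top (r : ℝ) (n : ℕ) {G : ℂ → ℂ} (hG : Differentiable ℂ G)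
    {u : ℂ → ℝ≥0∞} (hu : Measurable u) (hut : ∀ z, u z ≠ ∞) {K : Set ℂ} (hK : IsCompact K)
    (huK : ∀ z ∉ K, u z = 0) : ∫⁻ z, u z ∂(countingDivisor r n G) < ∞ := by
  rw [lintegral_countingDivisor r n G hu]
  refine ENNReal.mul_lt_top ENNReal.ofReal_lt_top ?_
  by_cases h0 : G = 0
  · have : ∀ z, analyticOrderNatAt G z = 0 := fun z => by
      have : analyticOrderAt G z = ⊤ := analyticOrderAt_eq_top.2 (by simp [h0])
      rw [analyticOrderNatAt, this, ENat.toNat_top]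
    simp [this]
  · have hfin := finite_zeros_inter_isCompact hG h0 hK
    rw [tsum_eq_sum (s := hfin.toFinset)]
    · refine ENNReal.sum_lt_top.2 fun z _ => ?_
      refine lt_of_le_of_lt (Set.indicator_le_self _ _ z) ?_
      exact ENNReal.mul_lt_top (ENNReal.mul_lt_top (ENNReal.natCast_lt_top _)
        ENNReal.ofReal_lt_top) (hut z).lt_top
    · intro z hz
      rw [Set.Finite.mem_toFinset] at hz
      refine Set.indicator_apply_eq_zero.2 fun h => ?_
      rw [huK z fun hzK => hz ⟨h.1, hzK⟩, mul_zero]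

lemma integrable_countingDivisor {E : Type*} [NormedAddCommGroup E] (r : ℝ) (n : ℕ)
    {G : ℂ → ℂ} (hG : Differentiable ℂ G) {φ : ℂ → E} (hφ : Continuous φ)
    (hφc : HasCompactSupport φ) : Integrable φ (countingDivisor r n G) := by
  refine ⟨hφ.aestronglyMeasurable, ?_⟩
  refine lintegral_countingDivisor_lt_top r n hG hφ.enorm.measurable (fun z => enorm_ne_top) hφc ?_
  intro z hz
  rw [image_eq_zero_of_notMem_tsupport hz, enorm_zero]

/-- When all zeros are simple the divisor does not see multiplicities, and the condition
`z ∈ puncturedDisk r` is implied by `ψ z ≠ 0`. -/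
lemma lintegral_countingDivisor_of_simple (r : ℝ) (n : ℕ) {G : ℂ → ℂ} (hG : Differentiable ℂ G)
    (hs : ∀ z, G z = 0 → deriv G z ≠ 0) {ψ : ℂ → ℝ} (hψ : Continuous ψ)
    (hψ0 : ∀ z, 0 ≤ ψ z) (hψr : tsupport ψ ⊆ puncturedDisk r) :
    ∫⁻ z, ENNReal.ofReal (ψ z) ∂(countingDivisor r n G) = ENNReal.ofReal (1 / n) *
      ∑' z, {z | G z = 0}.indicator (fun z => ENNReal.ofReal (ψ z * Real.log (r / ‖z‖))) z := by
  rw [lintegral_countingDivisor r n G hψ.measurable.ennreal_ofReal]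
  congr 1
  refine tsum_congr fun z => ?_
  by_cases hz : G z = 0
  · rw [Set.indicator_of_mem (show z ∈ {z | G z = 0} from hz)]
    have h1 : analyticOrderNatAt G z = 1 := by
      rw [analyticOrderNatAt,
        (hG.analyticAt z).analyticOrderAt_eq_one_of_zero_deriv_ne_zero hz (hs z hz), ENat.toNat_one]
    by_cases hzr : z ∈ puncturedDisk r
    · rw [Set.indicator_of_mem (show z ∈ {z | G z = 0 ∧ z ∈ puncturedDisk r} from ⟨hz, hzr⟩), h1,
        Nat.cast_one, one_mul, mul_comm, ← ENNReal.ofReal_mul (hψ0 z)]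
    · rw [Set.indicator_of_notMem (show z ∉ {z | G z = 0 ∧ z ∈ puncturedDisk r} from
        fun h => hzr h.2), image_eq_zero_of_notMem_tsupport fun h => hzr (hψr h), zero_mul,
        ENNReal.ofReal_zero]
  · rw [Set.indicator_of_notMem (show z ∉ {z | G z = 0} from hz),
      Set.indicator_of_notMem (show z ∉ {z | G z = 0 ∧ z ∈ puncturedDisk r} from fun h => hz h.1)]

lemma log_div_norm_nonneg {r : ℝ} {z : ℂ} (hz : z ∈ puncturedDisk r) : 0 ≤ Real.log (r / ‖z‖) :=
  Real.log_nonneg ((one_le_div hz.1).2 hz.2.le)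

lemma mul_log_nonneg {r : ℝ} {ψ : ℂ → ℝ} (hψ0 : ∀ z, 0 ≤ ψ z)
    (hψr : tsupport ψ ⊆ puncturedDisk r) (z : ℂ) : 0 ≤ ψ z * Real.log (r / ‖z‖) := by
  by_cases hz : z ∈ tsupport ψ
  · exact mul_nonneg (hψ0 z) (log_div_norm_nonneg (hψr hz))
  · rw [image_eq_zero_of_notMem_tsupport hz, zero_mul]

lemma continuous_mul_log {r : ℝ} (hr : 0 < r) {ψ : ℂ → ℝ} (hψ : Continuous ψ)
    (hψr : tsupport ψ ⊆ puncturedDisk r) : Continuous fun z => ψ z * Real.log (r / ‖z‖) := by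
  refine continuous_iff_continuousAt.2 fun z => ?_
  by_cases hz : z ∈ tsupport ψ
  · have h0 : ‖z‖ ≠ 0 := (hψr hz).1.ne'
    exact hψ.continuousAt.mul
      ((continuousAt_const.div continuous_norm.continuousAt h0).log (div_pos hr (hψr hz).1).ne')
  · have h : (fun z => ψ z * Real.log (r / ‖z‖)) =ᶠ[𝓝 z] fun _ => 0 := by
      filter_upwards [(isClosed_tsupport ψ).isOpen_compl.mem_nhds hz] with w hw
      rw [image_eq_zero_of_notMem_tsupport hw, zero_mul]
    exact continuousAt_const.congr h.symm

end CountingDivisor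

/-! ### The expected divisor -/

section Expectation

variable {ℓ : ℕ} {f : Fin ℓ → ℂ → ℂ} {r : ℝ} {ψ : ℂ → ℝ}

lemma continuous_expectedDensity (hf : ∀ j, Differentiable ℂ (f j)) (n : ℕ) :
    Continuous (expectedDensity f n) := by
  have hd := fun i => differentiable_monomialF hf n i
  have hpos : ∀ z, (∑ i, ‖monomialF f n i z‖ ^ 2) ≠ 0 := fun z => by
    rw [sum_normSq_monomialF]
    exact (zero_lt_one.trans_le (one_le_geomSum n (sqF_nonneg f z))).ne'
  have h1 : Continuous fun z => ∑ i, ‖monomialF f n i z‖ ^ 2 :=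
    continuous_finsetSum _ fun i _ => (hd i).continuous.norm.pow 2
  have h2 : Continuous fun z => ∑ i, ‖deriv (monomialF f n i) z‖ ^ 2 :=
    continuous_finsetSum _ fun i _ => (continuous_deriv_entire (hd i)).norm.pow 2
  have h3 : Continuous fun z => ‖∑ i, deriv (monomialF f n i) z * conj (monomialF f n i z)‖ ^ 2 :=
    (continuous_finsetSum _ fun i _ => (continuous_deriv_entire (hd i)).mul
      (Complex.continuous_conj.comp (hd i).continuous)).norm.pow 2
  exact continuous_const.mul (continuous_const.mul
    ((h2.div h1 hpos).sub (h3.div (h1.pow 2) fun z => pow_ne_zero 2 (hpos z))))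

lemma normSq_crossF_div_le (f : Fin ℓ → ℂ → ℂ) (z : ℂ) :
    ‖crossF f z‖ ^ 2 / sqF f z ≤ sqDerivF f z :=
  div_le_of_le_mul₀ (sqF_nonneg f z) (sqDerivF_nonneg f z)
    (by rw [mul_comm]; exact normSq_crossF_le f z)

lemma expectedDensity_nonneg (hf : ∀ j, Differentiable ℂ (f j)) (n : ℕ) (z : ℂ) :
    0 ≤ expectedDensity f n z := by
  rcases Nat.eq_zero_or_pos n with rfl | hn
  · simp [expectedDensity]
  · rw [expectedDensity_eq hf hn]
    have h1 := meanDegreeDeriv_nonneg n (sqF_nonneg f z)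
    have h2 := logDerivGeom_nonneg n (sqF_nonneg f z)
    have h3 := sub_nonneg.2 (normSq_crossF_div_le f z)
    have h4 := sqF_nonneg f z
    positivity

lemma differentiable_randomPoly (hf : ∀ j, Differentiable ℂ (f j)) (n : ℕ)
    (a : MultiIndex ℓ n → ℂ) : Differentiable ℂ (randomPoly f n a) := fun z =>
  (hasDerivAt_linComb (fun i => differentiable_monomialF hf n i) a z).differentiableAt

/-- The multi-index of length zero, whose monomial is the constant `1`. -/
def emptyIndex (ℓ n : ℕ) : MultiIndex ℓ n := ⟨0, fun k => k.elim0⟩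

lemma monomialF_emptyIndex (f : Fin ℓ → ℂ → ℂ) (n : ℕ) (z : ℂ) :
    monomialF f n (emptyIndex ℓ n) z = 1 :=
  Fin.prod_univ_zero _

/-- Almost surely all zeros of `G_n` are simple. -/
lemma lintegral_countingDivisor_ae_eq (hf : ∀ j, Differentiable ℂ (f j)) (n : ℕ)
    (hψ : Continuous ψ) (hψ0 : ∀ z, 0 ≤ ψ z) (hψr : tsupport ψ ⊆ puncturedDisk r) :
    (fun a => ∫⁻ z, ENNReal.ofReal (ψ z) ∂(countingDivisor r n (randomPoly f n a)))
      =ᵐ[coeffLaw ℓ n] fun a => ENNReal.ofReal (1 / n) *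
        ∑' z, {z | ∑ i, a i * monomialF f n i z = 0}.indicator
          (fun z => ENNReal.ofReal (ψ z * Real.log (r / ‖z‖))) z := by
  have hd := fun i => differentiable_monomialF hf n i
  filter_upwards [ae_simple_zeros hd (monomialF_emptyIndex f n)] with a ha
  refine lintegral_countingDivisor_of_simple r n (differentiable_randomPoly hf n a) ?_ hψ hψ0 hψr
  intro z hz
  rw [show deriv (randomPoly f n a) z = ∑ i, a i * deriv (monomialF f n i) z from
    (hasDerivAt_linComb hd a z).deriv]
  exact ha z hz

lemma measurable_tsum_zeros_randomPoly (hf : ∀ j, Differentiable ℂ (f j)) (n : ℕ) (hr : 0 < r)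
    (hψ : Continuous ψ) (hψr : tsupport ψ ⊆ puncturedDisk r) :
    Measurable fun a : MultiIndex ℓ n → ℂ =>
      ∑' z, {z | ∑ i, a i * monomialF f n i z = 0}.indicator
          (fun z => ENNReal.ofReal (ψ z * Real.log (r / ‖z‖))) z :=
  measurable_tsum_zeros
    (continuous_uncurry_linComb fun i => (differentiable_monomialF hf n i).continuous)
    (ENNReal.continuous_ofReal.comp (continuous_mul_log hr hψ hψr))

lemma lintegral_lintegral_countingDivisor (hf : ∀ j, Differentiable ℂ (f j)) (n : ℕ) (hr : 0 < r)
    (hψ : Continuous ψ) (hψ0 : ∀ z, 0 ≤ ψ z) (hψr : tsupport ψ ⊆ puncturedDisk r) :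
    ∫⁻ a, ∫⁻ z, ENNReal.ofReal (ψ z) ∂(countingDivisor r n (randomPoly f n a)) ∂(coeffLaw ℓ n) =
      ∫⁻ z, ENNReal.ofReal (ψ z * Real.log (r / ‖z‖) * expectedDensity f n z) := by
  rw [lintegral_congr_ae (lintegral_countingDivisor_ae_eq hf n hψ hψ0 hψr),
    lintegral_const_mul _ (measurable_tsum_zeros_randomPoly hf n hr hψ hψr)]
  unfold coeffLaw
  rw [lintegral_tsum_zeros_gaussian (fun i => differentiable_monomialF hf n i)
    (monomialF_emptyIndex f n)
    (u := fun z => ENNReal.ofReal (ψ z * Real.log (r / ‖z‖)))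
    (ENNReal.continuous_ofReal.comp (continuous_mul_log hr hψ hψr)),
    ← lintegral_const_mul' _ _ ENNReal.ofReal_ne_top]
  refine lintegral_congr fun z => ?_
  rw [mul_left_comm, ← ENNReal.ofReal_mul (by positivity),
    ← ENNReal.ofReal_mul (mul_log_nonneg hψ0 hψr z)]
  rfl

lemma hasCompactSupport_mul_log (hψc : HasCompactSupport ψ) (r : ℝ) :
    HasCompactSupport fun z => ψ z * Real.log (r / ‖z‖) :=
  HasCompactSupport.mul_right hψc

lemma integrable_mul_log_mul_expectedDensity (hf : ∀ j, Differentiable ℂ (f j)) (n : ℕ) (hr : 0 < r)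
    (hψ : Continuous ψ) (hψc : HasCompactSupport ψ) (hψr : tsupport ψ ⊆ puncturedDisk r) :
    Integrable fun z => ψ z * Real.log (r / ‖z‖) * expectedDensity f n z :=
  ((continuous_mul_log hr hψ hψr).mul
    (continuous_expectedDensity hf n)).integrable_of_hasCompactSupport
      (HasCompactSupport.mul_right (hasCompactSupport_mul_log hψc r))

lemma integral_countingDivisor_eq_toReal (r : ℝ) (n : ℕ) (G : ℂ → ℂ)
    (hψ : Continuous ψ) (hψ0 : ∀ z, 0 ≤ ψ z) :
    ∫ z, ψ z ∂(countingDivisor r n G) =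
      (∫⁻ z, ENNReal.ofReal (ψ z) ∂(countingDivisor r n G)).toReal :=
  integral_eq_lintegral_of_nonneg_ae (Eventually.of_forall hψ0) hψ.aestronglyMeasurable

lemma aemeasurable_lintegral_countingDivisor (hf : ∀ j, Differentiable ℂ (f j)) (n : ℕ) (hr : 0 < r)
    (hψ : Continuous ψ) (hψ0 : ∀ z, 0 ≤ ψ z) (hψr : tsupport ψ ⊆ puncturedDisk r) :
    AEMeasurable (fun a => ∫⁻ z, ENNReal.ofReal (ψ z) ∂(countingDivisor r n (randomPoly f n a)))
      (coeffLaw ℓ n) :=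
  ⟨_, (measurable_tsum_zeros_randomPoly hf n hr hψ hψr).const_mul _,
    lintegral_countingDivisor_ae_eq hf n hψ hψ0 hψr⟩

lemma integrable_integral_countingDivisor (hf : ∀ j, Differentiable ℂ (f j)) (n : ℕ) (hr : 0 < r)
    (hψ : Continuous ψ) (hψc : HasCompactSupport ψ) (hψ0 : ∀ z, 0 ≤ ψ z)
    (hψr : tsupport ψ ⊆ puncturedDisk r) :
    Integrable (fun a => ∫ z, ψ z ∂(countingDivisor r n (randomPoly f n a))) (coeffLaw ℓ n) := by
  simp_rw [integral_countingDivisor_eq_toReal r n _ hψ hψ0]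
  refine integrable_toReal_of_lintegral_ne_top
    (aemeasurable_lintegral_countingDivisor hf n hr hψ hψ0 hψr) ?_
  rw [lintegral_lintegral_countingDivisor hf n hr hψ hψ0 hψr]
  exact (integrable_mul_log_mul_expectedDensity hf n hr hψ hψc hψr).lintegral_lt_top.ne

/-- The expected value of a linear statistic of the divisor. -/
lemma integral_integral_countingDivisor (hf : ∀ j, Differentiable ℂ (f j)) (n : ℕ) (hr : 0 < r)
    (hψ : Continuous ψ) (hψc : HasCompactSupport ψ) (hψ0 : ∀ z, 0 ≤ ψ z)
    (hψr : tsupport ψ ⊆ puncturedDisk r) :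
    ∫ a, ∫ z, ψ z ∂(countingDivisor r n (randomPoly f n a)) ∂(coeffLaw ℓ n) =
      ∫ z, ψ z * Real.log (r / ‖z‖) * expectedDensity f n z := by
  simp_rw [integral_countingDivisor_eq_toReal r n _ hψ hψ0]
  rw [integral_toReal (aemeasurable_lintegral_countingDivisor hf n hr hψ hψ0 hψr)
      (Eventually.of_forall fun a => lintegral_countingDivisor_lt_top r n
        (differentiable_randomPoly hf n a) hψ.measurable.ennreal_ofReal
        (fun _ => ENNReal.ofReal_ne_top) hψc fun z hz => by
          rw [image_eq_zero_of_notMem_tsupport hz, ENNReal.ofReal_zero]),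
    lintegral_lintegral_countingDivisor hf n hr hψ hψ0 hψr,
    integral_eq_lintegral_of_nonneg_ae
      (Eventually.of_forall fun z => mul_nonneg (mul_log_nonneg hψ0 hψr z)
        (expectedDensity_nonneg hf n z))
      (integrable_mul_log_mul_expectedDensity hf n hr hψ hψc hψr).aestronglyMeasurable]

end Expectation

/-! ### Passage to the limit -/

section Limit

variable {ℓ : ℕ} {f : Fin ℓ → ℂ → ℂ} {Ψ : ℂ → ℝ}

/-- The pointwise limit of `logDerivGeom n` as `n → ∞`. -/
noncomputable def logDerivGeomLim (s : ℝ) : ℝ := if 1 < s then 1 / s else if s = 1 then 1 / 2 else 0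

lemma tendsto_logDerivGeom {s : ℝ} (hs : 0 ≤ s) :
    Tendsto (fun n => logDerivGeom n s) atTop (𝓝 (logDerivGeomLim s)) := by
  unfold logDerivGeomLim
  split_ifs with h1 h2
  · exact tendsto_logDerivGeom_of_one_lt h1
  · rw [h2]
    refine tendsto_const_nhds.congr' ?_
    filter_upwards [eventually_gt_atTop 0] with n hn
    rw [logDerivGeom_one hn]
  · exact tendsto_logDerivGeom_of_lt_one hs (lt_of_le_of_ne (not_lt.1 h1) h2)

lemma measurable_logDerivGeomLim : Measurable logDerivGeomLim :=
  Measurable.ite measurableSet_Ioi (measurable_const.div measurable_id)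
    (Measurable.ite (measurableSet_singleton 1) measurable_const measurable_const)

lemma logDerivGeomLim_nonneg {s : ℝ} (hs : 0 ≤ s) : 0 ≤ logDerivGeomLim s :=
  ge_of_tendsto' (tendsto_logDerivGeom hs) fun n => logDerivGeom_nonneg n hs

lemma logDerivGeomLim_le_one {s : ℝ} (hs : 0 ≤ s) : logDerivGeomLim s ≤ 1 :=
  le_of_tendsto' (tendsto_logDerivGeom hs) fun n => logDerivGeom_le_one n hs

/-- The density of the absolutely continuous part of the limit. -/
lemma absF_mul_Xi_mul_ddbarDensity (hf : ∀ j, Differentiable ℂ (f j)) (z : ℂ) :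
    absF f z * Xi (absF f z) * ddbarDensity (fun w => Real.log (absF f w)) z =
      1 / Real.pi * (logDerivGeomLim (sqF f z) * (sqDerivF f z - ‖crossF f z‖ ^ 2 / sqF f z)) := by
  unfold Xi logDerivGeomLim
  simp only [one_lt_absF_iff, absF_eq_one_iff]
  split_ifs with h1 h2
  · have h0 : absF f z ≠ 0 := (zero_lt_one.trans ((one_lt_absF_iff f z).2 h1)).ne'
    rw [ddbarDensity_log_absF hf (zero_lt_one.trans h1), mul_div_cancel₀ _ h0]
    ring
  · rw [ddbarDensity_log_absF hf (by rw [h2]; exact zero_lt_one), h2, (absF_eq_one_iff f z).2 h2]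
    ring
  · ring

lemma integrable_mul_sqDerivF (hf : ∀ j, Differentiable ℂ (f j)) (hΨ : Continuous Ψ)
    (hΨc : HasCompactSupport Ψ) : Integrable fun z => Ψ z * sqDerivF f z :=
  (hΨ.mul (continuous_sqDerivF hf)).integrable_of_hasCompactSupport
    (HasCompactSupport.mul_right hΨc)

lemma measurable_normSq_crossF_div (hf : ∀ j, Differentiable ℂ (f j)) :
    Measurable fun z => ‖crossF f z‖ ^ 2 / sqF f z :=
  ((continuous_crossF hf).norm.pow 2).measurable.div (continuous_sqF hf).measurable

lemma abs_mul_mul_sub_le (hΨ0 : ∀ z, 0 ≤ Ψ z) {h : ℝ} (h0 : 0 ≤ h) (h1 : h ≤ 1) (z : ℂ) :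
    ‖Ψ z * (h * (sqDerivF f z - ‖crossF f z‖ ^ 2 / sqF f z))‖ ≤ Ψ z * sqDerivF f z := by
  have h3 := sub_nonneg.2 (normSq_crossF_div_le f z)
  have h4 : 0 ≤ ‖crossF f z‖ ^ 2 / sqF f z := div_nonneg (by positivity) (sqF_nonneg f z)
  rw [Real.norm_eq_abs, abs_of_nonneg (mul_nonneg (hΨ0 z) (mul_nonneg h0 h3))]
  refine mul_le_mul_of_nonneg_left ?_ (hΨ0 z)
  exact (mul_le_of_le_one_left h3 h1).trans (sub_le_self _ h4)

lemma integrable_mul_mul_sub (hf : ∀ j, Differentiable ℂ (f j)) (hΨ : Continuous Ψ)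
    (hΨc : HasCompactSupport Ψ) (hΨ0 : ∀ z, 0 ≤ Ψ z) {h : ℂ → ℝ} (hm : Measurable h)
    (h0 : ∀ z, 0 ≤ h z) (h1 : ∀ z, h z ≤ 1) :
    Integrable fun z => Ψ z * (h z * (sqDerivF f z - ‖crossF f z‖ ^ 2 / sqF f z)) := by
  refine (integrable_mul_sqDerivF hf hΨ hΨc).mono' ?_
    (Eventually.of_forall fun z => abs_mul_mul_sub_le hΨ0 (h0 z) (h1 z) z)
  exact (hΨ.measurable.mul (hm.mul ((continuous_sqDerivF hf).measurable.sub
    (measurable_normSq_crossF_div hf)))).aestronglyMeasurable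

lemma measurable_logDerivGeom_sqF (hf : ∀ j, Differentiable ℂ (f j)) (n : ℕ) :
    Measurable fun z => logDerivGeom n (sqF f z) :=
  ((continuousOn_logDerivGeom n).comp_continuous (continuous_sqF hf)
    fun z => sqF_nonneg f z).measurable

lemma continuous_meanDegreeDeriv_sqF (hf : ∀ j, Differentiable ℂ (f j)) (n : ℕ) :
    Continuous fun z => meanDegreeDeriv n (sqF f z) :=
  (continuousOn_meanDegreeDeriv n).comp_continuous (continuous_sqF hf) fun z => sqF_nonneg f z

lemma tendsto_integral_logDerivGeom (hf : ∀ j, Differentiable ℂ (f j)) (hΨ : Continuous Ψ)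
    (hΨc : HasCompactSupport Ψ) (hΨ0 : ∀ z, 0 ≤ Ψ z) :
    Tendsto (fun n => ∫ z, Ψ z * (logDerivGeom n (sqF f z) *
        (sqDerivF f z - ‖crossF f z‖ ^ 2 / sqF f z))) atTop
      (𝓝 (∫ z, Ψ z * (logDerivGeomLim (sqF f z) *
        (sqDerivF f z - ‖crossF f z‖ ^ 2 / sqF f z)))) := by
  refine tendsto_integral_of_dominated_convergence (fun z => Ψ z * sqDerivF f z) (fun n => ?_)
    (integrable_mul_sqDerivF hf hΨ hΨc) (fun n => Eventually.of_forall fun z => ?_)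
    (Eventually.of_forall fun z => ?_)
  · exact (integrable_mul_mul_sub hf hΨ hΨc hΨ0 (measurable_logDerivGeom_sqF hf n)
      (fun z => logDerivGeom_nonneg n (sqF_nonneg f z))
      (fun z => logDerivGeom_le_one n (sqF_nonneg f z))).aestronglyMeasurable
  · exact abs_mul_mul_sub_le hΨ0 (logDerivGeom_nonneg n (sqF_nonneg f z))
      (logDerivGeom_le_one n (sqF_nonneg f z)) z
  · exact ((tendsto_logDerivGeom (sqF_nonneg f z)).mul_const _).const_mul _

/-- The factor `1/|f|²`, singular at the common zeros, may be truncated there, because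
`meanDegreeDeriv n` is `O(1/n)` on `|f|² ≤ 1/2`. -/
lemma abs_meanDegreeDeriv_truncation_le (hΨ0 : ∀ z, 0 ≤ Ψ z) {C : ℝ} (hC0 : 0 ≤ C) {n : ℕ}
    (hC : ∀ s, 0 ≤ s → s ≤ 1 / 2 → meanDegreeDeriv n s ≤ C / n) (z : ℂ) :
    ‖Ψ z * (meanDegreeDeriv n (sqF f z) * (‖crossF f z‖ ^ 2 / sqF f z)) -
      4⁻¹ * (Ψ z / max (sqF f z) (1 / 2) *
        (meanDegreeDeriv n (sqF f z) * (2 * ‖crossF f z‖) ^ 2))‖ ≤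
      C / n * (Ψ z * sqDerivF f z) := by
  have hv := sqF_nonneg f z
  have hq := sqDerivF_nonneg f z
  have hΨz := hΨ0 z
  have hp := meanDegreeDeriv_nonneg n hv
  have hCn : 0 ≤ C / n := div_nonneg hC0 (Nat.cast_nonneg n)
  have e : Ψ z * (meanDegreeDeriv n (sqF f z) * (‖crossF f z‖ ^ 2 / sqF f z)) -
      4⁻¹ * (Ψ z / max (sqF f z) (1 / 2) *
        (meanDegreeDeriv n (sqF f z) * (2 * ‖crossF f z‖) ^ 2)) =
      Ψ z * (meanDegreeDeriv n (sqF f z) * (‖crossF f z‖ ^ 2 / sqF f z -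
        ‖crossF f z‖ ^ 2 / max (sqF f z) (1 / 2))) := by ring
  rw [e]
  rcases le_or_gt (1 / 2) (sqF f z) with h | h
  · rw [max_eq_left h, sub_self, mul_zero, mul_zero, norm_zero]
    positivity
  · have h1 : 0 ≤ ‖crossF f z‖ ^ 2 / sqF f z - ‖crossF f z‖ ^ 2 / max (sqF f z) (1 / 2) := by
      rw [sub_nonneg]
      rcases eq_or_lt_of_le hv with h0 | h0
      · have hc : ‖crossF f z‖ ^ 2 = 0 := by
          have := normSq_crossF_le f z
          rw [← h0, zero_mul] at this
          exact le_antisymm this (by positivity)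
        rw [hc, zero_div, zero_div]
      · exact div_le_div_of_nonneg_left (by positivity) h0 (le_max_left _ _)
    have h2 : ‖crossF f z‖ ^ 2 / sqF f z - ‖crossF f z‖ ^ 2 / max (sqF f z) (1 / 2) ≤
        sqDerivF f z :=
      (sub_le_self _ (by positivity)).trans (normSq_crossF_div_le f z)
    rw [Real.norm_eq_abs, abs_of_nonneg (mul_nonneg hΨz (mul_nonneg hp h1)), mul_left_comm (C / n)]
    exact mul_le_mul_of_nonneg_left (mul_le_mul (hC _ hv h.le) h2 h1 hCn) hΨz

/-- The concentrating part of the expected density tends to the measure of the curve `|f| = 1`. -/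
lemma exists_tendsto_integral_meanDegreeDeriv (hf : ∀ j, Differentiable ℂ (f j))
    (hΨ : Continuous Ψ) (hΨc : HasCompactSupport Ψ) (hΨ0 : ∀ z, 0 ≤ Ψ z) :
    ∃ J : ℝ, 0 ≤ J ∧
      Tendsto (fun n => ∫ z, Ψ z * (meanDegreeDeriv n (sqF f z) * (‖crossF f z‖ ^ 2 / sqF f z)))
        atTop (𝓝 (Real.pi * J)) ∧
      ENNReal.ofReal J = ∫⁻ z, ENNReal.ofReal (Ψ z) ∂(formMeasure (curveC f) (argForm f)) := by
  have hmax : Continuous fun z => max (sqF f z) (1 / 2) := (continuous_sqF hf).max continuous_const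
  have hmax0 : ∀ z, 0 < max (sqF f z) (1 / 2) := fun z => lt_max_of_lt_right (by norm_num)
  have hχ : Continuous fun z => Ψ z / max (sqF f z) (1 / 2) := hΨ.div hmax fun z => (hmax0 z).ne'
  have hχc : HasCompactSupport fun z => Ψ z / max (sqF f z) (1 / 2) := by
    simp_rw [div_eq_mul_inv]
    exact HasCompactSupport.mul_right hΨc
  -- `|∇v|² = 4 |⟨f', f⟩|²` for `v = |f|²`, and `Ψ / max v (1/2)` agrees with `Ψ` on `v = 1`.
  obtain ⟨I, hI0, hI, hIe⟩ := isStepApprox_meanDegree.exists_tendsto_integral_gradNorm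
    (analyticOnNhd_sqF hf) (sqF_nonneg f) hχ hχc fun z => div_nonneg (hΨ0 z) (hmax0 z).le
  simp_rw [gradNorm_sqF hf] at hI hIe
  refine ⟨1 / (4 * Real.pi) * I, by positivity, ?_, ?_⟩
  · obtain ⟨C, hC0, hC⟩ := exists_meanDegreeDeriv_bound
    have hq := integrable_mul_sqDerivF hf hΨ hΨc
    have hbound : ∀ n z, ‖Ψ z * (meanDegreeDeriv n (sqF f z) * (‖crossF f z‖ ^ 2 / sqF f z)) -
      4⁻¹ * (Ψ z / max (sqF f z) (1 / 2) *
        (meanDegreeDeriv n (sqF f z) * (2 * ‖crossF f z‖) ^ 2))‖ ≤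
      C / n * (Ψ z * sqDerivF f z) := fun n z =>
      abs_meanDegreeDeriv_truncation_le hΨ0 hC0 (hC n) z
    have hint1 : ∀ n, Integrable fun z => 4⁻¹ * (Ψ z / max (sqF f z) (1 / 2) *
        (meanDegreeDeriv n (sqF f z) * (2 * ‖crossF f z‖) ^ 2)) := fun n =>
      ((hχ.mul ((continuous_meanDegreeDeriv_sqF hf n).mul
        ((continuous_const.mul (continuous_crossF hf).norm).pow 2))).integrable_of_hasCompactSupport
        (HasCompactSupport.mul_right hχc)).const_mul _
    have hmeas : ∀ n, Measurable fun z =>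
        Ψ z * (meanDegreeDeriv n (sqF f z) * (‖crossF f z‖ ^ 2 / sqF f z)) := fun n =>
      hΨ.measurable.mul ((continuous_meanDegreeDeriv_sqF hf n).measurable.mul
        (measurable_normSq_crossF_div hf))
    have hdiff : ∀ n, Integrable fun z =>
        Ψ z * (meanDegreeDeriv n (sqF f z) * (‖crossF f z‖ ^ 2 / sqF f z)) -
          4⁻¹ * (Ψ z / max (sqF f z) (1 / 2) *
            (meanDegreeDeriv n (sqF f z) * (2 * ‖crossF f z‖) ^ 2)) := fun n =>
      (hq.const_mul (C / n)).mono' ((hmeas n).aestronglyMeasurable.sub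
        (hint1 n).aestronglyMeasurable) (Eventually.of_forall (hbound n))
    have hzero : Tendsto (fun n : ℕ => ∫ z,
        (Ψ z * (meanDegreeDeriv n (sqF f z) * (‖crossF f z‖ ^ 2 / sqF f z)) -
          4⁻¹ * (Ψ z / max (sqF f z) (1 / 2) *
            (meanDegreeDeriv n (sqF f z) * (2 * ‖crossF f z‖) ^ 2)))) atTop (𝓝 0) := by
      have hlim : Tendsto (fun n : ℕ => C / n * ∫ z, Ψ z * sqDerivF f z) atTop (𝓝 0) := by
        have := (tendsto_const_div_atTop_nhds_zero_nat C).mul_const (∫ z, Ψ z * sqDerivF f z)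
        rwa [zero_mul] at this
      refine squeeze_zero_norm (fun n => ?_) hlim
      rw [← integral_const_mul]
      exact norm_integral_le_of_norm_le (hq.const_mul _) (Eventually.of_forall (hbound n))
    have h := hzero.add (hI.const_mul 4⁻¹)
    rw [zero_add, show (4 : ℝ)⁻¹ * I = Real.pi * (1 / (4 * Real.pi) * I) by
      field_simp] at h
    refine h.congr fun n => ?_
    rw [← integral_const_mul, ← integral_add (hdiff n) (hint1 n)]
    exact integral_congr_ae (Eventually.of_forall fun z => sub_add_cancel _ _)
  · rw [lintegral_formMeasure hf hΨ.measurable.ennreal_ofReal,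
      ENNReal.ofReal_mul (by positivity), hIe,
      ← lintegral_const_mul' _ _ ENNReal.ofReal_ne_top]
    refine setLIntegral_congr_fun
      (isClosed_eq (continuous_sqF hf) continuous_const).measurableSet fun z hz => ?_
    have hz1 : max (sqF f z) (1 / 2) = 1 := by
      rw [show sqF f z = 1 from hz]; norm_num
    simp only [hz1, div_one]
    rw [← ENNReal.ofReal_mul (by positivity), ← ENNReal.ofReal_mul (hΨ0 z)]
    congr 1
    field_simp
    ring

end Limit

/-! ### Complex test functions -/

section Assembly

variable {ℓ : ℕ} {f : Fin ℓ → ℂ → ℂ} {r : ℝ} {ψ : ℂ → ℝ}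

lemma integrable_log_mul_absF (hf : ∀ j, Differentiable ℂ (f j)) (hr : 0 < r)
    (hψ : Continuous ψ) (hψc : HasCompactSupport ψ) (hψ0 : ∀ z, 0 ≤ ψ z)
    (hψr : tsupport ψ ⊆ puncturedDisk r) :
    Integrable fun z => (Real.log (r / ‖z‖) * (absF f z * Xi (absF f z) *
      ddbarDensity (fun w => Real.log (absF f w)) z)) * ψ z := by
  have h := (integrable_mul_mul_sub hf (continuous_mul_log hr hψ hψr)
    (hasCompactSupport_mul_log hψc r) (mul_log_nonneg hψ0 hψr)
    (measurable_logDerivGeomLim.comp (continuous_sqF hf).measurable)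
    (fun z => logDerivGeomLim_nonneg (sqF_nonneg f z))
    (fun z => logDerivGeomLim_le_one (sqF_nonneg f z))).const_mul (1 / Real.pi)
  refine h.congr (Eventually.of_forall fun z => ?_)
  simp only [absF_mul_Xi_mul_ddbarDensity hf, Function.comp_apply]
  ring

lemma integrable_log_mul_formMeasure (hf : ∀ j, Differentiable ℂ (f j)) (hr : 0 < r)
    (hψ : Continuous ψ) (hψc : HasCompactSupport ψ) (hψ0 : ∀ z, 0 ≤ ψ z)
    (hψr : tsupport ψ ⊆ puncturedDisk r) :
    Integrable (fun z => Real.log (r / ‖z‖) * ψ z) (formMeasure (curveC f) (argForm f)) := by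
  obtain ⟨J, -, -, hJ⟩ := exists_tendsto_integral_meanDegreeDeriv hf (continuous_mul_log hr hψ hψr)
    (hasCompactSupport_mul_log hψc r) (mul_log_nonneg hψ0 hψr)
  simp_rw [mul_comm (Real.log _)]
  refine ⟨(continuous_mul_log hr hψ hψr).aestronglyMeasurable, ?_⟩
  rw [hasFiniteIntegral_iff_ofReal (Eventually.of_forall (mul_log_nonneg hψ0 hψr)), ← hJ]
  exact ENNReal.ofReal_lt_top

/-- The limit theorem for nonnegative real test functions. -/
lemma tendsto_integral_countingDivisor (hf : ∀ j, Differentiable ℂ (f j)) (hr : 0 < r)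
    (hψ : Continuous ψ) (hψc : HasCompactSupport ψ) (hψ0 : ∀ z, 0 ≤ ψ z)
    (hψr : tsupport ψ ⊆ puncturedDisk r) :
    Tendsto (fun n : ℕ => ∫ a, ∫ z, ψ z ∂(countingDivisor r n (randomPoly f n a)) ∂(coeffLaw ℓ n))
      atTop (𝓝 ((∫ z, (Real.log (r / ‖z‖) * (absF f z * Xi (absF f z) *
        ddbarDensity (fun w => Real.log (absF f w)) z)) * ψ z) +
        ∫ z, Real.log (r / ‖z‖) * ψ z ∂(formMeasure (curveC f) (argForm f)))) := by
  have hΨ := continuous_mul_log hr hψ hψr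
  have hΨc := hasCompactSupport_mul_log hψc r
  have hΨ0 := mul_log_nonneg hψ0 hψr
  obtain ⟨J, hJ0, hJ, hJe⟩ := exists_tendsto_integral_meanDegreeDeriv hf hΨ hΨc hΨ0
  have h2 := tendsto_integral_logDerivGeom hf hΨ hΨc hΨ0
  have eJ : ∫ z, Real.log (r / ‖z‖) * ψ z ∂(formMeasure (curveC f) (argForm f)) = J := by
    simp_rw [mul_comm (Real.log _)]
    rw [integral_eq_lintegral_of_nonneg_ae (Eventually.of_forall hΨ0) hΨ.aestronglyMeasurable,
      ← hJe, ENNReal.toReal_ofReal hJ0]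
  have eL : ∫ z, (Real.log (r / ‖z‖) * (absF f z * Xi (absF f z) *
        ddbarDensity (fun w => Real.log (absF f w)) z)) * ψ z =
      1 / Real.pi * ∫ z, ψ z * Real.log (r / ‖z‖) * (logDerivGeomLim (sqF f z) *
        (sqDerivF f z - ‖crossF f z‖ ^ 2 / sqF f z)) := by
    rw [← integral_const_mul]
    refine integral_congr_ae (Eventually.of_forall fun z => ?_)
    simp only [absF_mul_Xi_mul_ddbarDensity hf]
    ring
  have h := (h2.const_mul (1 / Real.pi)).add (hJ.const_mul (1 / Real.pi))
  rw [← mul_assoc (1 / Real.pi) Real.pi, one_div_mul_cancel Real.pi_ne_zero, one_mul] at h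
  rw [eL, eJ]
  refine h.congr' ?_
  filter_upwards [eventually_gt_atTop 0] with n hn
  rw [integral_integral_countingDivisor hf n hr hψ hψc hψ0 hψr]
  have hi2 := (integrable_mul_mul_sub hf hΨ hΨc hΨ0 (measurable_logDerivGeom_sqF hf n)
      (fun z => logDerivGeom_nonneg n (sqF_nonneg f z))
      (fun z => logDerivGeom_le_one n (sqF_nonneg f z))).const_mul (1 / Real.pi)
  rw [← integral_const_mul, ← integral_const_mul, eq_comm, ← sub_eq_iff_eq_add',
    ← integral_sub (integrable_mul_log_mul_expectedDensity hf n hr hψ hψc hψr) hi2]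
  refine integral_congr_ae (Eventually.of_forall fun z => ?_)
  simp only [expectedDensity_eq hf hn]
  ring

/-- The assertions of the limit theorem for one test function `φ`. -/
def IsLimitTestFunction (f : Fin ℓ → ℂ → ℂ) (r : ℝ) (φ : ℂ → ℂ) : Prop :=
  (∀ (n : ℕ) (a : MultiIndex ℓ n → ℂ), Integrable φ (countingDivisor r n (randomPoly f n a))) ∧
  (∀ n : ℕ, Integrable (fun a => ∫ z, φ z ∂(countingDivisor r n (randomPoly f n a)))
    (coeffLaw ℓ n)) ∧
  Integrable (fun z : ℂ => (Real.log (r / ‖z‖) * (absF f z * Xi (absF f z) *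
    ddbarDensity (fun w => Real.log (absF f w)) z)) • φ z) volume ∧
  Integrable (fun z : ℂ => Real.log (r / ‖z‖) • φ z) (formMeasure (curveC f) (argForm f)) ∧
  Tendsto (fun n : ℕ => ∫ a, (∫ z, φ z ∂(countingDivisor r n (randomPoly f n a))) ∂(coeffLaw ℓ n))
    atTop (𝓝 ((∫ z : ℂ, (Real.log (r / ‖z‖) * (absF f z * Xi (absF f z) *
        ddbarDensity (fun w => Real.log (absF f w)) z)) • φ z) +
      ∫ z : ℂ, Real.log (r / ‖z‖) • φ z ∂(formMeasure (curveC f) (argForm f))))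

lemma isLimitTestFunction_ofReal (hf : ∀ j, Differentiable ℂ (f j)) (hr : 0 < r)
    (hψ : Continuous ψ) (hψc : HasCompactSupport ψ) (hψ0 : ∀ z, 0 ≤ ψ z)
    (hψr : tsupport ψ ⊆ puncturedDisk r) :
    IsLimitTestFunction f r fun z => (ψ z : ℂ) := by
  have h1 := fun n (a : MultiIndex ℓ n → ℂ) =>
    integrable_countingDivisor r n (differentiable_randomPoly hf n a) hψ hψc
  have h2 := fun n => integrable_integral_countingDivisor hf n hr hψ hψc hψ0 hψr
  have h3 := integrable_log_mul_absF hf hr hψ hψc hψ0 hψr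
  have h4 := integrable_log_mul_formMeasure hf hr hψ hψc hψ0 hψr
  have h5 := tendsto_integral_countingDivisor hf hr hψ hψc hψ0 hψr
  unfold IsLimitTestFunction
  simp only [Complex.real_smul, ← Complex.ofReal_mul, integral_complex_ofReal, ← Complex.ofReal_add]
  exact ⟨fun n a => (h1 n a).ofReal, fun n => (h2 n).ofReal, h3.ofReal, h4.ofReal,
    (Complex.continuous_ofReal.tendsto _).comp h5⟩

lemma IsLimitTestFunction.add {φ₁ φ₂ : ℂ → ℂ} (h₁ : IsLimitTestFunction f r φ₁)
    (h₂ : IsLimitTestFunction f r φ₂) : IsLimitTestFunction f r fun z => φ₁ z + φ₂ z := by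
  obtain ⟨a1, a2, a3, a4, a5⟩ := h₁
  obtain ⟨b1, b2, b3, b4, b5⟩ := h₂
  have e : ∀ (n : ℕ) (a : MultiIndex ℓ n → ℂ), _ := fun n a => integral_add (a1 n a) (b1 n a)
  unfold IsLimitTestFunction
  simp only [e, smul_add]
  refine ⟨fun n a => (a1 n a).add (b1 n a), fun n => (a2 n).add (b2 n), a3.add b3, a4.add b4, ?_⟩
  rw [integral_add a3 b3, integral_add a4 b4, add_add_add_comm]
  exact (a5.add b5).congr fun n => (integral_add (a2 n) (b2 n)).symm

lemma IsLimitTestFunction.const_mul {φ : ℂ → ℂ} (h : IsLimitTestFunction f r φ) (c : ℂ) :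
    IsLimitTestFunction f r fun z => c * φ z := by
  obtain ⟨a1, a2, a3, a4, a5⟩ := h
  unfold IsLimitTestFunction
  simp only [integral_const_mul, ← mul_smul_comm, ← mul_add]
  exact ⟨fun n a => (a1 n a).const_mul c, fun n => (a2 n).const_mul c, a3.const_mul c,
    a4.const_mul c, a5.const_mul c⟩

lemma isLimitTestFunction_of_real (hf : ∀ j, Differentiable ℂ (f j)) (hr : 0 < r)
    (hψ : Continuous ψ) (hψc : HasCompactSupport ψ) (hψr : tsupport ψ ⊆ puncturedDisk r) :
    IsLimitTestFunction f r fun z => (ψ z : ℂ) := by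
  have key : ∀ g : ℝ → ℝ, Continuous g → (∀ x, 0 ≤ g x) → g 0 = 0 →
      IsLimitTestFunction f r fun z => (g (ψ z) : ℂ) := fun g hg hg0 hg00 =>
    isLimitTestFunction_ofReal hf hr (hg.comp hψ) (hψc.comp_left hg00) (fun z => hg0 _)
      ((closure_mono (Function.support_comp_subset hg00 ψ)).trans hψr)
  have h := (key (fun x => max x 0) (continuous_id.max continuous_const)
    (fun x => le_max_right _ _) (max_self 0)).add ((key (fun x => max (-x) 0)
      (continuous_neg.max continuous_const) (fun x => le_max_right _ _) (by simp)).const_mul (-1))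
  convert h using 2 with z
  rw [neg_one_mul, ← sub_eq_add_neg, ← Complex.ofReal_sub, max_zero_sub_max_neg_zero_eq_self]

lemma isLimitTestFunction (hf : ∀ j, Differentiable ℂ (f j)) (hr : 0 < r) {φ : ℂ → ℂ}
    (hφ : Continuous φ) (hφc : HasCompactSupport φ) (hφr : tsupport φ ⊆ puncturedDisk r) :
    IsLimitTestFunction f r φ := by
  have key : ∀ L : ℂ → ℝ, Continuous L → L 0 = 0 → IsLimitTestFunction f r fun z => (L (φ z) : ℂ) :=
    fun L hL hL0 => isLimitTestFunction_of_real hf hr (hL.comp hφ) (hφc.comp_left hL0)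
      ((closure_mono (Function.support_comp_subset hL0 φ)).trans hφr)
  have h := (key Complex.re Complex.continuous_re Complex.zero_re).add
    ((key Complex.im Complex.continuous_im Complex.zero_im).const_mul Complex.I)
  convert h using 2 with z
  rw [mul_comm, Complex.re_add_im]

end Assembly

end RandomEntire

theorem mainTheorem1 (ℓ : ℕ) (f : Fin ℓ → ℂ → ℂ) (hf : ∀ j, Differentiable ℂ (f j))
    (r : ℝ) (hr : 0 < r)
    (φ : ℂ → ℂ) (hφ : Continuous φ) (hφc : HasCompactSupport φ)
    (hφr : tsupport φ ⊆ RandomEntire.puncturedDisk r) :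
    (∀ (n : ℕ) (a : RandomEntire.MultiIndex ℓ n → ℂ),
      Integrable φ (RandomEntire.countingDivisor r n (RandomEntire.randomPoly f n a))) ∧
    (∀ n : ℕ, Integrable
      (fun a => ∫ z, φ z ∂(RandomEntire.countingDivisor r n (RandomEntire.randomPoly f n a)))
      (RandomEntire.coeffLaw ℓ n)) ∧
    Integrable (fun z : ℂ =>
      (Real.log (r / ‖z‖) * (RandomEntire.absF f z * RandomEntire.Xi (RandomEntire.absF f z) *
        RandomEntire.ddbarDensity (fun w => Real.log (RandomEntire.absF f w)) z)) • φ z) volume ∧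
    Integrable (fun z : ℂ => Real.log (r / ‖z‖) • φ z)
      (RandomEntire.formMeasure (RandomEntire.curveC f) (RandomEntire.argForm f)) ∧
    Tendsto
      (fun n : ℕ => ∫ a,
        (∫ z, φ z ∂(RandomEntire.countingDivisor r n (RandomEntire.randomPoly f n a)))
        ∂(RandomEntire.coeffLaw ℓ n))
      atTop
      (𝓝 ((∫ z : ℂ,
          (Real.log (r / ‖z‖) * (RandomEntire.absF f z * RandomEntire.Xi (RandomEntire.absF f z) *
            RandomEntire.ddbarDensity (fun w => Real.log (RandomEntire.absF f w)) z)) • φ z) +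
        ∫ z : ℂ, Real.log (r / ‖z‖) • φ z
          ∂(RandomEntire.formMeasure (RandomEntire.curveC f) (RandomEntire.argForm f)))) :=
  RandomEntire.isLimitTestFunction hf hr hφ hφc hφr
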